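/- Let $G\rightrightarrows M$ be a Lie groupoid with source $\alpha$, target $\beta$, identity map $\epsilon$, inversion $i$ and product $gh$ (defined when $(g,h)\in G_2$, i.e. $\beta(g)=\alpha(h)$), $\dim M=n$, $\dim G=n+m$; all manifolds and maps are $C^\infty$. Let $\tau:AG\to M$ be its Lie algebroid, $A_xG=\ker T_{\epsilon(x)}\alpha$, and for $X\in\Gamma(\tau)$ let $\overleftarrow X(g)=T_{\epsilon(\beta(g))}l_g\,(X(\beta(g)))$ and $\overrightarrow X(g)=-T_{\epsilon(\alpha(g))}r_g\,(T_{\epsilon(\alpha(g))}i\,(X(\alpha(g))))$ be the associated left- and right-invariant vector fields ($l_g$, $r_g$ the left and right translations by $g$). Let $L_d:G\to\mathbb R$ be a smooth discrete Lagrangian. A pair $(g,h)$ is a solution of the discrete Euler–Lagrange equations if $(g,h)\in G_2$ and $\overleftarrow X(g)(L_d)-\overrightarrow X(h)(L_d)=0$ for all $X\in\Gamma(\tau)$. Let $\Omega_{L_d}=-d\Theta^-_{L_d}$ be the Poincaré–Cartan 2-section on the Lie algebroid $P^\tau G=V\beta\oplus V\alpha\to G$ (where $V\alpha=\ker T\alpha$,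 $V\beta=\ker T\beta$, the anchor is $(v,w)\mapsto v+w$, the bracket is determined by $[\![(\overrightarrow X,\overleftarrow Y),(\overrightarrow{X'},\overleftarrow{Y'})]\!]=([\overrightarrow X,\overrightarrow{X'}],[\overleftarrow Y,\overleftarrow{Y'}])$, and $\Theta^-_{L_d}(v,w)=-v(L_d)$). Let $\mathbb F^-L_d:G\to A^*G$ be the discrete Legendre transformation $(\mathbb F^-L_d)(h)(v)=-v(L_d\circ r_h\circ i)$, $v\in A_{\alpha(h)}G$. Let $(g_0,h_0)$ be a solution and $x_0=\beta(g_0)=\alpha(h_0)$. Let $(x,u)=(x^i,u^\gamma)$ be local coordinates on an open set $\mathcal U\ni\epsilon(x_0)$ of $G$ and $(x^i)$ local coordinates on an open set $V\supseteq\alpha(\mathcal U)$ of $M$, such that $\alpha$ reads $(x,u)\mapsto x$ and the identities lying in $\mathcal U$ have coordinates $(x,0)$. Let $\mathcal W\subseteq\mathcal U$ be a symmetric neighborhood of $\epsilon(x_0)$: $\mathcal W$ is open, $\epsilon(x_0)\in\mathcal W$, $\epsilon(\alpha(\mathcal W))\subseteq\mathcal W$, $\epsilon(\beta(\mathcal W))\subseteq\mathcal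 W$, $i(\mathcal W)=\mathcal W$, and $gh\in\mathcal U$ for all composable $g,h\in\mathcal W$. Let $\Sigma_0\ni g_0$ and $\Upsilon_0\ni h_0$ be local bisections of $G$ (submanifolds which $\alpha$ and $\beta$ each map diffeomorphically onto an open subset of $M$), such that the sections $(\Sigma_0)_\beta=(\beta|_{\Sigma_0})^{-1}$ and $(\Upsilon_0)_\alpha=(\alpha|_{\Upsilon_0})^{-1}$ are defined on $V$. Put $L_{\Sigma_0}(g)=(\Sigma_0)_\beta(\alpha(g))\,g$, $R_{\Upsilon_0}(g)=g\,(\Upsilon_0)_\alpha(\beta(g))$, $\mathcal W_{\Sigma_0}=L_{\Sigma_0}(\mathcal W)\ni g_0$ and $\mathcal W_{\Upsilon_0}=R_{\Upsilon_0}(\mathcal W)\ni h_0$. Let $\mathsf b(x,u)$ be the coordinate expression of $\beta$ and define $\mathsf p$ by $(x,u)\cdot(\mathsf b(x,u),v)=(x,\mathsf p(x,u,v))$. Put $\rho^i_\gamma(x)=\frac{\partial\mathsf b^i}{\partial u^\gamma}(x,0)$ and $R^\nu_\mu(x,v)=\frac{\partial\mathsf p^\nu}{\partial u^\mu}(x,0,v)$,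 write $\ell(x,u)$ for $L_d\circ R_{\Upsilon_0}$ in coordinates, and let $$(\mathbb FL_d)^\gamma_\mu(x,u)=\rho^i_\mu(x)\frac{\partial^2\ell}{\partial x^i\partial u^\gamma}(x,u)-\frac{\partial R^\nu_\mu}{\partial u^\gamma}(x,u)\frac{\partial\ell}{\partial u^\nu}(x,u)-R^\nu_\mu(x,u)\frac{\partial^2\ell}{\partial u^\nu\partial u^\gamma}(x,u)$$ (summation over repeated indices). Then the following statements are equivalent: (i) the matrix $(\mathbb FL_d)^\gamma_\mu(x_0,0)$ is regular; (ii) the Poincaré–Cartan 2-section $\Omega_{L_d}$ is nondegenerate at the point $h_0$; (iii) the map $\mathbb F^-L_d$ is a local diffeomorphism at $h_0$. Any of them implies the following: there exist open neighborhoods $\widetilde{\mathcal W}_{\Sigma_0}\subseteq\mathcal W_{\Sigma_0}$ of $g_0$ and $\widetilde{\mathcal W}_{\Upsilon_0}\subseteq\mathcal W_{\Upsilon_0}$ of $h_0$ such that for every $g\in\widetilde{\mathcal W}_{\Sigma_0}$ there is a unique $\Psi(g)=h\in\widetilde{\mathcal W}_{\Upsilon_0}$ for which $(g,h)$ is a solution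 of the discrete Euler–Lagrange equations for $L_d$; and the map $\Psi:\widetilde{\mathcal W}_{\Sigma_0}\to\widetilde{\mathcal W}_{\Upsilon_0}$ is a local discrete Euler–Lagrange evolution operator, i.e. it is smooth and $(g,\Psi(g))$ is a solution for every $g\in\widetilde{\mathcal W}_{\Sigma_0}$. -/

import Mathlib

open scoped Manifold ContDiff

/-- A Lie groupoid `G ⇉ M` with `dim M = n` and `dim G = n + m`.  The product `mul g h` is
meaningful only for composable pairs, i.e. `tgt g = src h`; all axioms concern such pairs only
(the value of the total function `mul` on other pairs is irrelevant). Smoothness of the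
multiplication is smoothness on the submanifold `G₂ = {(g, h) | tgt g = src h}` of `G × G`. -/
structure LieGroupoid (n m : ℕ) (G M : Type*)
    [TopologicalSpace G] [ChartedSpace (EuclideanSpace ℝ (Fin (n + m))) G]
    [IsManifold (𝓡 (n + m)) ∞ G]
    [TopologicalSpace M] [ChartedSpace (EuclideanSpace ℝ (Fin n)) M]
    [IsManifold (𝓡 n) ∞ M] where
  /-- the source map `α` -/
  src : G → M
  /-- the target map `β` -/
  tgt : G → M
  /-- the multiplication `m` (for composable pairs) -/
  mul : G → G → G
  /-- the identity map `ε` -/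
  unit : M → G
  /-- the inversion `i` -/
  inv : G → G
  src_mul : ∀ g h, tgt g = src h → src (mul g h) = src g
  tgt_mul : ∀ g h, tgt g = src h → tgt (mul g h) = tgt h
  mul_assoc : ∀ g h k, tgt g = src h → tgt h = src k → mul g (mul h k) = mul (mul g h) k
  src_unit : ∀ x, src (unit x) = x
  tgt_unit : ∀ x, tgt (unit x) = x
  unit_mul : ∀ g, mul (unit (src g)) g = g
  mul_unit : ∀ g, mul g (unit (tgt g)) = g
  src_inv : ∀ g, src (inv g) = tgt g
  tgt_inv : ∀ g, tgt (inv g) = src g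
  inv_mul : ∀ g, mul (inv g) g = unit (tgt g)
  mul_inv : ∀ g, mul g (inv g) = unit (src g)
  submersion_src : Manifold.IsSubmersion (𝓡 (n + m)) (𝓡 n) ∞ src
  submersion_tgt : Manifold.IsSubmersion (𝓡 (n + m)) (𝓡 n) ∞ tgt
  contMDiff_unit : ContMDiff (𝓡 n) (𝓡 (n + m)) ∞ unit
  contMDiff_inv : ContMDiff (𝓡 (n + m)) (𝓡 (n + m)) ∞ inv
  contMDiffOn_mul : ContMDiffOn ((𝓡 (n + m)).prod (𝓡 (n + m))) (𝓡 (n + m)) ∞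
    (fun p : G × G => mul p.1 p.2) {p | tgt p.1 = src p.2}

namespace LieGroupoid

variable {n m : ℕ} {G M : Type*}
  [TopologicalSpace G] [ChartedSpace (EuclideanSpace ℝ (Fin (n + m))) G]
  [IsManifold (𝓡 (n + m)) ∞ G]
  [TopologicalSpace M] [ChartedSpace (EuclideanSpace ℝ (Fin n)) M]
  [IsManifold (𝓡 n) ∞ M]
  (𝒢 : LieGroupoid n m G M)

/-! ### The Lie algebroid and invariant vector fields -/

/-- The vertical space `V_g α = ker T_g α` of the source map. -/
noncomputable def vertSrc (g : G) : Submodule ℝ (TangentSpace (𝓡 (n + m)) g) :=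
  LinearMap.ker (mfderiv (𝓡 (n + m)) (𝓡 n) 𝒢.src g).toLinearMap

/-- The vertical space `V_g β = ker T_g β` of the target map. -/
noncomputable def vertTgt (g : G) : Submodule ℝ (TangentSpace (𝓡 (n + m)) g) :=
  LinearMap.ker (mfderiv (𝓡 (n + m)) (𝓡 n) 𝒢.tgt g).toLinearMap

/-- The fibre `A_x G = ker T_{ε(x)} α` of the Lie algebroid `AG → M`. -/
noncomputable abbrev algFiber (x : M) : Submodule ℝ (TangentSpace (𝓡 (n + m)) (𝒢.unit x)) :=
  𝒢.vertSrc (𝒢.unit x)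

/-- A family of vectors of `AG` over (a subset of) `M`, seen as a map into `TG`. -/
noncomputable def sectionMap (X : ∀ x : M, 𝒢.algFiber x) (x : M) : TangentBundle (𝓡 (n + m)) G :=
  ⟨𝒢.unit x, (X x : TangentSpace (𝓡 (n + m)) (𝒢.unit x))⟩

/-- Smooth global sections of the Lie algebroid: the elements of `Γ(τ)`, `τ : AG → M`. -/
structure AlgSection where
  toFun : ∀ x : M, 𝒢.algFiber x
  contMDiff : ContMDiff (𝓡 n) (𝓡 (n + m)).tangent ∞ (𝒢.sectionMap toFun)

/-- The left-invariant vector field `X^←(g) = (T_{ε(β(g))} l_g)(X(β(g)))`, where the left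
translation `l_g : h ↦ g h` is a map on the fibre `α⁻¹(β(g))`. The vector `X(β(g))` is tangent to
this fibre, so the derivative of `l_g` within the fibre has a well-defined value on it. -/
noncomputable def leftField (X : 𝒢.AlgSection) (g : G) : TangentSpace (𝓡 (n + m)) g :=
  (mfderivWithin (𝓡 (n + m)) (𝓡 (n + m)) (fun h => 𝒢.mul g h)
    (𝒢.src ⁻¹' {𝒢.tgt g}) (𝒢.unit (𝒢.tgt g)))
      (X.toFun (𝒢.tgt g) : TangentSpace (𝓡 (n + m)) (𝒢.unit (𝒢.tgt g)))

/-- The right-invariant vector field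
`X^→(g) = -(T_{ε(α(g))} r_g)((T_{ε(α(g))} i)(X(α(g))))`, where the right translation
`r_g : h ↦ h g` is a map on the fibre `β⁻¹(α(g))`. -/
noncomputable def rightField (X : 𝒢.AlgSection) (g : G) : TangentSpace (𝓡 (n + m)) g :=
  -((mfderivWithin (𝓡 (n + m)) (𝓡 (n + m)) (fun h => 𝒢.mul h g)
    (𝒢.tgt ⁻¹' {𝒢.src g}) (𝒢.unit (𝒢.src g)))
      ((mfderiv (𝓡 (n + m)) (𝓡 (n + m)) 𝒢.inv (𝒢.unit (𝒢.src g)))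
        (X.toFun (𝒢.src g) : TangentSpace (𝓡 (n + m)) (𝒢.unit (𝒢.src g)))))

/-- The derivative `v(f)` of a function `f` along a tangent vector `v` at `g`. -/
noncomputable def vecAct (f : G → ℝ) (g : G) (v : TangentSpace (𝓡 (n + m)) g) : ℝ :=
  mfderiv (𝓡 (n + m)) 𝓘(ℝ, ℝ) f g v

/-! ### Discrete Euler-Lagrange equations -/

/-- `(g, h)` is composable and solves the discrete Euler-Lagrange equations for `L`:
`X^←(g)(L) - X^→(h)(L) = 0` for every section `X` of `AG`. -/
def IsDELSolution (L : G → ℝ) (g h : G) : Prop :=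
  𝒢.tgt g = 𝒢.src h ∧
    ∀ X : 𝒢.AlgSection, vecAct L g (𝒢.leftField X g) - vecAct L h (𝒢.rightField X h) = 0

/-- A local discrete Euler-Lagrange evolution operator `Ψ : A → B` for `L`. -/
def IsLocalEvolutionOperator (L : G → ℝ) (A B : Set G) (Ψ : G → G) : Prop :=
  ContMDiffOn (𝓡 (n + m)) (𝓡 (n + m)) ∞ Ψ A ∧ Set.MapsTo Ψ A B ∧
    ∀ g ∈ A, 𝒢.IsDELSolution L g (Ψ g)

/-! ### The Poincaré-Cartan 2-section -/

/-- The fibre at `g` of the Lie algebroid `P^τ G = Vβ ⊕ Vα → G`. -/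
noncomputable abbrev PFiber (g : G) : Type _ := 𝒢.vertTgt g × 𝒢.vertSrc g

/-- The Poincaré-Cartan 1-section `Θ⁻_L(g)(v, w) = -v(L)`, as a function of the components of an
element of `V_g β ⊕ V_g α`. -/
noncomputable def thetaMinus (L : G → ℝ) (g : G) (v _w : TangentSpace (𝓡 (n + m)) g) : ℝ :=
  -vecAct L g v

/-- The value at `g` of `dΘ⁻_L(Z, Z')` on the sections `Z = (X^→, Y^←)` and
`Z' = (X'^→, Y'^←)` of `P^τ G`, where `d` is the Lie algebroid differential
`dΘ(Z, Z') = ρ(Z)(Θ(Z')) - ρ(Z')(Θ(Z)) - Θ(⟦Z, Z'⟧)`, the anchor is `ρ(v, w) = v + w`, and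
`⟦Z, Z'⟧ = ([X^→, X'^→], [Y^←, Y'^←]) = (-⟦X, X'⟧^→, ⟦Y, Y'⟧^←)`. -/
noncomputable def dThetaMinus (L : G → ℝ) (X Y X' Y' : 𝒢.AlgSection) (g : G) : ℝ :=
  vecAct (fun k => thetaMinus L k (𝒢.rightField X' k) (𝒢.leftField Y' k)) g
      (𝒢.rightField X g + 𝒢.leftField Y g)
    - vecAct (fun k => thetaMinus L k (𝒢.rightField X k) (𝒢.leftField Y k)) g
      (𝒢.rightField X' g + 𝒢.leftField Y' g)
    - thetaMinus L g
      (VectorField.mlieBracket (𝓡 (n + m)) (𝒢.rightField X) (𝒢.rightField X') g)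
      (VectorField.mlieBracket (𝓡 (n + m)) (𝒢.leftField Y) (𝒢.leftField Y') g)

/-- `Ω` is the value at `g` of the Poincaré-Cartan 2-section `Ω_L = -dΘ⁻_L`. It is determined by
its values on the sections `(X^→, Y^←)` with `X, Y ∈ Γ(τ)`, as these span the fibre. -/
def IsPoincareCartanAt (L : G → ℝ) (g : G) (Ω : LinearMap.BilinForm ℝ (𝒢.PFiber g)) : Prop :=
  ∀ (X Y X' Y' : 𝒢.AlgSection) (z z' : 𝒢.PFiber g),
    (z.1 : TangentSpace (𝓡 (n + m)) g) = 𝒢.rightField X g →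
    (z.2 : TangentSpace (𝓡 (n + m)) g) = 𝒢.leftField Y g →
    (z'.1 : TangentSpace (𝓡 (n + m)) g) = 𝒢.rightField X' g →
    (z'.2 : TangentSpace (𝓡 (n + m)) g) = 𝒢.leftField Y' g →
      Ω z z' = -𝒢.dThetaMinus L X Y X' Y' g

/-- The Poincaré-Cartan 2-section `Ω_L` is nondegenerate at the point `g`. -/
def PoincareCartanNondegenerateAt (L : G → ℝ) (g : G) : Prop :=
  ∃ Ω : LinearMap.BilinForm ℝ (𝒢.PFiber g), 𝒢.IsPoincareCartanAt L g Ω ∧ Ω.Nondegenerate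

/-! ### The dual bundle `A*G` and the Legendre transformation -/

/-- The total space of the dual bundle `A*G → M`. -/
abbrev DualBundle : Type _ := Σ x : M, Module.Dual ℝ (𝒢.algFiber x)

/-- A smooth local frame of `AG` over the open set `V ⊆ M` (values outside `V` are irrelevant). -/
structure LocalFrame where
  base : Set M
  isOpen_base : IsOpen base
  e : Fin m → ∀ x : M, 𝒢.algFiber x
  contMDiffOn : ∀ γ, ContMDiffOn (𝓡 n) (𝓡 (n + m)).tangent ∞ (𝒢.sectionMap (e γ)) base
  linearIndependent : ∀ x ∈ base, LinearIndependent ℝ fun γ => e γ x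
  span_eq_top : ∀ x ∈ base, Submodule.span ℝ (Set.range fun γ => e γ x) = ⊤

/-- The local trivialization `A*G|_V → V × ℝ^m`, `ξ_x ↦ (x, (ξ_x(e_γ(x)))_γ)`, given by a local
frame. The manifold structure of `A*G` is the one for which these are diffeomorphisms. -/
noncomputable def LocalFrame.dualTriv {𝒢 : LieGroupoid n m G M} (F : 𝒢.LocalFrame) (ξ : 𝒢.DualBundle) :
    M × (Fin m → ℝ) :=
  (ξ.1, fun γ => ξ.2 (F.e γ ξ.1))

/-- A map `f : G → A*G` is a local diffeomorphism at `g`, for the manifold structure of `A*G`. -/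
def IsLocalDiffeoToDualAt (f : G → 𝒢.DualBundle) (g : G) : Prop :=
  ∃ F : 𝒢.LocalFrame, (f g).1 ∈ F.base ∧
    IsLocalDiffeomorphAt (𝓡 (n + m)) ((𝓡 n).prod 𝓘(ℝ, Fin m → ℝ)) ∞ (fun k => F.dualTriv (f k)) g

/-- The discrete Legendre transformation `𝔽⁻L : G → A*G`,
`(𝔽⁻L)(h)(v) = -v(L ∘ r_h ∘ i)` for `v ∈ A_{α(h)} G`; here `r_h ∘ i : k ↦ k⁻¹ h` is a map on the
fibre `α⁻¹(α(h))`, to which `v` is tangent. -/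
noncomputable def legendreMinus (L : G → ℝ) (h : G) : 𝒢.DualBundle :=
  ⟨𝒢.src h,
    -((mfderivWithin (𝓡 (n + m)) 𝓘(ℝ, ℝ) (fun k => L (𝒢.mul (𝒢.inv k) h))
        (𝒢.src ⁻¹' {𝒢.src h}) (𝒢.unit (𝒢.src h))).toLinearMap.comp
      (𝒢.algFiber (𝒢.src h)).subtype)⟩

/-! ### Symmetric neighbourhoods, bisections and local coordinates -/

/-- `W` is a symmetric neighbourhood associated with the open set `U` and the point `x₀`. -/
structure IsSymmetricNhd (U : Set G) (x₀ : M) (W : Set G) : Prop where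
  isOpen : IsOpen W
  subset : W ⊆ U
  unit_mem : 𝒢.unit x₀ ∈ W
  unit_src : ∀ g ∈ W, 𝒢.unit (𝒢.src g) ∈ W
  unit_tgt : ∀ g ∈ W, 𝒢.unit (𝒢.tgt g) ∈ W
  image_inv : 𝒢.inv '' W = W
  mul_mem : ∀ g ∈ W, ∀ h ∈ W, 𝒢.tgt g = 𝒢.src h → 𝒢.mul g h ∈ U

/-- A local bisection `Σ ⊆ G`: the restrictions `α|_Σ : Σ → dom` and `β|_Σ : Σ → cod` are
diffeomorphisms onto open subsets of `M`, with inverses the smooth local sections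
`Σ_α = secSrc` of `α` and `Σ_β = secTgt` of `β`. (The image of a smooth local section of `α` is
automatically an embedded submanifold.) -/
structure LocalBisection where
  carrier : Set G
  dom : Set M
  cod : Set M
  isOpen_dom : IsOpen dom
  isOpen_cod : IsOpen cod
  secSrc : M → G
  secTgt : M → G
  contMDiffOn_secSrc : ContMDiffOn (𝓡 n) (𝓡 (n + m)) ∞ secSrc dom
  contMDiffOn_secTgt : ContMDiffOn (𝓡 n) (𝓡 (n + m)) ∞ secTgt cod
  src_secSrc : ∀ x ∈ dom, 𝒢.src (secSrc x) = x
  tgt_secTgt : ∀ y ∈ cod, 𝒢.tgt (secTgt y) = y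
  image_secSrc : secSrc '' dom = carrier
  image_secTgt : secTgt '' cod = carrier

/-- Left translation `L_Σ : α⁻¹(cod) → α⁻¹(dom)`, `g ↦ Σ_β(α(g)) g`. -/
def LocalBisection.leftTrans {𝒢 : LieGroupoid n m G M} (S : 𝒢.LocalBisection) (g : G) : G :=
  𝒢.mul (S.secTgt (𝒢.src g)) g

/-- Right translation `R_Σ : β⁻¹(dom) → β⁻¹(cod)`, `g ↦ g Σ_α(β(g))`. -/
def LocalBisection.rightTrans {𝒢 : LieGroupoid n m G M} (S : 𝒢.LocalBisection) (g : G) : G :=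
  𝒢.mul g (S.secSrc (𝒢.tgt g))

/-- Local coordinates `(x, u)` on an open set `U = coord.source ∋ ε(x₀)` of `G` and `x` on an open
set `V = baseCoord.source ⊇ α(U)` of `M`, such that `α` is `(x, u) ↦ x` and the identities in `U`
are the elements `(x, 0)`. -/
structure AdaptedCoordinates (x₀ : M) where
  coord : OpenPartialHomeomorph G ((Fin n → ℝ) × (Fin m → ℝ))
  baseCoord : OpenPartialHomeomorph M (Fin n → ℝ)
  contMDiffOn_coord :
    ContMDiffOn (𝓡 (n + m)) 𝓘(ℝ, (Fin n → ℝ) × (Fin m → ℝ)) ∞ coord coord.source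
  contMDiffOn_coord_symm :
    ContMDiffOn 𝓘(ℝ, (Fin n → ℝ) × (Fin m → ℝ)) (𝓡 (n + m)) ∞ coord.symm coord.target
  contMDiffOn_baseCoord :
    ContMDiffOn (𝓡 n) 𝓘(ℝ, Fin n → ℝ) ∞ baseCoord baseCoord.source
  contMDiffOn_baseCoord_symm :
    ContMDiffOn 𝓘(ℝ, Fin n → ℝ) (𝓡 n) ∞ baseCoord.symm baseCoord.target
  unit_mem : 𝒢.unit x₀ ∈ coord.source
  src_mem : ∀ g ∈ coord.source, 𝒢.src g ∈ baseCoord.source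
  coord_fst : ∀ g ∈ coord.source, (coord g).1 = baseCoord (𝒢.src g)
  coord_unit : ∀ x, 𝒢.unit x ∈ coord.source → coord (𝒢.unit x) = (baseCoord x, 0)

/-- The partial derivative `∂f/∂x^i` of a function of `(x, u)`. -/
noncomputable def pdx (i : Fin n) (f : (Fin n → ℝ) × (Fin m → ℝ) → ℝ)
    (z : (Fin n → ℝ) × (Fin m → ℝ)) : ℝ :=
  fderiv ℝ f z (Pi.single i 1, 0)

/-- The partial derivative `∂f/∂u^γ` of a function of `(x, u)`. -/
noncomputable def pdu (γ : Fin m) (f : (Fin n → ℝ) × (Fin m → ℝ) → ℝ)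
    (z : (Fin n → ℝ) × (Fin m → ℝ)) : ℝ :=
  fderiv ℝ f z (0, Pi.single γ 1)

namespace AdaptedCoordinates

variable {𝒢} {x₀ : M} (c : 𝒢.AdaptedCoordinates x₀)

/-- The local expression `𝖻(x, u)` of the target map. -/
def b (x : Fin n → ℝ) (u : Fin m → ℝ) : Fin n → ℝ :=
  c.baseCoord (𝒢.tgt (c.coord.symm (x, u)))

/-- The local expression of the product: `(x, u) · (𝖻(x, u), v) = (x, 𝗉(x, u, v))`. -/
def p (x : Fin n → ℝ) (u v : Fin m → ℝ) : Fin m → ℝ :=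
  (c.coord (𝒢.mul (c.coord.symm (x, u)) (c.coord.symm (c.b x u, v)))).2

/-- `ρ^i_γ(x) = ∂𝖻^i/∂u^γ (x, 0)`. -/
noncomputable def rho (i : Fin n) (γ : Fin m) (x : Fin n → ℝ) : ℝ :=
  fderiv ℝ (fun u => c.b x u i) 0 (Pi.single γ 1)

/-- `R^ν_μ(x, v) = ∂𝗉^ν/∂u^μ (x, 0, v)`, as a function of the pair `z = (x, v)`. -/
noncomputable def R (ν μ : Fin m) (z : (Fin n → ℝ) × (Fin m → ℝ)) : ℝ :=
  fderiv ℝ (fun u => c.p z.1 u z.2 ν) 0 (Pi.single μ 1)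

/-- The function `L ∘ R_Υ` in the coordinates `(x, u)`. -/
def lagr (L : G → ℝ) (S : 𝒢.LocalBisection) (z : (Fin n → ℝ) × (Fin m → ℝ)) : ℝ :=
  L (S.rightTrans (c.coord.symm z))

/-- The matrix `(𝔽L)^γ_μ(x, u) = ρ^i_μ(x) ∂²(L∘R_Υ)/∂x^i∂u^γ
- (∂R^ν_μ/∂u^γ) ∂(L∘R_Υ)/∂u^ν - R^ν_μ ∂²(L∘R_Υ)/∂u^ν∂u^γ`, evaluated at `z = (x, u)`. -/
noncomputable def FL (L : G → ℝ) (S : 𝒢.LocalBisection) (z : (Fin n → ℝ) × (Fin m → ℝ)) :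
    Matrix (Fin m) (Fin m) ℝ :=
  Matrix.of fun γ μ =>
    (∑ i, c.rho i μ z.1 * pdx i (pdu γ (c.lagr L S)) z)
      - (∑ ν, pdu γ (c.R ν μ) z * pdu ν (c.lagr L S) z)
      - (∑ ν, c.R ν μ z * pdu ν (pdu γ (c.lagr L S)) z)

end AdaptedCoordinates

end LieGroupoid

/-! Everything is computed in one chart, `transChart`, the map z = (x, u) ↦ R_Υ(x, u), which sends
(x₀, 0) to h₀. If ξ denotes the fibre coordinates of a section X at the source of R_Υ(z), then the
right-invariant field of X reads -`curveDeriv z ξ`, where `curveDeriv z ξ` is the velocity at 0 of k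
↦ k⁻¹·(x, u) along k = (x, tξ). Implicit differentiation (`hasFDerivAt_coord_curve`) gives
`curveDeriv z ξ` = (ρ(x)ξ, -R(x, u)ξ). Consequently the negative of the Legendre transformation is
`rightMomentum` = ρ ∂ℓ/∂x - R ∂ℓ/∂u. Since ρ depends on x only, the derivative of this momentum in u
is exactly the matrix 𝔽L (`fderiv_rightMomentum`). All the claims follow from this identity.

Legendre transformation: in the frame ∂/∂u it is `legendreCoord`, z ↦ (x, -momentum). Its derivative
is block triangular with diagonal blocks the identity and minus the transpose of 𝔽L. A regular
matrix therefore makes it a local diffeomorphism by the inverse function theorem. Conversely, a left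
null vector of 𝔽L gives a direction inside the source fibre which the derivative of the Legendre
transformation kills, whatever frame is used.

Poincaré–Cartan section: on right-invariant fields Θ⁻ is the momentum paired with ξ, and it ignores
the left-invariant component. In dΘ⁻ the derivatives along right-invariant fields cancel against the
bracket term. Only derivatives along left-invariant fields survive; these are u-directions (0, η),
and they produce 𝔽L (`dThetaMinus_transChart`). At u = 0 the u-components (ξ, η) of the two summands
are linear coordinates on the fibre Vβ ⊕ Vα. There Ω is the alternating form with off-diagonal block
𝔽L, hence nondegenerate exactly when 𝔽L is regular.

Evolution operator: (g, R_Υ(z)) is a solution iff `leftCoord g = legendreCoord z`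
(`isDELSolution_iff_leftCoord_eq`); the first components express composability, the second the
equality of momenta. Inverting `legendreCoord` near (x₀, 0) solves this uniquely and smoothly for z.
-/

open scoped Manifold ContDiff Topology

/-! ### Manifold derivatives as maps of model spaces, and derivatives along curves -/

section ModelDerivative

variable {E E' E'' H H' H'' M M' N : Type*}
  [NormedAddCommGroup E] [NormedSpace ℝ E] [NormedAddCommGroup E'] [NormedSpace ℝ E']
  [NormedAddCommGroup E''] [NormedSpace ℝ E'']
  [TopologicalSpace H] [TopologicalSpace H'] [TopologicalSpace H'']
  (I : ModelWithCorners ℝ E H) (I' : ModelWithCorners ℝ E' H') (J : ModelWithCorners ℝ E'' H'')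
  [TopologicalSpace M] [ChartedSpace H M] [TopologicalSpace M'] [ChartedSpace H' M']
  [TopologicalSpace N] [ChartedSpace H'' N]

/-- The derivative `mfderiv` as a linear map between the model vector spaces. -/
noncomputable def mderiv (f : M → M') (x : M) : E →L[ℝ] E' := mfderiv I I' f x

/-- The derivative `mfderivWithin` as a linear map between the model vector spaces. -/
noncomputable def mderivWithin (f : M → M') (s : Set M) (x : M) : E →L[ℝ] E' :=
  mfderivWithin I I' f s x

variable {I I' J}

/-- A derivative within a fibre of α or β need not be determined on the whole ambient tangent space,
but on velocities of families staying in the fibre the chain rule determines it. This is how the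
translations `l_g` and `r_g` are evaluated. The base point enters through the equation `hx`, because
`γ y` usually equals it only after using groupoid identities. -/
theorem mderivWithin_apply_mderiv {f : M → M'} {s : Set M} {γ : N → M} {y : N} {x : M}
    (hx : γ y = x) (hf : MDifferentiableWithinAt I I' f s x) (hγ : MDifferentiableAt J I γ y)
    (hs : ∀ᶠ t in 𝓝 y, γ t ∈ s) (v : E'') :
    mderivWithin I I' f s x (mderiv J I γ y v) = mderiv J I' (f ∘ γ) y v := by
  subst hx
  have h := hf.hasMFDerivWithinAt.comp y (hγ.hasMFDerivAt.hasMFDerivWithinAt (s := γ ⁻¹' s))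
    subset_rfl
  rw [mderiv, mderiv, (h.hasMFDerivAt hs).mfderiv]
  rfl

theorem mderiv_apply_mderiv {f : M → M'} {γ : N → M} {y : N} {x : M} (hx : γ y = x)
    (hf : MDifferentiableAt I I' f x) (hγ : MDifferentiableAt J I γ y) (v : E'') :
    mderiv I I' f x (mderiv J I γ y v) = mderiv J I' (f ∘ γ) y v := by
  subst hx
  rw [mderiv, mderiv, mderiv, mfderiv_comp y hf hγ]
  rfl

theorem Filter.EventuallyEq.mderiv_eq {f g : M → M'} {x : M} (h : f =ᶠ[𝓝 x] g) :
    mderiv I I' f x = mderiv I I' g x := by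
  rw [mderiv, mderiv, h.mfderiv_eq]

theorem mderiv_eq_fderiv {f : E → E'} {x : E} : mderiv 𝓘(ℝ, E) 𝓘(ℝ, E') f x = fderiv ℝ f x :=
  mfderiv_eq_fderiv

theorem mderiv_id {x : M} : mderiv I I (id : M → M) x = ContinuousLinearMap.id ℝ E :=
  mfderiv_id

theorem mderiv_const {x : M} {y : M'} : mderiv I I' (fun _ : M => y) x = 0 :=
  mfderiv_const

end ModelDerivative

/-! ### Groupoid identities and smoothness of products of composable families -/

namespace LieGroupoid

variable {n m : ℕ} {G M : Type*}
  [TopologicalSpace G] [ChartedSpace (EuclideanSpace ℝ (Fin (n + m))) G]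
  [IsManifold (𝓡 (n + m)) ∞ G]
  [TopologicalSpace M] [ChartedSpace (EuclideanSpace ℝ (Fin n)) M]
  [IsManifold (𝓡 n) ∞ M]
  (𝒢 : LieGroupoid n m G M)

theorem mul_inv_cancel_left {g h : G} (e : 𝒢.src g = 𝒢.src h) :
    𝒢.mul g (𝒢.mul (𝒢.inv g) h) = h := by
  rw [𝒢.mul_assoc _ _ _ (𝒢.src_inv g).symm ((𝒢.tgt_inv g).trans e), 𝒢.mul_inv, e, 𝒢.unit_mul]

theorem mul_inv_cancel_right {g h : G} (e : 𝒢.tgt g = 𝒢.src h) :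
    𝒢.mul (𝒢.mul g h) (𝒢.inv h) = g := by
  rw [← 𝒢.mul_assoc _ _ _ e (𝒢.src_inv h).symm, 𝒢.mul_inv, ← e, 𝒢.mul_unit]

theorem inv_mul_cancel_right {g h : G} (e : 𝒢.tgt g = 𝒢.tgt h) :
    𝒢.mul (𝒢.mul g (𝒢.inv h)) h = g := by
  rw [← 𝒢.mul_assoc _ _ _ (e.trans (𝒢.src_inv h).symm) (𝒢.tgt_inv h), 𝒢.inv_mul, ← e,
    𝒢.mul_unit]

theorem inv_unit (x : M) : 𝒢.inv (𝒢.unit x) = 𝒢.unit x := by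
  have h := 𝒢.unit_mul (𝒢.inv (𝒢.unit x))
  rwa [𝒢.src_inv, 𝒢.tgt_unit, 𝒢.mul_inv, 𝒢.src_unit, eq_comm] at h

theorem contMDiff_src : ContMDiff (𝓡 (n + m)) (𝓡 n) ∞ 𝒢.src := 𝒢.submersion_src.contMDiff

theorem contMDiff_tgt : ContMDiff (𝓡 (n + m)) (𝓡 n) ∞ 𝒢.tgt := 𝒢.submersion_tgt.contMDiff

section Smooth

variable {E H N : Type*} [NormedAddCommGroup E] [NormedSpace ℝ E] [TopologicalSpace H]
  {I : ModelWithCorners ℝ E H} [TopologicalSpace N] [ChartedSpace H N]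
  {f g : N → G} {s : Set N} {y : N}

theorem contMDiffWithinAt_mul (hf : ContMDiffWithinAt I (𝓡 (n + m)) ∞ f s y)
    (hg : ContMDiffWithinAt I (𝓡 (n + m)) ∞ g s y) (hs : ∀ t ∈ s, 𝒢.tgt (f t) = 𝒢.src (g t))
    (hy : 𝒢.tgt (f y) = 𝒢.src (g y)) :
    ContMDiffWithinAt I (𝓡 (n + m)) ∞ (fun t => 𝒢.mul (f t) (g t)) s y := by
  have h := 𝒢.contMDiffOn_mul (f y, g y) hy
  exact ContMDiffWithinAt.comp (g := fun p : G × G => 𝒢.mul p.1 p.2) y h (hf.prodMk hg)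
    (fun t ht => hs t ht)

theorem contMDiffOn_mul_of_composable (hf : ContMDiffOn I (𝓡 (n + m)) ∞ f s)
    (hg : ContMDiffOn I (𝓡 (n + m)) ∞ g s) (hs : ∀ t ∈ s, 𝒢.tgt (f t) = 𝒢.src (g t)) :
    ContMDiffOn I (𝓡 (n + m)) ∞ (fun t => 𝒢.mul (f t) (g t)) s := fun y hy =>
  𝒢.contMDiffWithinAt_mul (hf y hy) (hg y hy) hs (hs y hy)

theorem contMDiffAt_mul (hf : ContMDiffAt I (𝓡 (n + m)) ∞ f y)
    (hg : ContMDiffAt I (𝓡 (n + m)) ∞ g y) (hs : ∀ᶠ t in 𝓝 y, 𝒢.tgt (f t) = 𝒢.src (g t)) :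
    ContMDiffAt I (𝓡 (n + m)) ∞ (fun t => 𝒢.mul (f t) (g t)) y := by
  have := 𝒢.contMDiffWithinAt_mul (s := {t | 𝒢.tgt (f t) = 𝒢.src (g t)})
    (hf.contMDiffWithinAt) hg.contMDiffWithinAt (fun _ h => h) hs.self_of_nhds
  exact this.contMDiffAt hs

end Smooth

theorem mdifferentiableWithinAt_mul_left (g : G) :
    MDifferentiableWithinAt (𝓡 (n + m)) (𝓡 (n + m)) (fun h => 𝒢.mul g h)
      (𝒢.src ⁻¹' {𝒢.tgt g}) (𝒢.unit (𝒢.tgt g)) :=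
  (𝒢.contMDiffWithinAt_mul contMDiffWithinAt_const contMDiffWithinAt_id
    (fun _ h => (show _ = _ from h).symm) (𝒢.src_unit _).symm).mdifferentiableWithinAt (by simp)

theorem mdifferentiableWithinAt_mul_right (g : G) :
    MDifferentiableWithinAt (𝓡 (n + m)) (𝓡 (n + m)) (fun h => 𝒢.mul h g)
      (𝒢.tgt ⁻¹' {𝒢.src g}) (𝒢.unit (𝒢.src g)) :=
  (𝒢.contMDiffWithinAt_mul contMDiffWithinAt_id contMDiffWithinAt_const
    (fun _ h => h) (𝒢.tgt_unit _)).mdifferentiableWithinAt (by simp)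

theorem mdifferentiableWithinAt_inv_mul {L : G → ℝ} (hL : ContMDiff (𝓡 (n + m)) 𝓘(ℝ, ℝ) ∞ L)
    (h : G) :
    MDifferentiableWithinAt (𝓡 (n + m)) 𝓘(ℝ, ℝ) (fun k => L (𝒢.mul (𝒢.inv k) h))
      (𝒢.src ⁻¹' {𝒢.src h}) (𝒢.unit (𝒢.src h)) := by
  have := 𝒢.contMDiffWithinAt_mul (s := 𝒢.src ⁻¹' {𝒢.src h}) (y := 𝒢.unit (𝒢.src h))
    (𝒢.contMDiff_inv.contMDiffAt.contMDiffWithinAt) (contMDiffWithinAt_const (c := h))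
    (fun t ht => (𝒢.tgt_inv t).trans ht) ((𝒢.tgt_inv _).trans (𝒢.src_unit _))
  exact ((hL.contMDiffAt.comp_contMDiffWithinAt _ this)).mdifferentiableWithinAt (by simp)

end LieGroupoid

/-! ### Global sections of AG with a prescribed value -/

namespace LieGroupoid

variable {n m : ℕ} {G M : Type*}
  [TopologicalSpace G] [ChartedSpace (EuclideanSpace ℝ (Fin (n + m))) G]
  [IsManifold (𝓡 (n + m)) ∞ G]
  [TopologicalSpace M] [ChartedSpace (EuclideanSpace ℝ (Fin n)) M]
  [IsManifold (𝓡 n) ∞ M]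
  (𝒢 : LieGroupoid n m G M)

theorem mfderiv_src_mfderiv_unit (x : M) (v : EuclideanSpace ℝ (Fin n)) :
    mfderiv (𝓡 (n + m)) (𝓡 n) 𝒢.src (𝒢.unit x) (mfderiv (𝓡 n) (𝓡 (n + m)) 𝒢.unit x v) = v := by
  have h := mfderiv_comp_apply x (𝒢.contMDiff_src.mdifferentiableAt (by simp))
    (𝒢.contMDiff_unit.mdifferentiableAt (x := x) (by simp)) v
  have e : 𝒢.src ∘ 𝒢.unit = id := funext 𝒢.src_unit
  rw [e, mfderiv_id] at h
  exact h.symm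

/-- The component in `ker Tα` of a tangent vector at an identity. -/
noncomputable def vertPart (x : M) (w : TangentSpace (𝓡 (n + m)) (𝒢.unit x)) :
    TangentSpace (𝓡 (n + m)) (𝒢.unit x) :=
  w - (show TangentSpace (𝓡 (n + m)) (𝒢.unit x) from
    mfderiv (𝓡 n) (𝓡 (n + m)) 𝒢.unit x
      (mfderiv (𝓡 (n + m)) (𝓡 n) 𝒢.src (𝒢.unit x) w : EuclideanSpace ℝ (Fin n)))

theorem vertPart_mem (x : M) (w : TangentSpace (𝓡 (n + m)) (𝒢.unit x)) :
    𝒢.vertPart x w ∈ 𝒢.algFiber x := by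
  change mfderiv (𝓡 (n + m)) (𝓡 n) 𝒢.src (𝒢.unit x) (𝒢.vertPart x w) = 0
  rw [vertPart, map_sub, sub_eq_zero]
  exact (𝒢.mfderiv_src_mfderiv_unit x _).symm

theorem vertPart_of_mem (x : M) {w : TangentSpace (𝓡 (n + m)) (𝒢.unit x)}
    (hw : w ∈ 𝒢.algFiber x) : 𝒢.vertPart x w = w := by
  have h : mfderiv (𝓡 (n + m)) (𝓡 n) 𝒢.src (𝒢.unit x) w = 0 := hw
  rw [vertPart, h]
  exact (congrArg (w - ·) (map_zero (mfderiv (𝓡 n) (𝓡 (n + m)) 𝒢.unit x))).trans (sub_zero w)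

/-- The family is the image of w under the smooth map Tε ∘ Tα of TG. This is the term subtracted in
`vertPart`, so projecting onto ker Tα preserves smoothness. -/
theorem contMDiffAt_tangent_comp_unit_src {w : ∀ x, TangentSpace (𝓡 (n + m)) (𝒢.unit x)} {y : M}
    (hw : ContMDiffAt (𝓡 n) (𝓡 (n + m)).tangent ∞
      (fun x => (⟨𝒢.unit x, w x⟩ : TangentBundle (𝓡 (n + m)) G)) y) :
    ContMDiffAt (𝓡 n) (𝓡 (n + m)).tangent ∞
      (fun x => (⟨𝒢.unit x, mfderiv (𝓡 n) (𝓡 (n + m)) 𝒢.unit x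
        (mfderiv (𝓡 (n + m)) (𝓡 n) 𝒢.src (𝒢.unit x) (w x) : EuclideanSpace ℝ (Fin n))⟩ :
          TangentBundle (𝓡 (n + m)) G)) y := by
  have h1 : ContMDiff (𝓡 (n + m)).tangent (𝓡 n).tangent ∞ (tangentMap (𝓡 (n + m)) (𝓡 n) 𝒢.src) :=
    𝒢.contMDiff_src.contMDiff_tangentMap (by simp)
  have h2 : ContMDiff (𝓡 n).tangent (𝓡 (n + m)).tangent ∞
      (tangentMap (𝓡 n) (𝓡 (n + m)) 𝒢.unit) :=
    𝒢.contMDiff_unit.contMDiff_tangentMap (by simp)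
  -- The vector produced by Tα is based at α(ε(x)), which is only propositionally x; generalizing
  -- the base point lets the two tangent-bundle elements be identified.
  have key : ∀ (x b : M), b = x → ∀ u : EuclideanSpace ℝ (Fin n),
      (⟨𝒢.unit x, mfderiv (𝓡 n) (𝓡 (n + m)) 𝒢.unit x u⟩ : TangentBundle (𝓡 (n + m)) G) =
        tangentMap (𝓡 n) (𝓡 (n + m)) 𝒢.unit ⟨b, u⟩ := by
    rintro x _ rfl u; rfl
  have h3 := ((h2.comp h1).contMDiffAt.comp y hw)
  refine h3.congr_of_eventuallyEq (.of_forall fun x => ?_)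
  exact key x _ (𝒢.src_unit x) _

/-- Extend a as a vector field along ε that is constant in a trivialization of TG, project it to ker
Tα, and cut it off by a bump function. This turns conditions on all sections into conditions on all
fibre vectors. -/
theorem exists_algSection [T2Space M] (y : M) (a : 𝒢.algFiber y) :
    ∃ X : 𝒢.AlgSection, X.toFun y = a := by
  classical
  let e := trivializationAt (EuclideanSpace ℝ (Fin (n + m)))
    (TangentSpace (𝓡 (n + m)) : G → Type _) (𝒢.unit y)
  have hO : 𝒢.unit ⁻¹' e.baseSet ∈ 𝓝 y :=
    𝒢.contMDiff_unit.continuous.continuousAt.preimage_mem_nhds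
      (e.open_baseSet.mem_nhds (FiberBundle.mem_baseSet_trivializationAt' _))
  obtain ⟨φ, -, hφ⟩ := (SmoothBumpFunction.nhds_basis_tsupport (I := 𝓡 n) y).mem_iff.1 hO
  let v : EuclideanSpace ℝ (Fin (n + m)) := (e ⟨𝒢.unit y, a⟩).2
  let w : ∀ x, TangentSpace (𝓡 (n + m)) (𝒢.unit x) := fun x => e.symmL ℝ (𝒢.unit x) v
  let X : ∀ x, 𝒢.algFiber x := fun x => φ x • ⟨𝒢.vertPart x (w x), 𝒢.vertPart_mem x _⟩
  have hX : ContMDiff (𝓡 n) (𝓡 (n + m)).tangent ∞ (𝒢.sectionMap X) := by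
    intro x₁
    by_cases hx : x₁ ∈ tsupport φ
    · have hx₁ : 𝒢.unit x₁ ∈ e.baseSet := hφ hx
      have hw : ContMDiffAt (𝓡 n) (𝓡 (n + m)).tangent ∞
          (fun x => (⟨𝒢.unit x, w x⟩ : TangentBundle (𝓡 (n + m)) G)) x₁ := by
        have h := (e.contMDiffOn_symm (IB := 𝓡 (n + m)) (n := ∞)).contMDiffAt
          (x := (𝒢.unit x₁, v)) (e.open_target.mem_nhds (e.mem_target.2 hx₁))
        have h2 : ContMDiffAt (𝓡 n) ((𝓡 (n + m)).prod 𝓘(ℝ, EuclideanSpace ℝ (Fin (n + m)))) ∞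
            (fun x => (𝒢.unit x, v)) x₁ := 𝒢.contMDiff_unit.contMDiffAt.prodMk contMDiffAt_const
        refine (h.comp x₁ h2).congr_of_eventuallyEq ?_
        filter_upwards [𝒢.contMDiff_unit.continuous.continuousAt.preimage_mem_nhds
          (e.open_baseSet.mem_nhds hx₁)] with x hx
        have := e.mk_symm (b := 𝒢.unit x) hx v
        rw [← e.symmL_apply (R := ℝ) hx] at this
        exact this
      have hw' := 𝒢.contMDiffAt_tangent_comp_unit_src hw
      -- On the support of the bump function smoothness is read in the trivialization, which is
      -- linear on fibres and so commutes with the scaling and the subtraction in `vertPart`.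
      refine (Bundle.Trivialization.contMDiffAt_iff (e := e) (e.mem_source.2 hx₁)).2
        ⟨𝒢.contMDiff_unit.contMDiffAt, ?_⟩
      have k1 := ((Bundle.Trivialization.contMDiffAt_iff (e := e) (e.mem_source.2 hx₁)).1 hw).2
      have k2 := ((Bundle.Trivialization.contMDiffAt_iff (e := e) (e.mem_source.2 hx₁)).1 hw').2
      refine (φ.contMDiffAt.smul (k1.sub k2)).congr_of_eventuallyEq ?_
      filter_upwards [𝒢.contMDiff_unit.continuous.continuousAt.preimage_mem_nhds
          (e.open_baseSet.mem_nhds hx₁)] with x hx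
      have l := e.linear ℝ (b := 𝒢.unit x) hx
      change (e ⟨𝒢.unit x, φ x • 𝒢.vertPart x (w x)⟩).2 = _
      rw [l.map_smul]
      exact congrArg (φ x • ·) ((l.mk' _).map_sub _ _)
    · have h0 := (Bundle.contMDiff_zeroSection ℝ (TangentSpace (𝓡 (n + m)) : G → Type _)
        (IB := 𝓡 (n + m)) (F := EuclideanSpace ℝ (Fin (n + m))) (n := ∞)).comp 𝒢.contMDiff_unit
      refine h0.contMDiffAt.congr_of_eventuallyEq ?_
      filter_upwards [(isClosed_tsupport φ).isOpen_compl.mem_nhds hx] with x hx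
      have : φ x = 0 := image_eq_zero_of_notMem_tsupport hx
      change (⟨𝒢.unit x, φ x • 𝒢.vertPart x (w x)⟩ : TangentBundle (𝓡 (n + m)) G) = _
      rw [this, zero_smul]
      rfl
  refine ⟨⟨X, hX⟩, ?_⟩
  ext1
  change φ y • 𝒢.vertPart y (w y) = a
  have hw : w y = a := by
    have hy : 𝒢.unit y ∈ e.baseSet := (mem_of_mem_nhds hO : y ∈ 𝒢.unit ⁻¹' e.baseSet)
    have := e.symm_proj_apply ⟨𝒢.unit y, a⟩ hy
    rw [← e.symmL_apply (R := ℝ) hy] at this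
    exact this
  rw [hw, 𝒢.vertPart_of_mem y a.2, φ.eq_one, one_smul]

end LieGroupoid

/-! ### Translation by a bisection and the coordinate expressions of β and the product -/

namespace LieGroupoid

variable {n m : ℕ} {G M : Type*}
  [TopologicalSpace G] [ChartedSpace (EuclideanSpace ℝ (Fin (n + m))) G]
  [IsManifold (𝓡 (n + m)) ∞ G]
  [TopologicalSpace M] [ChartedSpace (EuclideanSpace ℝ (Fin n)) M]
  [IsManifold (𝓡 n) ∞ M]
  {𝒢 : LieGroupoid n m G M}

namespace LocalBisection

variable (Y : 𝒢.LocalBisection)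

theorem tgt_secSrc_mem {x : M} (hx : x ∈ Y.dom) : 𝒢.tgt (Y.secSrc x) ∈ Y.cod := by
  obtain ⟨y, hy, e⟩ : Y.secSrc x ∈ Y.secTgt '' Y.cod := by
    rw [Y.image_secTgt, ← Y.image_secSrc]; exact ⟨x, hx, rfl⟩
  rwa [← e, Y.tgt_secTgt y hy]

theorem secTgt_tgt_secSrc {x : M} (hx : x ∈ Y.dom) :
    Y.secTgt (𝒢.tgt (Y.secSrc x)) = Y.secSrc x := by
  obtain ⟨y, hy, e⟩ : Y.secSrc x ∈ Y.secTgt '' Y.cod := by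
    rw [Y.image_secTgt, ← Y.image_secSrc]; exact ⟨x, hx, rfl⟩
  rw [← e, Y.tgt_secTgt y hy]

theorem secSrc_src_secTgt {y : M} (hy : y ∈ Y.cod) :
    Y.secSrc (𝒢.src (Y.secTgt y)) = Y.secTgt y := by
  obtain ⟨x, hx, e⟩ : Y.secTgt y ∈ Y.secSrc '' Y.dom := by
    rw [Y.image_secSrc, ← Y.image_secTgt]; exact ⟨y, hy, rfl⟩
  rw [← e, Y.src_secSrc x hx]

theorem src_rightTrans {g : G} (hg : 𝒢.tgt g ∈ Y.dom) : 𝒢.src (Y.rightTrans g) = 𝒢.src g :=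
  𝒢.src_mul _ _ (Y.src_secSrc _ hg).symm

theorem tgt_rightTrans {g : G} (hg : 𝒢.tgt g ∈ Y.dom) :
    𝒢.tgt (Y.rightTrans g) = 𝒢.tgt (Y.secSrc (𝒢.tgt g)) :=
  𝒢.tgt_mul _ _ (Y.src_secSrc _ hg).symm

theorem contMDiffOn_rightTrans :
    ContMDiffOn (𝓡 (n + m)) (𝓡 (n + m)) ∞ Y.rightTrans (𝒢.tgt ⁻¹' Y.dom) :=
  𝒢.contMDiffOn_mul_of_composable contMDiffOn_id
    (Y.contMDiffOn_secSrc.comp 𝒢.contMDiff_tgt.contMDiffOn fun _ h => h)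
    fun _ h => (Y.src_secSrc _ h).symm

/-- The inverse of the right translation by a bisection. -/
def rightTransInv (h : G) : G :=
  𝒢.mul h (𝒢.inv (Y.secTgt (𝒢.tgt h)))

theorem contMDiffOn_rightTransInv :
    ContMDiffOn (𝓡 (n + m)) (𝓡 (n + m)) ∞ Y.rightTransInv (𝒢.tgt ⁻¹' Y.cod) :=
  𝒢.contMDiffOn_mul_of_composable contMDiffOn_id
    (𝒢.contMDiff_inv.comp_contMDiffOn
      (Y.contMDiffOn_secTgt.comp 𝒢.contMDiff_tgt.contMDiffOn fun _ h => h))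
    fun _ h => ((𝒢.src_inv _).trans (Y.tgt_secTgt _ h)).symm

theorem rightTransInv_rightTrans {g : G} (hg : 𝒢.tgt g ∈ Y.dom) :
    Y.rightTransInv (Y.rightTrans g) = g := by
  rw [rightTransInv, Y.tgt_rightTrans hg, Y.secTgt_tgt_secSrc hg]
  exact 𝒢.mul_inv_cancel_right (Y.src_secSrc _ hg).symm

theorem tgt_rightTransInv {h : G} (hh : 𝒢.tgt h ∈ Y.cod) :
    𝒢.tgt (Y.rightTransInv h) = 𝒢.src (Y.secTgt (𝒢.tgt h)) := by
  rw [rightTransInv, 𝒢.tgt_mul _ _ ((𝒢.src_inv _).trans (Y.tgt_secTgt _ hh)).symm, 𝒢.tgt_inv]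

/-- The factor removed by `rightTransInv` is the element of the bisection with target β(h). After
its removal the target becomes the source of that element, so `rightTrans` restores the same factor.
-/
theorem rightTrans_rightTransInv {h : G} (hh : 𝒢.tgt h ∈ Y.cod) :
    Y.rightTrans (Y.rightTransInv h) = h := by
  rw [rightTrans, Y.tgt_rightTransInv hh, Y.secSrc_src_secTgt hh]
  exact 𝒢.inv_mul_cancel_right (Y.tgt_secTgt _ hh).symm

end LocalBisection

/-- The model space of the adapted coordinates `(x, u)`. -/
abbrev Coord (n m : ℕ) : Type := (Fin n → ℝ) × (Fin m → ℝ)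

namespace AdaptedCoordinates

variable {x₀ : M} (c : 𝒢.AdaptedCoordinates x₀)

theorem src_symm_mem {z : Coord n m} (hz : z ∈ c.coord.target) :
    𝒢.src (c.coord.symm z) ∈ c.baseCoord.source :=
  c.src_mem _ (c.coord.map_target hz)

theorem baseCoord_src_symm {z : Coord n m} (hz : z ∈ c.coord.target) :
    c.baseCoord (𝒢.src (c.coord.symm z)) = z.1 := by
  rw [← c.coord_fst _ (c.coord.map_target hz), c.coord.right_inv hz]

theorem mem_baseCoord_source {y : M} (hy : 𝒢.unit y ∈ c.coord.source) :
    y ∈ c.baseCoord.source := by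
  simpa [𝒢.src_unit] using c.src_mem _ hy

theorem mk_zero_mem_target {y : M} (hy : 𝒢.unit y ∈ c.coord.source) :
    (c.baseCoord y, (0 : Fin m → ℝ)) ∈ c.coord.target := by
  rw [← c.coord_unit y hy]; exact c.coord.map_source hy

theorem symm_mk_zero {y : M} (hy : 𝒢.unit y ∈ c.coord.source) :
    c.coord.symm (c.baseCoord y, 0) = 𝒢.unit y := by
  rw [← c.coord_unit y hy, c.coord.left_inv hy]

/-- The domain of the local expression of the target map. -/
def bDom : Set (Coord n m) :=
  c.coord.target ∩ (fun z => 𝒢.tgt (c.coord.symm z)) ⁻¹' c.baseCoord.source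

/-- The local expression of the target map, as a function of `z = (x, u)`. -/
def bMap (z : Coord n m) : Fin n → ℝ := c.baseCoord (𝒢.tgt (c.coord.symm z))

theorem contMDiffOn_tgt_symm : ContMDiffOn 𝓘(ℝ, Coord n m) (𝓡 n) ∞
    (fun z => 𝒢.tgt (c.coord.symm z)) c.coord.target :=
  𝒢.contMDiff_tgt.comp_contMDiffOn c.contMDiffOn_coord_symm

theorem contMDiffOn_src_symm : ContMDiffOn 𝓘(ℝ, Coord n m) (𝓡 n) ∞
    (fun z => 𝒢.src (c.coord.symm z)) c.coord.target :=
  𝒢.contMDiff_src.comp_contMDiffOn c.contMDiffOn_coord_symm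

theorem isOpen_bDom : IsOpen c.bDom :=
  c.contMDiffOn_tgt_symm.continuousOn.isOpen_inter_preimage c.coord.open_target
    c.baseCoord.open_source

theorem contMDiffOn_bMap : ContMDiffOn 𝓘(ℝ, Coord n m) 𝓘(ℝ, Fin n → ℝ) ∞ c.bMap c.bDom :=
  c.contMDiffOn_baseCoord.comp (c.contMDiffOn_tgt_symm.mono Set.inter_subset_left)
    Set.inter_subset_right

/-- The pairs `((x, u), v)` such that `(x, u)` and `(b(x, u), v)` are coordinates of composable
elements. -/
def pairDom : Set (Coord n m × (Fin m → ℝ)) :=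
  (Prod.fst ⁻¹' c.bDom) ∩ (fun q => (c.bMap q.1, q.2)) ⁻¹' c.coord.target

/-- The product `(x, u) · (b(x, u), v)`. -/
def pairMul (q : Coord n m × (Fin m → ℝ)) : G :=
  𝒢.mul (c.coord.symm q.1) (c.coord.symm (c.bMap q.1, q.2))

theorem contMDiffOn_pairSnd : ContMDiffOn 𝓘(ℝ, Coord n m × (Fin m → ℝ)) 𝓘(ℝ, Coord n m) ∞
    (fun q : Coord n m × (Fin m → ℝ) => (c.bMap q.1, q.2)) (Prod.fst ⁻¹' c.bDom) := by
  rw [contMDiffOn_iff_contDiffOn]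
  exact (c.contMDiffOn_bMap.contDiffOn.comp contDiff_fst.contDiffOn fun _ h => h).prodMk
    contDiff_snd.contDiffOn

theorem isOpen_pairDom : IsOpen c.pairDom :=
  c.contMDiffOn_pairSnd.continuousOn.isOpen_inter_preimage
    (c.isOpen_bDom.preimage continuous_fst) c.coord.open_target

theorem composable_of_mem_pairDom {q : Coord n m × (Fin m → ℝ)} (hq : q ∈ c.pairDom) :
    𝒢.tgt (c.coord.symm q.1) = 𝒢.src (c.coord.symm (c.bMap q.1, q.2)) :=
  c.baseCoord.injOn hq.1.2 (c.src_symm_mem hq.2) (c.baseCoord_src_symm hq.2).symm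

theorem contMDiffOn_pairMul : ContMDiffOn 𝓘(ℝ, Coord n m × (Fin m → ℝ)) (𝓡 (n + m)) ∞
    c.pairMul c.pairDom := by
  refine 𝒢.contMDiffOn_mul_of_composable ?_ ?_ fun q hq => c.composable_of_mem_pairDom hq
  · exact c.contMDiffOn_coord_symm.comp contDiff_fst.contMDiff.contMDiffOn fun q hq => hq.1.1
  · exact c.contMDiffOn_coord_symm.comp (c.contMDiffOn_pairSnd.mono Set.inter_subset_left)
      fun q hq => hq.2

/-- The domain of the local expression of the product. -/
def pDom : Set (Coord n m × (Fin m → ℝ)) := c.pairDom ∩ c.pairMul ⁻¹' c.coord.source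

/-- The local expression of the product, as a function of `((x, u), v)`. -/
def pMap (q : Coord n m × (Fin m → ℝ)) : Fin m → ℝ := (c.coord (c.pairMul q)).2

theorem isOpen_pDom : IsOpen c.pDom :=
  c.contMDiffOn_pairMul.continuousOn.isOpen_inter_preimage c.isOpen_pairDom c.coord.open_source

theorem contDiffOn_pMap : ContDiffOn ℝ ∞ c.pMap c.pDom := by
  rw [← contMDiffOn_iff_contDiffOn]
  exact contDiff_snd.contMDiff.comp_contMDiffOn (c.contMDiffOn_coord.comp
    (c.contMDiffOn_pairMul.mono Set.inter_subset_left) Set.inter_subset_right)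

/-- The coordinates `z = (x, u)` of elements which can be right translated by the bisection `Y` and
whose source has its identity in the coordinate domain. -/
def chartDom (Y : 𝒢.LocalBisection) : Set (Coord n m) :=
  (c.coord.target ∩ (fun z => 𝒢.unit (𝒢.src (c.coord.symm z))) ⁻¹' c.coord.source) ∩
    (c.coord.target ∩ (fun z => 𝒢.tgt (c.coord.symm z)) ⁻¹' Y.dom)

theorem isOpen_chartDom (Y : 𝒢.LocalBisection) : IsOpen (c.chartDom Y) :=
  ((𝒢.contMDiff_unit.comp_contMDiffOn c.contMDiffOn_src_symm).continuousOn.isOpen_inter_preimage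
    c.coord.open_target c.coord.open_source).inter
  (c.contMDiffOn_tgt_symm.continuousOn.isOpen_inter_preimage c.coord.open_target Y.isOpen_dom)

variable {c} {Y : 𝒢.LocalBisection} {z : Coord n m}

theorem mem_target_of_mem_chartDom (hz : z ∈ c.chartDom Y) : z ∈ c.coord.target := hz.1.1

theorem unit_mem_of_mem_chartDom (hz : z ∈ c.chartDom Y) :
    𝒢.unit (𝒢.src (c.coord.symm z)) ∈ c.coord.source := hz.1.2

theorem tgt_mem_of_mem_chartDom (hz : z ∈ c.chartDom Y) :
    𝒢.tgt (c.coord.symm z) ∈ Y.dom := hz.2.2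

theorem symm_fst_zero (hz : z ∈ c.chartDom Y) :
    c.coord.symm (z.1, 0) = 𝒢.unit (𝒢.src (c.coord.symm z)) := by
  rw [← c.symm_mk_zero (unit_mem_of_mem_chartDom hz),
    c.baseCoord_src_symm (mem_target_of_mem_chartDom hz)]

theorem fst_zero_mem_bDom (hz : z ∈ c.chartDom Y) : (z.1, 0) ∈ c.bDom := by
  refine ⟨?_, ?_⟩
  · have := c.mk_zero_mem_target (unit_mem_of_mem_chartDom hz)
    rwa [c.baseCoord_src_symm (mem_target_of_mem_chartDom hz)] at this
  · change 𝒢.tgt (c.coord.symm (z.1, 0)) ∈ c.baseCoord.source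
    rw [symm_fst_zero hz, 𝒢.tgt_unit]
    exact c.src_symm_mem (mem_target_of_mem_chartDom hz)

theorem bMap_fst_zero (hz : z ∈ c.chartDom Y) : c.bMap (z.1, 0) = z.1 := by
  rw [bMap, symm_fst_zero hz, 𝒢.tgt_unit, c.baseCoord_src_symm (mem_target_of_mem_chartDom hz)]

/-- Because b(x, 0) = x, the second factor (b(x, 0), u) is z itself. Hence the derivatives defining
ρ and R are taken at interior points of the domains of b and p. -/
theorem mem_pairDom (hz : z ∈ c.chartDom Y) : ((z.1, 0), z.2) ∈ c.pairDom := by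
  refine ⟨fst_zero_mem_bDom hz, ?_⟩
  change (c.bMap (z.1, 0), z.2) ∈ c.coord.target
  rw [bMap_fst_zero hz]
  exact mem_target_of_mem_chartDom hz

theorem pairMul_fst_zero (hz : z ∈ c.chartDom Y) : c.pairMul ((z.1, 0), z.2) = c.coord.symm z := by
  rw [pairMul, bMap_fst_zero hz, symm_fst_zero hz]
  exact 𝒢.unit_mul _

theorem mem_pDom (hz : z ∈ c.chartDom Y) : ((z.1, 0), z.2) ∈ c.pDom := by
  refine ⟨mem_pairDom hz, ?_⟩
  change c.pairMul ((z.1, 0), z.2) ∈ c.coord.source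
  rw [pairMul_fst_zero hz]
  exact c.coord.map_target (mem_target_of_mem_chartDom hz)

variable (c Y)

/-- The coordinates `(x, u)` of the element `R_Y(x, u)` of `G`. -/
noncomputable def transChart : OpenPartialHomeomorph (Coord n m) G where
  toFun z := Y.rightTrans (c.coord.symm z)
  invFun h := c.coord (Y.rightTransInv h)
  source := c.chartDom Y
  target := ((𝒢.tgt ⁻¹' Y.cod) ∩ Y.rightTransInv ⁻¹' c.coord.source) ∩
    (fun h => c.coord (Y.rightTransInv h)) ⁻¹' c.chartDom Y
  map_source' z hz := by
    have h1 := Y.rightTransInv_rightTrans (tgt_mem_of_mem_chartDom hz)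
    refine ⟨⟨?_, ?_⟩, ?_⟩
    · change 𝒢.tgt (Y.rightTrans (c.coord.symm z)) ∈ Y.cod
      rw [Y.tgt_rightTrans (tgt_mem_of_mem_chartDom hz)]
      exact Y.tgt_secSrc_mem (tgt_mem_of_mem_chartDom hz)
    · change Y.rightTransInv (Y.rightTrans (c.coord.symm z)) ∈ c.coord.source
      rw [h1]
      exact c.coord.map_target (mem_target_of_mem_chartDom hz)
    · change c.coord (Y.rightTransInv (Y.rightTrans (c.coord.symm z))) ∈ c.chartDom Y
      rw [h1, c.coord.right_inv (mem_target_of_mem_chartDom hz)]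
      exact hz
  map_target' h hh := hh.2
  left_inv' z hz := by
    rw [Y.rightTransInv_rightTrans (tgt_mem_of_mem_chartDom hz),
      c.coord.right_inv (mem_target_of_mem_chartDom hz)]
  right_inv' h hh := by
    rw [c.coord.left_inv hh.1.2, Y.rightTrans_rightTransInv hh.1.1]
  open_source := c.isOpen_chartDom Y
  open_target := by
    have h1 : IsOpen (𝒢.tgt ⁻¹' Y.cod) := Y.isOpen_cod.preimage 𝒢.contMDiff_tgt.continuous
    have h2 := Y.contMDiffOn_rightTransInv.continuousOn.isOpen_inter_preimage h1 c.coord.open_source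
    exact ContinuousOn.isOpen_inter_preimage
      (c.coord.continuousOn.comp (Y.contMDiffOn_rightTransInv.continuousOn.mono
        Set.inter_subset_left) fun _ h => h.2) h2 (c.isOpen_chartDom Y)
  continuousOn_toFun := Y.contMDiffOn_rightTrans.continuousOn.comp
    (c.coord.continuousOn_symm.mono fun _ hz => mem_target_of_mem_chartDom hz)
    fun _ hz => tgt_mem_of_mem_chartDom hz
  continuousOn_invFun := c.coord.continuousOn.comp (Y.contMDiffOn_rightTransInv.continuousOn.mono
    fun _ h => h.1.1) fun _ h => h.1.2

theorem contMDiffOn_transChart : ContMDiffOn 𝓘(ℝ, Coord n m) (𝓡 (n + m)) ∞ (c.transChart Y)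
    (c.transChart Y).source :=
  Y.contMDiffOn_rightTrans.comp
    (c.contMDiffOn_coord_symm.mono fun _ hz => mem_target_of_mem_chartDom hz)
    fun _ hz => tgt_mem_of_mem_chartDom hz

theorem contMDiffOn_transChart_symm : ContMDiffOn (𝓡 (n + m)) 𝓘(ℝ, Coord n m) ∞
    (c.transChart Y).symm (c.transChart Y).target :=
  c.contMDiffOn_coord.comp (Y.contMDiffOn_rightTransInv.mono fun _ h => h.1.1) fun _ h => h.1.2

end AdaptedCoordinates

end LieGroupoid

/-! ### The velocity of k ↦ k⁻¹h in coordinates -/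

namespace LieGroupoid

variable {n m : ℕ} {G M : Type*}
  [TopologicalSpace G] [ChartedSpace (EuclideanSpace ℝ (Fin (n + m))) G]
  [IsManifold (𝓡 (n + m)) ∞ G]
  [TopologicalSpace M] [ChartedSpace (EuclideanSpace ℝ (Fin n)) M]
  [IsManifold (𝓡 n) ∞ M]
  {𝒢 : LieGroupoid n m G M}

namespace AdaptedCoordinates

variable {x₀ : M} (c : 𝒢.AdaptedCoordinates x₀)

/-- The coordinate expression of `ξ ↦ ∂/∂ξ (k⁻¹ · h)`, `k = (x, ξ)`, at `ξ = 0`, where `h` has the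
coordinates `z = (x, u)`. -/
noncomputable def curveDeriv (z : Coord n m) : (Fin m → ℝ) →L[ℝ] Coord n m :=
  ((fderiv ℝ c.bMap (z.1, 0)).comp (ContinuousLinearMap.inr ℝ _ _)).prod
    (-(fderiv ℝ c.pMap ((z.1, 0), z.2)).comp
      ((ContinuousLinearMap.inl ℝ _ _).comp (ContinuousLinearMap.inr ℝ _ _)))

theorem curveDeriv_snd (z : Coord n m) (ξ : Fin m → ℝ) :
    (c.curveDeriv z ξ).2 = -fderiv ℝ c.pMap ((z.1, 0), z.2) ((0, ξ), 0) := rfl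

theorem contDiffOn_curveDeriv (Y : 𝒢.LocalBisection) :
    ContDiffOn ℝ ∞ c.curveDeriv (c.chartDom Y) := by
  rw [contDiffOn_clm_apply]
  intro ξ
  have h1 : ContDiffOn ℝ ∞ (fderiv ℝ c.bMap) c.bDom :=
    c.contMDiffOn_bMap.contDiffOn.fderiv_of_isOpen c.isOpen_bDom (by simp)
  have h2 : ContDiffOn ℝ ∞ (fderiv ℝ c.pMap) c.pDom :=
    c.contDiffOn_pMap.fderiv_of_isOpen c.isOpen_pDom (by simp)
  have e1 : ContDiff ℝ ∞ (fun z : Coord n m => ((z.1, 0) : Coord n m)) :=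
    contDiff_fst.prodMk contDiff_const
  have e2 : ContDiff ℝ ∞ (fun z : Coord n m => (((z.1, 0), z.2) : Coord n m × (Fin m → ℝ))) :=
    e1.prodMk contDiff_snd
  exact ((h1.comp e1.contDiffOn fun z hz => fst_zero_mem_bDom hz).clm_apply contDiffOn_const).prodMk
    ((h2.comp e2.contDiffOn fun z hz => mem_pDom hz).clm_apply contDiffOn_const).neg

/-- The element `k⁻¹ · h`, where `k = (x, ξ)` and `h = (x, u) = z`. -/
def curve (z : Coord n m) (ξ : Fin m → ℝ) : G :=
  𝒢.mul (𝒢.inv (c.coord.symm (z.1, ξ))) (c.coord.symm z)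

/-- The set of all `ξ` for which the curve `curve z` is in the coordinate domain. -/
def curveDom (z : Coord n m) : Set (Fin m → ℝ) :=
  ((fun ξ => (z.1, ξ)) ⁻¹' c.bDom) ∩ c.curve z ⁻¹' c.coord.source

variable {c} {Y : 𝒢.LocalBisection} {z : Coord n m}

theorem src_symm_eq (hz : z ∈ c.coord.target) {ξ : Fin m → ℝ} (h : (z.1, ξ) ∈ c.coord.target) :
    𝒢.src (c.coord.symm (z.1, ξ)) = 𝒢.src (c.coord.symm z) :=
  c.baseCoord.injOn (c.src_symm_mem h) (c.src_symm_mem hz)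
    ((c.baseCoord_src_symm h).trans (c.baseCoord_src_symm hz).symm)

theorem contMDiffOn_curve (hz : z ∈ c.coord.target) :
    ContMDiffOn 𝓘(ℝ, Fin m → ℝ) (𝓡 (n + m)) ∞ (c.curve z) ((fun ξ => (z.1, ξ)) ⁻¹' c.bDom) := by
  refine 𝒢.contMDiffOn_mul_of_composable ?_ contMDiffOn_const ?_
  · refine 𝒢.contMDiff_inv.comp_contMDiffOn (c.contMDiffOn_coord_symm.comp
      (contDiff_const.prodMk contDiff_id).contMDiff.contMDiffOn fun ξ h => h.1)
  · intro ξ h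
    rw [𝒢.tgt_inv, src_symm_eq hz h.1]

theorem isOpen_curveDom (hz : z ∈ c.coord.target) : IsOpen (c.curveDom z) :=
  (contMDiffOn_curve hz).continuousOn.isOpen_inter_preimage
    (c.isOpen_bDom.preimage (by fun_prop)) c.coord.open_source

theorem curve_zero (hz : z ∈ c.chartDom Y) : c.curve z 0 = c.coord.symm z := by
  rw [curve, symm_fst_zero hz, 𝒢.inv_unit, 𝒢.unit_mul]

theorem zero_mem_curveDom (hz : z ∈ c.chartDom Y) : 0 ∈ c.curveDom z := by
  refine ⟨fst_zero_mem_bDom hz, ?_⟩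
  change c.curve z 0 ∈ c.coord.source
  rw [curve_zero hz]
  exact c.coord.map_target (mem_target_of_mem_chartDom hz)

/-- The x-coordinate is the source, and α(k⁻¹h) = β(k). -/
theorem coord_curve_fst (hz : z ∈ c.coord.target) {ξ : Fin m → ℝ} (hξ : ξ ∈ c.curveDom z) :
    (c.coord (c.curve z ξ)).1 = c.bMap (z.1, ξ) := by
  rw [c.coord_fst _ hξ.2, curve, 𝒢.src_mul _ _ (by rw [𝒢.tgt_inv, src_symm_eq hz hξ.1.1]),
    𝒢.src_inv]
  rfl

theorem symm_bMap_curve (hz : z ∈ c.coord.target) {ξ : Fin m → ℝ} (hξ : ξ ∈ c.curveDom z) :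
    c.coord.symm (c.bMap (z.1, ξ), (c.coord (c.curve z ξ)).2) = c.curve z ξ := by
  rw [← coord_curve_fst hz hξ, Prod.mk.eta, c.coord.left_inv hξ.2]

theorem pairMul_curve (hz : z ∈ c.coord.target) {ξ : Fin m → ℝ} (hξ : ξ ∈ c.curveDom z) :
    c.pairMul ((z.1, ξ), (c.coord (c.curve z ξ)).2) = c.coord.symm z := by
  rw [pairMul, symm_bMap_curve hz hξ]
  exact 𝒢.mul_inv_cancel_left (src_symm_eq hz hξ.1.1)

/-- This is k(k⁻¹h) = h in coordinates: an implicit equation for the u-coordinates of k⁻¹h,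
involving the product but not the inversion. -/
theorem pMap_curve (hz : z ∈ c.coord.target) {ξ : Fin m → ℝ} (hξ : ξ ∈ c.curveDom z) :
    c.pMap ((z.1, ξ), (c.coord (c.curve z ξ)).2) = z.2 := by
  rw [pMap, pairMul_curve hz hξ, c.coord.right_inv hz]

theorem contDiffOn_coord_curve (hz : z ∈ c.coord.target) :
    ContDiffOn ℝ ∞ (fun ξ => c.coord (c.curve z ξ)) (c.curveDom z) := by
  rw [← contMDiffOn_iff_contDiffOn]
  exact c.contMDiffOn_coord.comp ((contMDiffOn_curve hz).mono Set.inter_subset_left)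
    Set.inter_subset_right

/-- The x-part is b(x, ξ). The u-part v(ξ) satisfies p(x, ξ, v(ξ)) = u; differentiating at ξ = 0,
where ∂p/∂v is the identity, gives v'(0) = -∂p/∂ξ = -R. Thus no derivative of the inversion is
needed. -/
theorem hasFDerivAt_coord_curve (hz : z ∈ c.chartDom Y) :
    HasFDerivAt (fun ξ => c.coord (c.curve z ξ)) (c.curveDeriv z) 0 := by
  have hzt := mem_target_of_mem_chartDom hz
  have hS := (isOpen_curveDom hzt).mem_nhds (zero_mem_curveDom hz)
  have hd : DifferentiableAt ℝ (fun ξ => c.coord (c.curve z ξ)) 0 :=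
    ((contDiffOn_coord_curve hzt).contDiffAt hS).differentiableAt (by simp)
  have hP : HasFDerivAt c.pMap (fderiv ℝ c.pMap ((z.1, 0), z.2)) ((z.1, 0), z.2) :=
    ((c.contDiffOn_pMap.contDiffAt (c.isOpen_pDom.mem_nhds (mem_pDom hz))).differentiableAt
      (by simp)).hasFDerivAt
  have hb : HasFDerivAt c.bMap (fderiv ℝ c.bMap (z.1, 0)) (z.1, 0) :=
    ((c.contMDiffOn_bMap.contDiffOn.contDiffAt
      (c.isOpen_bDom.mem_nhds (fst_zero_mem_bDom hz))).differentiableAt (by simp)).hasFDerivAt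
  -- The left factor (x, 0) is an identity, so p(x, 0, v) = v for v near u.
  have hsnd : ∀ η : Fin m → ℝ, fderiv ℝ c.pMap ((z.1, 0), z.2) (0, η) = η := by
    intro η
    have h1 : HasFDerivAt (fun v : Fin m → ℝ => (((z.1, 0), v) : Coord n m × (Fin m → ℝ)))
        (ContinuousLinearMap.inr ℝ _ _) z.2 := hasFDerivAt_prodMk_right _ _
    have h2 := hP.comp z.2 h1
    have h3 : (c.pMap ∘ fun v : Fin m → ℝ => (((z.1, 0), v) : Coord n m × (Fin m → ℝ)))
        =ᶠ[𝓝 z.2] id := by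
      have hc : Continuous fun v : Fin m → ℝ => ((z.1, v) : Coord n m) := by fun_prop
      filter_upwards [hc.continuousAt.preimage_mem_nhds (c.coord.open_target.mem_nhds hzt)] with v hv
      have hv' : (z.1, v) ∈ c.coord.target := hv
      change (c.coord (𝒢.mul (c.coord.symm (z.1, 0)) (c.coord.symm (c.bMap (z.1, 0), v)))).2 = v
      rw [bMap_fst_zero hz, symm_fst_zero hz, ← src_symm_eq hzt hv', 𝒢.unit_mul,
        c.coord.right_inv hv']
    have h4 := h2.unique ((hasFDerivAt_id z.2).congr_of_eventuallyEq h3)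
    exact DFunLike.congr_fun h4 η
  set A := fderiv ℝ (fun ξ => c.coord (c.curve z ξ)) 0 with hA
  have hz2 : (c.coord (c.curve z 0)).2 = z.2 := by
    rw [curve_zero hz, c.coord.right_inv hzt]
  have e : A = c.curveDeriv z := by
    ext1 ξ
    refine Prod.ext ?_ ?_
    · have h1 : HasFDerivAt (fun ξ => (c.coord (c.curve z ξ)).1)
          ((ContinuousLinearMap.fst ℝ _ _).comp A) 0 := hd.hasFDerivAt.fst
      have h2 : HasFDerivAt (fun ξ => c.bMap (z.1, ξ))
          ((fderiv ℝ c.bMap (z.1, 0)).comp (ContinuousLinearMap.inr ℝ _ _)) 0 :=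
        hb.comp (0 : Fin m → ℝ) (hasFDerivAt_prodMk_right _ _)
      have h3 : (fun ξ => (c.coord (c.curve z ξ)).1) =ᶠ[𝓝 0] (fun ξ => c.bMap (z.1, ξ)) := by
        filter_upwards [hS] with ξ hξ using coord_curve_fst hzt hξ
      exact DFunLike.congr_fun (h1.unique (h2.congr_of_eventuallyEq h3)) ξ
    · have h1 : HasFDerivAt (fun ξ : Fin m → ℝ => (((z.1, ξ), (c.coord (c.curve z ξ)).2) :
          Coord n m × (Fin m → ℝ))) ((ContinuousLinearMap.inr ℝ _ _).prod
            ((ContinuousLinearMap.snd ℝ _ _).comp A)) 0 :=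
        (hasFDerivAt_prodMk_right _ _).prodMk hd.hasFDerivAt.snd
      have h2 := HasFDerivAt.comp (g := c.pMap) (g' := fderiv ℝ c.pMap ((z.1, 0), z.2))
        (0 : Fin m → ℝ) (by rw [hz2]; exact hP) h1
      have h3 : (c.pMap ∘ fun ξ : Fin m → ℝ => (((z.1, ξ), (c.coord (c.curve z ξ)).2) :
          Coord n m × (Fin m → ℝ))) =ᶠ[𝓝 0] fun _ => z.2 := by
        filter_upwards [hS] with ξ hξ using pMap_curve hzt hξ
      have h4 : fderiv ℝ c.pMap ((z.1, 0), z.2) ((0, ξ), (A ξ).2) = 0 :=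
        DFunLike.congr_fun (h2.unique ((hasFDerivAt_const z.2 (0 : Fin m → ℝ)).congr_of_eventuallyEq
          h3)) ξ
      have h5 : (((0, ξ), (A ξ).2) : Coord n m × (Fin m → ℝ)) = ((0, ξ), 0) + (0, (A ξ).2) := by
        simp
      rw [h5, map_add, hsnd] at h4
      rw [curveDeriv_snd]
      exact eq_neg_of_add_eq_zero_right h4
  rw [← e]
  exact hd.hasFDerivAt

/-- By associativity, and since left multiplication does not change the target, R_Υ commutes with
left multiplication by k⁻¹. The velocity computed without the bisection is therefore also valid in
the chart around h₀. -/
theorem inv_symm_mul_transChart (hz : z ∈ c.chartDom Y) {ξ : Fin m → ℝ} (hξ : ξ ∈ c.curveDom z) :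
    𝒢.mul (𝒢.inv (c.coord.symm (z.1, ξ))) (c.transChart Y z) =
      c.transChart Y (c.coord (c.curve z ξ)) := by
  have h1 : 𝒢.tgt (𝒢.inv (c.coord.symm (z.1, ξ))) = 𝒢.src (c.coord.symm z) := by
    rw [𝒢.tgt_inv, src_symm_eq (mem_target_of_mem_chartDom hz) hξ.1.1]
  change 𝒢.mul (𝒢.inv (c.coord.symm (z.1, ξ))) (Y.rightTrans (c.coord.symm z)) =
    Y.rightTrans (c.coord.symm (c.coord (c.curve z ξ)))
  rw [c.coord.left_inv hξ.2, LocalBisection.rightTrans, LocalBisection.rightTrans,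
    𝒢.mul_assoc _ _ _ h1 (Y.src_secSrc _ (tgt_mem_of_mem_chartDom hz)).symm, curve,
    𝒢.tgt_mul _ _ h1]

end AdaptedCoordinates

end LieGroupoid

/-! ### Invariant fields, Legendre transformation and discrete Euler–Lagrange equations in
coordinates -/

namespace LieGroupoid

variable {n m : ℕ} {G M : Type*}
  [TopologicalSpace G] [ChartedSpace (EuclideanSpace ℝ (Fin (n + m))) G]
  [IsManifold (𝓡 (n + m)) ∞ G]
  [TopologicalSpace M] [ChartedSpace (EuclideanSpace ℝ (Fin n)) M]
  [IsManifold (𝓡 n) ∞ M]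
  {𝒢 : LieGroupoid n m G M}

namespace AdaptedCoordinates

variable {x₀ : M} (c : 𝒢.AdaptedCoordinates x₀)

theorem mdifferentiableAt_coord {g : G} (hg : g ∈ c.coord.source) :
    MDifferentiableAt (𝓡 (n + m)) 𝓘(ℝ, Coord n m) c.coord g :=
  (c.contMDiffOn_coord.contMDiffAt (c.coord.open_source.mem_nhds hg)).mdifferentiableAt (by simp)

theorem mdifferentiableAt_symm {z : Coord n m} (hz : z ∈ c.coord.target) :
    MDifferentiableAt 𝓘(ℝ, Coord n m) (𝓡 (n + m)) c.coord.symm z :=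
  (c.contMDiffOn_coord_symm.contMDiffAt
    (c.coord.open_target.mem_nhds hz)).mdifferentiableAt (by simp)

/-- The points of `M` whose identity lies in the coordinate domain. -/
def baseDom : Set M := 𝒢.unit ⁻¹' c.coord.source

theorem isOpen_baseDom : IsOpen c.baseDom :=
  c.coord.open_source.preimage 𝒢.contMDiff_unit.continuous

/-- The curve family `ξ ↦ (x, ξ)` in the fibre of the source map over `y = (x)`. -/
def fiberCurve (y : M) (ξ : Fin m → ℝ) : G := c.coord.symm (c.baseCoord y, ξ)

/-- The vector `ξ^γ ∂/∂u^γ` in the fibre of `AG` over `y`. -/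
noncomputable def fiberVec (y : M) : (Fin m → ℝ) →L[ℝ] EuclideanSpace ℝ (Fin (n + m)) :=
  mderiv 𝓘(ℝ, Fin m → ℝ) (𝓡 (n + m)) (c.fiberCurve y) 0

/-- The `u`-coordinates of a tangent vector at an identity. -/
noncomputable def fiberCoord (y : M) : EuclideanSpace ℝ (Fin (n + m)) →L[ℝ] (Fin m → ℝ) :=
  (ContinuousLinearMap.snd ℝ (Fin n → ℝ) (Fin m → ℝ)).comp
    (mderiv (𝓡 (n + m)) 𝓘(ℝ, Coord n m) c.coord (𝒢.unit y))

variable {c} {y : M}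

theorem fiberCurve_zero (hy : y ∈ c.baseDom) : c.fiberCurve y 0 = 𝒢.unit y := c.symm_mk_zero hy

theorem fiberCurve_dom_mem_nhds (hy : y ∈ c.baseDom) :
    (fun ξ : Fin m → ℝ => (c.baseCoord y, ξ)) ⁻¹' c.coord.target ∈ 𝓝 0 :=
  (show Continuous fun ξ : Fin m → ℝ => (c.baseCoord y, ξ) by fun_prop).continuousAt
    |>.preimage_mem_nhds (c.coord.open_target.mem_nhds (c.mk_zero_mem_target hy))

theorem src_fiberCurve (hy : y ∈ c.baseDom) {ξ : Fin m → ℝ}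
    (hξ : (c.baseCoord y, ξ) ∈ c.coord.target) : 𝒢.src (c.fiberCurve y ξ) = y :=
  c.baseCoord.injOn (c.src_symm_mem hξ) (c.mem_baseCoord_source hy) (c.baseCoord_src_symm hξ)

theorem eventually_src_fiberCurve (hy : y ∈ c.baseDom) :
    ∀ᶠ ξ in 𝓝 0, 𝒢.src (c.fiberCurve y ξ) = y := by
  filter_upwards [fiberCurve_dom_mem_nhds hy] with ξ hξ using src_fiberCurve hy hξ

theorem contMDiffAt_fiberCurve (hy : y ∈ c.baseDom) :
    ContMDiffAt 𝓘(ℝ, Fin m → ℝ) (𝓡 (n + m)) ∞ (c.fiberCurve y) 0 :=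
  ContMDiffAt.comp (0 : Fin m → ℝ) (c.contMDiffOn_coord_symm.contMDiffAt
    (c.coord.open_target.mem_nhds (c.mk_zero_mem_target hy)))
    (contDiff_const.prodMk contDiff_id).contMDiff.contMDiffAt

theorem mdifferentiableAt_fiberCurve (hy : y ∈ c.baseDom) :
    MDifferentiableAt 𝓘(ℝ, Fin m → ℝ) (𝓡 (n + m)) (c.fiberCurve y) 0 :=
  (contMDiffAt_fiberCurve hy).mdifferentiableAt (by simp)

theorem fiberVec_mem (hy : y ∈ c.baseDom) (ξ : Fin m → ℝ) :
    (c.fiberVec y ξ : TangentSpace (𝓡 (n + m)) (𝒢.unit y)) ∈ 𝒢.algFiber y := by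
  have h := mderiv_apply_mderiv (fiberCurve_zero hy)
    (𝒢.contMDiff_src.mdifferentiableAt (by simp)) (mdifferentiableAt_fiberCurve hy) ξ
  have e : 𝒢.src ∘ c.fiberCurve y =ᶠ[𝓝 0] fun _ => y := eventually_src_fiberCurve hy
  rw [e.mderiv_eq, mderiv_const] at h
  exact h

theorem fiberCoord_fiberVec (hy : y ∈ c.baseDom) (ξ : Fin m → ℝ) :
    c.fiberCoord y (c.fiberVec y ξ) = ξ := by
  have h := mderiv_apply_mderiv (fiberCurve_zero hy)
    (c.mdifferentiableAt_coord hy) (mdifferentiableAt_fiberCurve hy) ξ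
  have e : c.coord ∘ c.fiberCurve y =ᶠ[𝓝 0] fun ξ => (c.baseCoord y, ξ) := by
    filter_upwards [fiberCurve_dom_mem_nhds hy] with ξ hξ using c.coord.right_inv hξ
  rw [e.mderiv_eq, mderiv_eq_fderiv, (hasFDerivAt_prodMk_right _ _).fderiv] at h
  exact congrArg Prod.snd h

/-- The x-coordinate on G factors through α, so a vector in ker Tα has no x-component and is
recovered from its u-component. -/
theorem fiberVec_fiberCoord (hy : y ∈ c.baseDom) {a : EuclideanSpace ℝ (Fin (n + m))}
    (ha : (a : TangentSpace (𝓡 (n + m)) (𝒢.unit y)) ∈ 𝒢.algFiber y) :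
    c.fiberVec y (c.fiberCoord y a) = a := by
  have h1 := mderiv_apply_mderiv (γ := c.coord) (y := 𝒢.unit y) (c.coord_unit y hy)
    (c.mdifferentiableAt_symm (c.mk_zero_mem_target hy)) (c.mdifferentiableAt_coord hy) a
  have e1 : c.coord.symm ∘ c.coord =ᶠ[𝓝 (𝒢.unit y)] id := by
    filter_upwards [c.coord.open_source.mem_nhds hy] with g hg using c.coord.left_inv hg
  rw [e1.mderiv_eq, mderiv_id] at h1
  have hfst : MDifferentiableAt 𝓘(ℝ, Coord n m) 𝓘(ℝ, Fin n → ℝ) Prod.fst (c.coord (𝒢.unit y)) :=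
    mdifferentiableAt_iff_differentiableAt.2 differentiableAt_fst
  have h2 := mderiv_apply_mderiv rfl hfst (c.mdifferentiableAt_coord hy) a
  have hb : MDifferentiableAt (𝓡 n) 𝓘(ℝ, Fin n → ℝ) c.baseCoord y :=
    (c.contMDiffOn_baseCoord.contMDiffAt (c.baseCoord.open_source.mem_nhds
      (c.mem_baseCoord_source hy))).mdifferentiableAt (by simp)
  have h3 := mderiv_apply_mderiv (𝒢.src_unit y) hb
    (𝒢.contMDiff_src.mdifferentiableAt (by simp)) a
  have e2 : Prod.fst ∘ c.coord =ᶠ[𝓝 (𝒢.unit y)] c.baseCoord ∘ 𝒢.src := by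
    filter_upwards [c.coord.open_source.mem_nhds hy] with g hg using c.coord_fst g hg
  have ha' : mderiv (𝓡 (n + m)) (𝓡 n) 𝒢.src (𝒢.unit y) a = 0 := ha
  rw [ha', map_zero] at h3
  rw [e2.mderiv_eq, ← h3, mderiv_eq_fderiv, fderiv_fst] at h2
  have hmk : MDifferentiableAt 𝓘(ℝ, Fin m → ℝ) 𝓘(ℝ, Coord n m)
      (fun ξ : Fin m → ℝ => (c.baseCoord y, ξ)) 0 :=
    mdifferentiableAt_iff_differentiableAt.2 (by fun_prop)
  have h4 := mderiv_apply_mderiv (γ := fun ξ : Fin m → ℝ => (c.baseCoord y, ξ)) (y := 0) rfl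
    (c.mdifferentiableAt_symm (c.mk_zero_mem_target hy)) hmk (c.fiberCoord y a)
  rw [mderiv_eq_fderiv, (hasFDerivAt_prodMk_right _ _).fderiv] at h4
  refine h4.symm.trans (Eq.trans ?_ h1)
  exact congrArg _ (Prod.ext h2.symm rfl)

/-- The fibre of `AG` over `y` is identified with `ℝ^m` by the coordinates. -/
noncomputable def fiberEquiv (hy : y ∈ c.baseDom) : (Fin m → ℝ) ≃ₗ[ℝ] 𝒢.algFiber y where
  toFun ξ := ⟨c.fiberVec y ξ, fiberVec_mem hy ξ⟩
  map_add' ξ η := Subtype.ext (map_add (c.fiberVec y) ξ η)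
  map_smul' r ξ := Subtype.ext (map_smul (c.fiberVec y) r ξ)
  invFun a := c.fiberCoord y a.1
  left_inv ξ := fiberCoord_fiberVec hy ξ
  right_inv a := Subtype.ext (fiberVec_fiberCoord hy a.2)

section Trans

variable {Y : 𝒢.LocalBisection} {z : Coord n m}

theorem src_transChart (hz : z ∈ c.chartDom Y) :
    𝒢.src (c.transChart Y z) = 𝒢.src (c.coord.symm z) :=
  Y.src_rightTrans (tgt_mem_of_mem_chartDom hz)

theorem src_transChart_mem (hz : z ∈ c.chartDom Y) : 𝒢.src (c.transChart Y z) ∈ c.baseDom := by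
  rw [src_transChart hz]
  exact unit_mem_of_mem_chartDom hz

theorem baseCoord_src_transChart (hz : z ∈ c.chartDom Y) :
    c.baseCoord (𝒢.src (c.transChart Y z)) = z.1 := by
  rw [src_transChart hz, c.baseCoord_src_symm (mem_target_of_mem_chartDom hz)]

theorem mdifferentiableAt_transChart (hz : z ∈ c.chartDom Y) :
    MDifferentiableAt 𝓘(ℝ, Coord n m) (𝓡 (n + m)) (c.transChart Y) z :=
  ((c.contMDiffOn_transChart Y).contMDiffAt
    ((c.isOpen_chartDom Y).mem_nhds hz)).mdifferentiableAt (by simp)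

theorem contDiffOn_lagr {L : G → ℝ} (hL : ContMDiff (𝓡 (n + m)) 𝓘(ℝ, ℝ) ∞ L) :
    ContDiffOn ℝ ∞ (c.lagr L Y) (c.chartDom Y) := by
  rw [← contMDiffOn_iff_contDiffOn]
  exact hL.comp_contMDiffOn (c.contMDiffOn_transChart Y)

theorem inv_fiberCurve_mul_transChart (hz : z ∈ c.chartDom Y) :
    (fun ξ => 𝒢.mul (𝒢.inv (c.fiberCurve (𝒢.src (c.transChart Y z)) ξ)) (c.transChart Y z))
      =ᶠ[𝓝 0] (c.transChart Y ∘ fun ξ => c.coord (c.curve z ξ)) := by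
  filter_upwards [(isOpen_curveDom (mem_target_of_mem_chartDom hz)).mem_nhds
    (zero_mem_curveDom hz)] with ξ hξ
  rw [fiberCurve, baseCoord_src_transChart hz, inv_symm_mul_transChart hz hξ]
  rfl

/-- The derivative of `R_Y` in the coordinates `(x, u)`. -/
noncomputable def transDeriv (c : 𝒢.AdaptedCoordinates x₀) (Y : 𝒢.LocalBisection) (z : Coord n m) :
    Coord n m →L[ℝ] EuclideanSpace ℝ (Fin (n + m)) :=
  mderiv 𝓘(ℝ, Coord n m) (𝓡 (n + m)) (c.transChart Y) z

theorem mderiv_inv_fiberCurve_mul (hz : z ∈ c.chartDom Y) (ξ : Fin m → ℝ) :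
    mderiv 𝓘(ℝ, Fin m → ℝ) (𝓡 (n + m)) (fun ξ =>
      𝒢.mul (𝒢.inv (c.fiberCurve (𝒢.src (c.transChart Y z)) ξ)) (c.transChart Y z)) 0 ξ =
      c.transDeriv Y z (c.curveDeriv z ξ) := by
  have e := hasFDerivAt_coord_curve hz
  have h0 : c.coord (c.curve z 0) = z := by
    rw [curve_zero hz, c.coord.right_inv (mem_target_of_mem_chartDom hz)]
  have h := mderiv_apply_mderiv (γ := fun ξ => c.coord (c.curve z ξ)) (y := 0) h0
    (mdifferentiableAt_transChart hz) e.hasMFDerivAt.mdifferentiableAt ξ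
  rw [(inv_fiberCurve_mul_transChart hz).mderiv_eq, ← h, mderiv_eq_fderiv, e.fderiv]
  rfl

theorem mderiv_comp_transDeriv {F : Type*} [NormedAddCommGroup F] [NormedSpace ℝ F] {f : G → F}
    (hz : z ∈ c.chartDom Y)
    (hf : MDifferentiableAt (𝓡 (n + m)) 𝓘(ℝ, F) f (c.transChart Y z)) (w : Coord n m) :
    mderiv (𝓡 (n + m)) 𝓘(ℝ, F) f (c.transChart Y z) (c.transDeriv Y z w) =
      fderiv ℝ (fun z => f (c.transChart Y z)) z w := by
  have h := mderiv_apply_mderiv rfl hf (mdifferentiableAt_transChart hz) w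
  rw [mderiv_eq_fderiv] at h
  exact h

/-- Represent X at the source by the family ξ ↦ (x, ξ); inversion followed by right translation
turns it into (x, ξ)⁻¹ · R_Υ(z), whose velocity is known. -/
theorem rightField_transChart (hz : z ∈ c.chartDom Y) (X : 𝒢.AlgSection) :
    𝒢.rightField X (c.transChart Y z) = -c.transDeriv Y z (c.curveDeriv z
      (c.fiberCoord (𝒢.src (c.transChart Y z)) (X.toFun (𝒢.src (c.transChart Y z))).1)) := by
  have hyD := src_transChart_mem hz
  have hX := fiberVec_fiberCoord hyD (X.toFun (𝒢.src (c.transChart Y z))).2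
  have hinv : MDifferentiableAt (𝓡 (n + m)) (𝓡 (n + m)) 𝒢.inv
      (𝒢.unit (𝒢.src (c.transChart Y z))) := 𝒢.contMDiff_inv.mdifferentiableAt (by simp)
  have hc := mdifferentiableAt_fiberCurve hyD
  have hic : MDifferentiableAt 𝓘(ℝ, Fin m → ℝ) (𝓡 (n + m))
      (𝒢.inv ∘ c.fiberCurve (𝒢.src (c.transChart Y z))) 0 :=
    MDifferentiableAt.comp (0 : Fin m → ℝ) (by rw [fiberCurve_zero hyD]; exact hinv) hc
  have h0 : (𝒢.inv ∘ c.fiberCurve (𝒢.src (c.transChart Y z))) 0 =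
      𝒢.unit (𝒢.src (c.transChart Y z)) := by
    rw [Function.comp_apply, fiberCurve_zero hyD, 𝒢.inv_unit]
  -- The formula is proved for vectors of the form `fiberVec`, which are velocities of a family in
  -- the source fibre; `hX` then rewrites the value of X in this form.
  have key : ∀ ξ, -mderivWithin (𝓡 (n + m)) (𝓡 (n + m)) (fun h => 𝒢.mul h (c.transChart Y z))
      (𝒢.tgt ⁻¹' {𝒢.src (c.transChart Y z)}) (𝒢.unit (𝒢.src (c.transChart Y z)))
      (mderiv (𝓡 (n + m)) (𝓡 (n + m)) 𝒢.inv (𝒢.unit (𝒢.src (c.transChart Y z)))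
        (c.fiberVec (𝒢.src (c.transChart Y z)) ξ)) = -c.transDeriv Y z (c.curveDeriv z ξ) := by
    intro ξ
    rw [fiberVec, mderiv_apply_mderiv (fiberCurve_zero hyD) hinv hc,
      mderivWithin_apply_mderiv h0 (𝒢.mdifferentiableWithinAt_mul_right _) hic
        (by filter_upwards [eventually_src_fiberCurve hyD] with η hη using (𝒢.tgt_inv _).trans hη)]
    exact congrArg Neg.neg (mderiv_inv_fiberCurve_mul hz ξ)
  have h := key (c.fiberCoord (𝒢.src (c.transChart Y z))
    (X.toFun (𝒢.src (c.transChart Y z))).1)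
  rw [hX] at h
  exact h

theorem vecAct_rightField_transChart {L : G → ℝ} (hL : ContMDiff (𝓡 (n + m)) 𝓘(ℝ, ℝ) ∞ L)
    (hz : z ∈ c.chartDom Y) (X : 𝒢.AlgSection) :
    vecAct L (c.transChart Y z) (𝒢.rightField X (c.transChart Y z)) =
      -fderiv ℝ (c.lagr L Y) z (c.curveDeriv z
      (c.fiberCoord (𝒢.src (c.transChart Y z)) (X.toFun (𝒢.src (c.transChart Y z))).1)) := by
  rw [rightField_transChart hz]
  refine (map_neg (mderiv (𝓡 (n + m)) 𝓘(ℝ, ℝ) L (c.transChart Y z)) _).trans ?_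
  exact congrArg Neg.neg (mderiv_comp_transDeriv hz (hL.mdifferentiableAt (by simp)) _)

/-- The same family (x, ξ)⁻¹ · R_Υ(z) computes 𝔽⁻L, so its value on X is the derivative of L along
the right-invariant field of X. -/
theorem legendreMinus_transChart {L : G → ℝ} (hL : ContMDiff (𝓡 (n + m)) 𝓘(ℝ, ℝ) ∞ L)
    (hz : z ∈ c.chartDom Y) (a : 𝒢.algFiber (𝒢.src (c.transChart Y z))) :
    (𝒢.legendreMinus L (c.transChart Y z)).2 a =
      -fderiv ℝ (c.lagr L Y) z (c.curveDeriv z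
        (c.fiberCoord (𝒢.src (c.transChart Y z)) a.1)) := by
  have hyD := src_transChart_mem hz
  have hX := fiberVec_fiberCoord hyD a.2
  have key : ∀ ξ, -mderivWithin (𝓡 (n + m)) 𝓘(ℝ, ℝ)
      (fun k => L (𝒢.mul (𝒢.inv k) (c.transChart Y z)))
      (𝒢.src ⁻¹' {𝒢.src (c.transChart Y z)}) (𝒢.unit (𝒢.src (c.transChart Y z)))
        (c.fiberVec (𝒢.src (c.transChart Y z)) ξ) =
      -fderiv ℝ (c.lagr L Y) z (c.curveDeriv z ξ) := by
    intro ξ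
    have e : ((fun k => L (𝒢.mul (𝒢.inv k) (c.transChart Y z))) ∘
        c.fiberCurve (𝒢.src (c.transChart Y z))) =ᶠ[𝓝 0]
        c.lagr L Y ∘ fun ξ => c.coord (c.curve z ξ) := by
      filter_upwards [inv_fiberCurve_mul_transChart hz] with η hη using congrArg L hη
    have h0 : c.coord (c.curve z 0) = z := by
      rw [curve_zero hz, c.coord.right_inv (mem_target_of_mem_chartDom hz)]
    have hl : HasFDerivAt (c.lagr L Y) (fderiv ℝ (c.lagr L Y) z) (c.coord (c.curve z 0)) := by
      rw [h0]
      exact (((contDiffOn_lagr hL).contDiffAt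
        ((c.isOpen_chartDom Y).mem_nhds hz)).differentiableAt (by simp)).hasFDerivAt
    have hlc := HasFDerivAt.comp (g := c.lagr L Y) (f := fun ξ => c.coord (c.curve z ξ)) 0 hl
      (hasFDerivAt_coord_curve hz)
    rw [fiberVec, mderivWithin_apply_mderiv (fiberCurve_zero hyD)
      (𝒢.mdifferentiableWithinAt_inv_mul hL (c.transChart Y z)) (mdifferentiableAt_fiberCurve hyD)
      (eventually_src_fiberCurve hyD), e.mderiv_eq, mderiv_eq_fderiv,
      hlc.fderiv]
    rfl
  have h := key (c.fiberCoord (𝒢.src (c.transChart Y z)) a.1)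
  rw [hX] at h
  exact h

end Trans

/-- The derivative of `L` at `g` along the left-invariant vector fields, in the coordinates of
`AG`. -/
noncomputable def leftMomentum (c : 𝒢.AdaptedCoordinates x₀) (L : G → ℝ) (g : G) :
    (Fin m → ℝ) →L[ℝ] ℝ :=
  fderiv ℝ (fun ξ => L (𝒢.mul g (c.fiberCurve (𝒢.tgt g) ξ))) 0

theorem vecAct_leftField {L : G → ℝ} (hL : ContMDiff (𝓡 (n + m)) 𝓘(ℝ, ℝ) ∞ L) {g : G}
    (hg : 𝒢.tgt g ∈ c.baseDom) (X : 𝒢.AlgSection) :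
    vecAct L g (𝒢.leftField X g) =
      c.leftMomentum L g (c.fiberCoord (𝒢.tgt g) (X.toFun (𝒢.tgt g)).1) := by
  have hX := fiberVec_fiberCoord hg (X.toFun (𝒢.tgt g)).2
  have key : ∀ ξ, mderiv (𝓡 (n + m)) 𝓘(ℝ, ℝ) L g (mderivWithin (𝓡 (n + m)) (𝓡 (n + m))
      (fun h => 𝒢.mul g h) (𝒢.src ⁻¹' {𝒢.tgt g}) (𝒢.unit (𝒢.tgt g)) (c.fiberVec (𝒢.tgt g) ξ)) =
      c.leftMomentum L g ξ := by
    intro ξ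
    have hmul : MDifferentiableAt 𝓘(ℝ, Fin m → ℝ) (𝓡 (n + m))
        ((fun h => 𝒢.mul g h) ∘ c.fiberCurve (𝒢.tgt g)) 0 :=
      (𝒢.contMDiffAt_mul contMDiffAt_const (contMDiffAt_fiberCurve hg) (by
        filter_upwards [eventually_src_fiberCurve hg] with η hη using hη.symm)).mdifferentiableAt
        (by simp)
    have h0 : ((fun h => 𝒢.mul g h) ∘ c.fiberCurve (𝒢.tgt g)) 0 = g := by
      rw [Function.comp_apply, fiberCurve_zero hg, 𝒢.mul_unit]
    rw [fiberVec, mderivWithin_apply_mderiv (fiberCurve_zero hg)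
      (𝒢.mdifferentiableWithinAt_mul_left g) (mdifferentiableAt_fiberCurve hg)
      (eventually_src_fiberCurve hg), mderiv_apply_mderiv h0 (hL.mdifferentiableAt (by simp)) hmul,
      mderiv_eq_fderiv]
    rfl
  have h := key (c.fiberCoord (𝒢.tgt g) (X.toFun (𝒢.tgt g)).1)
  rw [hX] at h
  exact h

/-- Both invariant fields depend on X only through its value at β(g) = α(h). Since every fibre
vector extends to a section, the equations for all X become an equality of two covectors on ℝ^m. -/
theorem isDELSolution_iff [T2Space M] {L : G → ℝ} (hL : ContMDiff (𝓡 (n + m)) 𝓘(ℝ, ℝ) ∞ L)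
    {Y : 𝒢.LocalBisection} {z : Coord n m} (hz : z ∈ c.chartDom Y) {g : G}
    (hg : 𝒢.tgt g ∈ c.baseDom) :
    𝒢.IsDELSolution L g (c.transChart Y z) ↔ c.baseCoord (𝒢.tgt g) = z.1 ∧
      ∀ ξ, c.leftMomentum L g ξ = -fderiv ℝ (c.lagr L Y) z (c.curveDeriv z ξ) := by
  have hb : 𝒢.tgt g = 𝒢.src (c.transChart Y z) ↔ c.baseCoord (𝒢.tgt g) = z.1 := by
    rw [← baseCoord_src_transChart hz]
    exact (c.baseCoord.injOn.eq_iff (c.mem_baseCoord_source hg)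
      (c.mem_baseCoord_source (src_transChart_mem hz))).symm
  rw [IsDELSolution, ← hb]
  refine and_congr_right fun e => ?_
  have hX : ∀ X : 𝒢.AlgSection, vecAct L g (𝒢.leftField X g) -
      vecAct L (c.transChart Y z) (𝒢.rightField X (c.transChart Y z)) =
      c.leftMomentum L g (c.fiberCoord (𝒢.tgt g) (X.toFun (𝒢.tgt g)).1) -
      -fderiv ℝ (c.lagr L Y) z (c.curveDeriv z
        (c.fiberCoord (𝒢.tgt g) (X.toFun (𝒢.tgt g)).1)) := by
    intro X
    rw [vecAct_leftField hL hg, vecAct_rightField_transChart hL hz, e]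
  constructor
  · intro h ξ
    obtain ⟨X, hX'⟩ := 𝒢.exists_algSection (𝒢.tgt g) (fiberEquiv hg ξ)
    have h1 := h X
    rw [hX, hX', sub_eq_zero] at h1
    have h2 : c.fiberCoord (𝒢.tgt g) (fiberEquiv hg ξ).1 = ξ := fiberCoord_fiberVec hg ξ
    rwa [h2] at h1
  · intro h X
    rw [hX, sub_eq_zero, h]

end AdaptedCoordinates

end LieGroupoid

/-! ### The matrix 𝔽L as the u-derivative of the momentum -/

namespace LieGroupoid

variable {n m : ℕ} {G M : Type*}
  [TopologicalSpace G] [ChartedSpace (EuclideanSpace ℝ (Fin (n + m))) G]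
  [IsManifold (𝓡 (n + m)) ∞ G]
  [TopologicalSpace M] [ChartedSpace (EuclideanSpace ℝ (Fin n)) M]
  [IsManifold (𝓡 n) ∞ M]
  {𝒢 : LieGroupoid n m G M}

theorem fderiv_eq_sum_pdx_add_sum_pdu (f : Coord n m → ℝ) (z w : Coord n m) :
    fderiv ℝ f z w = (∑ i, w.1 i * pdx i f z) + ∑ ν, w.2 ν * pdu ν f z := by
  have h1 : w = (∑ i, w.1 i • ((Pi.single i 1, 0) : Coord n m)) +
      ∑ ν, w.2 ν • ((0, Pi.single ν 1) : Coord n m) := by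
    refine Prod.ext ?_ ?_
    · simp only [Prod.fst_add, Prod.fst_sum, Prod.smul_mk, smul_zero, Finset.sum_const_zero,
        add_zero]
      exact pi_eq_sum_univ' w.1
    · simp only [Prod.snd_add, Prod.snd_sum, Prod.smul_mk, smul_zero, Finset.sum_const_zero,
        zero_add]
      exact pi_eq_sum_univ' w.2
  conv_lhs => rw [h1]
  simp only [map_add, map_sum, map_smul, smul_eq_mul]
  rfl

theorem fderiv_fderiv_apply_comm {E : Type*} [NormedAddCommGroup E] [NormedSpace ℝ E] {f : E → ℝ}
    {z : E} (hf : ContDiffAt ℝ ∞ f z) (v w : E) :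
    fderiv ℝ (fun z => fderiv ℝ f z v) z w = fderiv ℝ (fun z => fderiv ℝ f z w) z v := by
  have hs : IsSymmSndFDerivAt ℝ f z := hf.isSymmSndFDerivAt (by
    rw [minSmoothness_of_isRCLikeNormedField]; exact WithTop.coe_le_coe.2 (le_top (a := (2 : ℕ∞))))
  have hd : DifferentiableAt ℝ (fderiv ℝ f) z :=
    (hf.fderiv_right (m := ∞) (by simp)).differentiableAt (by simp)
  have key : ∀ v w : E, fderiv ℝ (fun z => fderiv ℝ f z v) z w =
      fderiv ℝ (fderiv ℝ f) z w v := by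
    intro v w
    rw [(hd.hasFDerivAt.clm_apply (hasFDerivAt_const v z)).fderiv]
    simp
  rw [key, key, hs.eq]

namespace AdaptedCoordinates

variable {x₀ : M} (c : 𝒢.AdaptedCoordinates x₀)

/-- The discrete momentum `-(𝔽⁻L)(R_Y(z))` in the coordinates of `AG`. -/
noncomputable def rightMomentum (L : G → ℝ) (Y : 𝒢.LocalBisection) (z : Coord n m) :
    (Fin m → ℝ) →L[ℝ] ℝ :=
  (fderiv ℝ (c.lagr L Y) z).comp (c.curveDeriv z)

variable {c} {Y : 𝒢.LocalBisection} {z : Coord n m} {L : G → ℝ}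

theorem contDiffOn_rightMomentum (hL : ContMDiff (𝓡 (n + m)) 𝓘(ℝ, ℝ) ∞ L) :
    ContDiffOn ℝ ∞ (c.rightMomentum L Y) (c.chartDom Y) :=
  ((contDiffOn_lagr hL).fderiv_of_isOpen (c.isOpen_chartDom Y) (by simp)).clm_comp
    (c.contDiffOn_curveDeriv Y)

theorem rho_eq (hz : z ∈ c.chartDom Y) (i : Fin n) (μ : Fin m) :
    c.rho i μ z.1 = (c.curveDeriv z (Pi.single μ 1)).1 i := by
  have hb : HasFDerivAt c.bMap (fderiv ℝ c.bMap (z.1, 0)) (z.1, 0) :=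
    ((c.contMDiffOn_bMap.contDiffOn.contDiffAt
      (c.isOpen_bDom.mem_nhds (fst_zero_mem_bDom hz))).differentiableAt (by simp)).hasFDerivAt
  have h := hasFDerivAt_pi'.1 (hb.comp (0 : Fin m → ℝ) (hasFDerivAt_prodMk_right _ _)) i
  exact DFunLike.congr_fun h.fderiv (Pi.single μ 1)

theorem R_eq (hz : z ∈ c.chartDom Y) (ν μ : Fin m) :
    c.R ν μ z = -(c.curveDeriv z (Pi.single μ 1)).2 ν := by
  have hP : HasFDerivAt c.pMap (fderiv ℝ c.pMap ((z.1, 0), z.2)) ((z.1, 0), z.2) :=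
    ((c.contDiffOn_pMap.contDiffAt (c.isOpen_pDom.mem_nhds (mem_pDom hz))).differentiableAt
      (by simp)).hasFDerivAt
  have h1 : HasFDerivAt (fun u : Fin m → ℝ => (((z.1, u), z.2) : Coord n m × (Fin m → ℝ)))
      ((ContinuousLinearMap.inl ℝ _ _).comp (ContinuousLinearMap.inr ℝ _ _)) 0 :=
    HasFDerivAt.comp (g := fun a : Coord n m => (a, z.2)) (f := fun u : Fin m → ℝ => (z.1, u)) 0
      (hasFDerivAt_prodMk_left _ _) (hasFDerivAt_prodMk_right _ _)
  have h := hasFDerivAt_pi'.1 (hP.comp (0 : Fin m → ℝ) h1) ν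
  refine (DFunLike.congr_fun h.fderiv (Pi.single μ 1)).trans ?_
  rw [curveDeriv_snd, Pi.neg_apply, neg_neg]
  rfl

/-- The coefficient ρ(x)ξ is a derivative of b at (x, 0) and so does not involve u. This is why 𝔽L
contains no derivative of ρ. -/
theorem fderiv_curveDeriv_fst (hz : z ∈ c.chartDom Y) (ξ : Fin m → ℝ) (w : Fin m → ℝ) (i : Fin n) :
    fderiv ℝ (fun z => (c.curveDeriv z ξ).1 i) z (0, w) = 0 := by
  have h1 : ContDiffOn ℝ ∞ (fderiv ℝ c.bMap) c.bDom :=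
    c.contMDiffOn_bMap.contDiffOn.fderiv_of_isOpen c.isOpen_bDom (by simp)
  have h2 : DifferentiableAt ℝ (fderiv ℝ c.bMap) (z.1, 0) :=
    (h1.contDiffAt (c.isOpen_bDom.mem_nhds (fst_zero_mem_bDom hz))).differentiableAt (by simp)
  have h3 : DifferentiableAt ℝ
      (fun x : Fin n → ℝ => fderiv ℝ c.bMap (x, (0 : Fin m → ℝ)) (0, ξ) i) z.1 := by
    have h4 : DifferentiableAt ℝ (fun x : Fin n → ℝ => fderiv ℝ c.bMap (x, (0 : Fin m → ℝ))) z.1 :=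
      h2.comp z.1 (f := fun x : Fin n → ℝ => (x, (0 : Fin m → ℝ))) (by fun_prop)
    exact differentiableAt_pi.1 (h4.clm_apply (differentiableAt_const _)) i
  have h5 := h3.hasFDerivAt.comp z (hasFDerivAt_fst (p := z))
  exact (DFunLike.congr_fun h5.fderiv (0, w)).trans
    (map_zero (fderiv ℝ (fun x : Fin n → ℝ => fderiv ℝ c.bMap (x, (0 : Fin m → ℝ)) (0, ξ) i) z.1))

/-- The product rule applied to ρ ∂ℓ/∂x - R ∂ℓ/∂u, combined with the symmetry of second derivatives
to match the order of differentiation in `FL`. -/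
theorem fderiv_rightMomentum_single (hL : ContMDiff (𝓡 (n + m)) 𝓘(ℝ, ℝ) ∞ L)
    (hz : z ∈ c.chartDom Y) (γ μ : Fin m) :
    fderiv ℝ (fun z => c.rightMomentum L Y z (Pi.single μ 1)) z (0, Pi.single γ 1) =
      c.FL L Y z γ μ := by
  have hn := (c.isOpen_chartDom Y).mem_nhds hz
  have hl : ContDiffAt ℝ ∞ (c.lagr L Y) z := (contDiffOn_lagr hL).contDiffAt hn
  have hl' : DifferentiableAt ℝ (fderiv ℝ (c.lagr L Y)) z :=
    (hl.fderiv_right (m := ∞) (by simp)).differentiableAt (by simp)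
  have hD : DifferentiableAt ℝ (fun z => c.curveDeriv z (Pi.single μ 1)) z :=
    (((c.contDiffOn_curveDeriv Y).contDiffAt hn).differentiableAt (by simp)).clm_apply
      (differentiableAt_const _)
  have hr : ∀ i, DifferentiableAt ℝ (fun z => (c.curveDeriv z (Pi.single μ 1)).1 i) z :=
    fun i => differentiableAt_pi.1 hD.fst i
  have hs : ∀ ν, DifferentiableAt ℝ (fun z => (c.curveDeriv z (Pi.single μ 1)).2 ν) z :=
    fun i => differentiableAt_pi.1 hD.snd i
  have hpx : ∀ i, DifferentiableAt ℝ (pdx i (c.lagr L Y)) z :=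
    fun i => hl'.clm_apply (differentiableAt_const _)
  have hpu : ∀ ν, DifferentiableAt ℝ (pdu ν (c.lagr L Y)) z :=
    fun i => hl'.clm_apply (differentiableAt_const _)
  have e : (fun z => c.rightMomentum L Y z (Pi.single μ 1)) = fun z =>
      (∑ i, (c.curveDeriv z (Pi.single μ 1)).1 i * pdx i (c.lagr L Y) z) +
        ∑ ν, (c.curveDeriv z (Pi.single μ 1)).2 ν * pdu ν (c.lagr L Y) z :=
    funext fun z => fderiv_eq_sum_pdx_add_sum_pdu _ _ _
  have hd := (HasFDerivAt.fun_sum fun i (_ : i ∈ Finset.univ) =>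
    (hr i).hasFDerivAt.mul (hpx i).hasFDerivAt).add
    (HasFDerivAt.fun_sum fun ν (_ : ν ∈ Finset.univ) =>
      (hs ν).hasFDerivAt.mul (hpu ν).hasFDerivAt)
  have hR : ∀ ν, pdu γ (c.R ν μ) z =
      -fderiv ℝ (fun z => (c.curveDeriv z (Pi.single μ 1)).2 ν) z (0, Pi.single γ 1) := by
    intro ν
    have e : c.R ν μ =ᶠ[𝓝 z] fun z => -(c.curveDeriv z (Pi.single μ 1)).2 ν := by
      filter_upwards [hn] with z hz using R_eq hz ν μ
    rw [pdu, e.fderiv_eq, fderiv_fun_neg]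
    rfl
  have h1 : ∀ f : Coord n m → ℝ, fderiv ℝ f z (0, Pi.single γ 1) = pdu γ f z := fun f => rfl
  have h2 : ∀ ν, pdu γ (pdu ν (c.lagr L Y)) z = pdu ν (pdu γ (c.lagr L Y)) z :=
    fun ν => fderiv_fderiv_apply_comm hl _ _
  have h3 : ∀ i, pdu γ (pdx i (c.lagr L Y)) z = pdx i (pdu γ (c.lagr L Y)) z :=
    fun i => fderiv_fderiv_apply_comm hl _ _
  rw [e]
  refine (DFunLike.congr_fun hd.fderiv (0, Pi.single γ 1)).trans ?_
  simp only [FL, Matrix.of_apply, add_apply, sum_apply, smul_apply, smul_eq_mul,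
    fderiv_curveDeriv_fst hz, hR, rho_eq hz, R_eq hz, Finset.sum_add_distrib, h1, h2, h3, mul_comm]
  simp only [mul_neg, Finset.sum_neg_distrib, Finset.sum_const_zero, zero_mul]
  ring

theorem fderiv_rightMomentum (hL : ContMDiff (𝓡 (n + m)) 𝓘(ℝ, ℝ) ∞ L)
    (hz : z ∈ c.chartDom Y) (w ξ : Fin m → ℝ) :
    fderiv ℝ (fun z => c.rightMomentum L Y z ξ) z (0, w) = (Matrix.vecMul w (c.FL L Y z)) ⬝ᵥ ξ := by
  have hn := (c.isOpen_chartDom Y).mem_nhds hz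
  have hd : ∀ ξ, DifferentiableAt ℝ (fun z => c.rightMomentum L Y z ξ) z := fun ξ =>
    (((contDiffOn_rightMomentum hL).contDiffAt hn).differentiableAt (by simp)).clm_apply
      (differentiableAt_const _)
  have e : (fun z => c.rightMomentum L Y z ξ) =
      fun z => ∑ μ, ξ μ * c.rightMomentum L Y z (Pi.single μ 1) := by
    funext z
    conv_lhs => rw [pi_eq_sum_univ' ξ]
    simp
  have h := HasFDerivAt.fun_sum fun μ (_ : μ ∈ Finset.univ) => (hd (Pi.single μ 1)).hasFDerivAt.const_mul (ξ μ)
  rw [e, h.fderiv, sum_apply, dotProduct]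
  refine Finset.sum_congr rfl fun μ _ => ?_
  have hw : ((0, w) : Coord n m) = ∑ γ, w γ • ((0, Pi.single γ 1) : Coord n m) := by
    refine Prod.ext ?_ ?_
    · simp [Prod.fst_sum]
    · simp only [Prod.snd_sum, Prod.smul_mk]
      exact pi_eq_sum_univ' w
  rw [smul_apply, hw, map_sum, Matrix.vecMul, dotProduct, smul_eq_mul, mul_comm]
  congr 1
  refine Finset.sum_congr rfl fun γ _ => ?_
  rw [map_smul, fderiv_rightMomentum_single hL hz, smul_eq_mul]

end AdaptedCoordinates

end LieGroupoid

/-! ### Regularity of 𝔽L and the Legendre transformation -/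

namespace LieGroupoid

variable {n m : ℕ} {G M : Type*}
  [TopologicalSpace G] [ChartedSpace (EuclideanSpace ℝ (Fin (n + m))) G]
  [IsManifold (𝓡 (n + m)) ∞ G]
  [TopologicalSpace M] [ChartedSpace (EuclideanSpace ℝ (Fin n)) M]
  [IsManifold (𝓡 n) ∞ M]
  {𝒢 : LieGroupoid n m G M}

namespace AdaptedCoordinates

variable {x₀ : M} (c : 𝒢.AdaptedCoordinates x₀)

/-- The map `R_Y(x, u) ↦ (x, 𝔽⁻L(R_Y(x, u)))` in coordinates. -/
noncomputable def legendreCoord (L : G → ℝ) (Y : 𝒢.LocalBisection) (z : Coord n m) : Coord n m :=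
  (z.1, fun μ => -c.rightMomentum L Y z (Pi.single μ 1))

variable {c} {Y : 𝒢.LocalBisection} {z : Coord n m} {L : G → ℝ}

theorem contDiffOn_legendreCoord (hL : ContMDiff (𝓡 (n + m)) 𝓘(ℝ, ℝ) ∞ L) :
    ContDiffOn ℝ ∞ (c.legendreCoord L Y) (c.chartDom Y) :=
  contDiff_fst.contDiffOn.prodMk (contDiffOn_pi.2 fun _ =>
    ((contDiffOn_rightMomentum hL).clm_apply contDiffOn_const).neg)

theorem continuousOn_det_FL (hL : ContMDiff (𝓡 (n + m)) 𝓘(ℝ, ℝ) ∞ L) :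
    ContinuousOn (fun z => (c.FL L Y z).det) (c.chartDom Y) := by
  have h : ContinuousOn (c.FL L Y) (c.chartDom Y) := by
    refine continuousOn_pi.2 fun γ => continuousOn_pi.2 fun μ => ?_
    have h1 : ContDiffOn ℝ ∞ (fun z => c.rightMomentum L Y z (Pi.single μ 1)) (c.chartDom Y) :=
      (contDiffOn_rightMomentum hL).clm_apply contDiffOn_const
    have h2 := h1.fderiv_of_isOpen (m := ∞) (c.isOpen_chartDom Y) (by simp)
    refine (h2.continuousOn.clm_apply (continuousOn_const (c := (0, Pi.single γ 1)))).congr ?_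
    exact fun z hz => (fderiv_rightMomentum_single hL hz γ μ).symm
  exact continuous_id.matrix_det.comp_continuousOn h

/-- A kernel vector (a, w) of the derivative has a = 0 from the first component, and then the second
component makes w a left null vector of 𝔽L; injectivity suffices in finite dimension. -/
theorem hasFDerivAt_legendreCoord_equiv (hL : ContMDiff (𝓡 (n + m)) 𝓘(ℝ, ℝ) ∞ L)
    (hz : z ∈ c.chartDom Y) (hdet : (c.FL L Y z).det ≠ 0) :
    ∃ e : Coord n m ≃L[ℝ] Coord n m,
      HasFDerivAt (c.legendreCoord L Y) (e : Coord n m →L[ℝ] Coord n m) z := by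
  have hn := (c.isOpen_chartDom Y).mem_nhds hz
  have hd : ∀ ξ, DifferentiableAt ℝ (fun z => c.rightMomentum L Y z ξ) z := fun ξ =>
    (((contDiffOn_rightMomentum hL).contDiffAt hn).differentiableAt (by simp)).clm_apply
      (differentiableAt_const _)
  have h : HasFDerivAt (c.legendreCoord L Y) ((ContinuousLinearMap.fst ℝ _ _).prod
      (ContinuousLinearMap.pi fun μ =>
        -fderiv ℝ (fun z => c.rightMomentum L Y z (Pi.single μ 1)) z)) z :=
    hasFDerivAt_fst.prodMk (hasFDerivAt_pi.2 fun μ => (hd _).hasFDerivAt.neg)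
  set A := (ContinuousLinearMap.fst ℝ (Fin n → ℝ) (Fin m → ℝ)).prod
      (ContinuousLinearMap.pi fun μ =>
        -fderiv ℝ (fun z => c.rightMomentum L Y z (Pi.single μ 1)) z) with hA
  have hinj : Function.Injective A.toLinearMap := by
    rw [← LinearMap.ker_eq_bot, LinearMap.ker_eq_bot']
    rintro ⟨a, w⟩ haw
    have h1 : a = 0 := congrArg Prod.fst haw
    subst h1
    have h2 : Matrix.vecMul w (c.FL L Y z) = 0 := by
      funext μ
      have h3 : -fderiv ℝ (fun z => c.rightMomentum L Y z (Pi.single μ 1)) z (0, w) = 0 :=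
        congrFun (congrArg Prod.snd haw) μ
      rw [fderiv_rightMomentum hL hz, neg_eq_zero, dotProduct_single_one] at h3
      exact h3
    by_contra hne
    exact hdet (Matrix.exists_vecMul_eq_zero_iff.1 ⟨w, fun h => hne (by rw [h]; rfl), h2⟩)
  refine ⟨(LinearEquiv.ofInjectiveEndo A.toLinearMap hinj).toContinuousLinearEquiv, ?_⟩
  have hA' : ((LinearEquiv.ofInjectiveEndo A.toLinearMap hinj).toContinuousLinearEquiv :
      Coord n m →L[ℝ] Coord n m) = A := ContinuousLinearMap.ext fun v => rfl
  rw [hA']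
  exact h

/-- The inverse function theorem, in a form shared by the Legendre transformation and the evolution
operator; O allows the source to be shrunk, in the latter case into the coordinate image of W. -/
theorem exists_openPartialHomeomorph_legendreCoord (hL : ContMDiff (𝓡 (n + m)) 𝓘(ℝ, ℝ) ∞ L)
    (hz : z ∈ c.chartDom Y) (hdet : (c.FL L Y z).det ≠ 0) {O : Set (Coord n m)} (hO : IsOpen O)
    (hzO : z ∈ O) :
    ∃ Φ : OpenPartialHomeomorph (Coord n m) (Coord n m), z ∈ Φ.source ∧ Φ.source ⊆ O ∧
      Φ.source ⊆ c.chartDom Y ∧ (∀ w, Φ w = c.legendreCoord L Y w) ∧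
      ContDiffOn ℝ ∞ Φ.symm Φ.target := by
  obtain ⟨e, he⟩ := hasFDerivAt_legendreCoord_equiv hL hz hdet
  have hc := (contDiffOn_legendreCoord (c := c) (Y := Y) hL).contDiffAt
    ((c.isOpen_chartDom Y).mem_nhds hz)
  -- Restricting to the open set where 𝔽L is regular makes the derivative invertible at every point
  -- of the source, so the inverse is smooth on the whole target and not only at the image of z.
  have hD : IsOpen (c.chartDom Y ∩ (fun z => (c.FL L Y z).det) ⁻¹' {0}ᶜ) :=
    (continuousOn_det_FL hL).isOpen_inter_preimage (c.isOpen_chartDom Y) isOpen_compl_singleton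
  let Φ := (hc.toOpenPartialHomeomorph _ he (by simp)).restrOpen _ (hD.inter hO)
  have hs : Φ.source ⊆ (c.chartDom Y ∩ (fun z => (c.FL L Y z).det) ⁻¹' {0}ᶜ) ∩ O := by
    rw [OpenPartialHomeomorph.restrOpen_source]; exact Set.inter_subset_right
  refine ⟨Φ, ?_, fun w hw => (hs hw).2, fun w hw => (hs hw).1.1, fun w => rfl, ?_⟩
  · rw [OpenPartialHomeomorph.restrOpen_source]
    exact ⟨hc.mem_toOpenPartialHomeomorph_source he (by simp), ⟨hz, hdet⟩, hzO⟩
  · intro w hw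
    have hw' := hs (Φ.map_target hw)
    obtain ⟨e', he'⟩ := hasFDerivAt_legendreCoord_equiv hL hw'.1.1 hw'.1.2
    exact (Φ.contDiffAt_symm hw he' ((contDiffOn_legendreCoord hL).contDiffAt
      ((c.isOpen_chartDom Y).mem_nhds hw'.1.1))).contDiffWithinAt

/-- The tangent map of f applied to the smooth section z ↦ (z, V z). It serves for the frame ∂/∂u
and for the right-invariant fields. -/
theorem contMDiffOn_mderiv_apply {f : Coord n m → G} {V : Coord n m → Coord n m}
    {s : Set (Coord n m)} (hs : IsOpen s) (hf : ContMDiffOn 𝓘(ℝ, Coord n m) (𝓡 (n + m)) ∞ f s)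
    (hV : ContDiffOn ℝ ∞ V s) :
    ContMDiffOn 𝓘(ℝ, Coord n m) (𝓡 (n + m)).tangent ∞
      (fun z => (⟨f z, mderiv 𝓘(ℝ, Coord n m) (𝓡 (n + m)) f z (V z)⟩ :
        TangentBundle (𝓡 (n + m)) G)) s := by
  have h1 := hf.contMDiffOn_tangentMapWithin (m := ∞) (by simp) hs.uniqueMDiffOn
  have h2 : ContMDiffOn 𝓘(ℝ, Coord n m) 𝓘(ℝ, Coord n m).tangent ∞
      (fun z => (⟨z, V z⟩ : TangentBundle 𝓘(ℝ, Coord n m) (Coord n m))) s :=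
    contMDiffOn_vectorSpace_iff_contDiffOn.2 hV
  refine (h1.comp h2 fun z hz => hz).congr fun z hz => ?_
  simp only [Function.comp_apply, tangentMapWithin, mfderivWithin_of_isOpen hs hz]
  rfl

theorem fiberVec_eq {y : M} (hy : y ∈ c.baseDom) (ξ : Fin m → ℝ) :
    c.fiberVec y ξ =
      mderiv 𝓘(ℝ, Coord n m) (𝓡 (n + m)) c.coord.symm (c.baseCoord y, 0) (0, ξ) := by
  have hmk : MDifferentiableAt 𝓘(ℝ, Fin m → ℝ) 𝓘(ℝ, Coord n m)
      (fun ξ : Fin m → ℝ => (c.baseCoord y, ξ)) 0 :=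
    mdifferentiableAt_iff_differentiableAt.2 (by fun_prop)
  have h4 := mderiv_apply_mderiv (γ := fun ξ : Fin m → ℝ => (c.baseCoord y, ξ)) (y := 0) rfl
    (c.mdifferentiableAt_symm (c.mk_zero_mem_target hy)) hmk ξ
  rw [mderiv_eq_fderiv, (hasFDerivAt_prodMk_right _ _).fderiv] at h4
  exact h4.symm

open Classical in
/-- The frame `∂/∂u^γ` of `AG`. -/
noncomputable def frameVec (c : 𝒢.AdaptedCoordinates x₀) (γ : Fin m) (y : M) : 𝒢.algFiber y :=
  if hy : y ∈ c.baseDom then fiberEquiv hy (Pi.single γ 1) else 0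

theorem frameVec_of_mem (γ : Fin m) {y : M} (hy : y ∈ c.baseDom) :
    c.frameVec γ y = fiberEquiv hy (Pi.single γ 1) := dif_pos hy

theorem contMDiffOn_frameVec (γ : Fin m) :
    ContMDiffOn (𝓡 n) (𝓡 (n + m)).tangent ∞ (𝒢.sectionMap (c.frameVec γ)) c.baseDom := by
  have h1 := contMDiffOn_mderiv_apply c.coord.open_target c.contMDiffOn_coord_symm
    (contDiffOn_const (c := ((0, Pi.single γ 1) : Coord n m)))
  have h2 : ContMDiffOn (𝓡 n) 𝓘(ℝ, Coord n m) ∞ (fun y => (c.baseCoord y, (0 : Fin m → ℝ)))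
      c.baseDom :=
    (contDiff_prodMk_left (0 : Fin m → ℝ)).contMDiff.comp_contMDiffOn
      (c.contMDiffOn_baseCoord.mono fun y hy => c.mem_baseCoord_source hy)
  refine (h1.comp h2 fun y hy => c.mk_zero_mem_target hy).congr fun y hy => ?_
  have key : ∀ g, c.coord.symm (c.baseCoord y, 0) = g →
      ∀ u : EuclideanSpace ℝ (Fin (n + m)), (⟨g, u⟩ : TangentBundle (𝓡 (n + m)) G) =
        ⟨c.coord.symm (c.baseCoord y, 0), u⟩ := by
    rintro _ rfl u; rfl
  refine Eq.trans ?_ (key _ (c.symm_mk_zero hy) _)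
  rw [sectionMap, frameVec_of_mem γ hy]
  exact congrArg (fun u : EuclideanSpace ℝ (Fin (n + m)) =>
    (⟨𝒢.unit y, u⟩ : TangentBundle (𝓡 (n + m)) G)) (fiberVec_eq hy _)

/-- The local frame of `AG` given by adapted coordinates. -/
noncomputable def frame (c : 𝒢.AdaptedCoordinates x₀) : 𝒢.LocalFrame where
  base := c.baseDom
  isOpen_base := c.isOpen_baseDom
  e := c.frameVec
  contMDiffOn := contMDiffOn_frameVec
  linearIndependent y hy := by
    have h := (((Pi.basisFun ℝ (Fin m)).map (fiberEquiv hy))).linearIndependent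
    convert h using 2 with γ
    simp [frameVec_of_mem γ hy]
  span_eq_top y hy := by
    have h := (((Pi.basisFun ℝ (Fin m)).map (fiberEquiv hy))).span_eq
    convert h using 3 with γ
    funext γ
    simp [frameVec_of_mem γ hy]

theorem legendreMinus_frame (hL : ContMDiff (𝓡 (n + m)) 𝓘(ℝ, ℝ) ∞ L) (hz : z ∈ c.chartDom Y) :
    c.frame.dualTriv (𝒢.legendreMinus L (c.transChart Y z)) =
      (c.baseCoord.symm z.1, (c.legendreCoord L Y z).2) := by
  have hyD := src_transChart_mem hz
  refine Prod.ext ?_ ?_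
  · change 𝒢.src (c.transChart Y z) = c.baseCoord.symm z.1
    rw [← baseCoord_src_transChart hz, c.baseCoord.left_inv (c.mem_baseCoord_source hyD)]
  · funext γ
    refine (legendreMinus_transChart hL hz _).trans ?_
    change -fderiv ℝ (c.lagr L Y) z (c.curveDeriv z (c.fiberCoord (𝒢.src (c.transChart Y z))
      (c.frameVec γ (𝒢.src (c.transChart Y z))).1)) = _
    rw [frameVec_of_mem γ hyD]
    exact congrArg (fun ξ => -fderiv ℝ (c.lagr L Y) z (c.curveDeriv z ξ))
      (fiberCoord_fiberVec hyD _)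

/-- In the frame ∂/∂u the Legendre transformation is `legendreCoord` read through `transChart` on G
and the base chart on M; e is this composite of partial homeomorphisms. -/
theorem isLocalDiffeoToDualAt (hL : ContMDiff (𝓡 (n + m)) 𝓘(ℝ, ℝ) ∞ L) (hz : z ∈ c.chartDom Y)
    (hdet : (c.FL L Y z).det ≠ 0) :
    𝒢.IsLocalDiffeoToDualAt (𝒢.legendreMinus L) (c.transChart Y z) := by
  obtain ⟨Φ, hzΦ, -, hΦs, hΦ, hΦc⟩ := exists_openPartialHomeomorph_legendreCoord hL hz hdet
    isOpen_univ (Set.mem_univ z)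
  refine ⟨c.frame, src_transChart_mem hz, ?_⟩
  have hbs : ∀ w ∈ c.chartDom Y, w.1 ∈ c.baseCoord.target := by
    intro w hw
    rw [← baseCoord_src_transChart hw]
    exact c.baseCoord.map_source (c.mem_baseCoord_source (src_transChart_mem hw))
  -- Since Φ preserves x, its values have first component in the range of the base chart, so
  -- composing with that chart does not shrink the source.
  have hΦ1 : ∀ w, (Φ w).1 = w.1 := fun w => by rw [hΦ]; rfl
  let e := ((c.transChart Y).symm.trans Φ).trans
    (c.baseCoord.symm.prod (OpenPartialHomeomorph.refl (Fin m → ℝ)))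
  have hes : ∀ k, k ∈ e.source ↔ k ∈ (c.transChart Y).target ∧
      (c.transChart Y).symm k ∈ Φ.source := by
    intro k
    simp only [e, OpenPartialHomeomorph.trans_source, OpenPartialHomeomorph.symm_source,
      Set.mem_inter_iff, Set.mem_preimage, OpenPartialHomeomorph.prod_source,
      OpenPartialHomeomorph.refl_source, Set.mem_prod, Set.mem_univ, and_true,
      OpenPartialHomeomorph.coe_trans, Function.comp_apply, hΦ1]
    exact ⟨fun h => h.1, fun h => ⟨h, hbs _ (hΦs h.2)⟩⟩
  have het : ∀ p, p ∈ e.target ↔ p.1 ∈ c.baseCoord.source ∧ (c.baseCoord p.1, p.2) ∈ Φ.target := by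
    intro p
    simp only [e, OpenPartialHomeomorph.trans_target, OpenPartialHomeomorph.symm_target,
      Set.mem_inter_iff, Set.mem_preimage, OpenPartialHomeomorph.prod_target,
      OpenPartialHomeomorph.refl_target, Set.mem_prod, Set.mem_univ, and_true]
    exact ⟨fun h => ⟨h.1, h.2.1⟩, fun h => ⟨h.1, h.2, hΦs (Φ.map_target h.2)⟩⟩
  let P : PartialDiffeomorph (𝓡 (n + m)) ((𝓡 n).prod 𝓘(ℝ, Fin m → ℝ)) G (M × (Fin m → ℝ)) ∞ :=
    { toPartialEquiv := e.toPartialEquiv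
      open_source := e.open_source
      open_target := e.open_target
      contMDiffOn_toFun := by
        have h1 : ContMDiffOn (𝓡 (n + m)) 𝓘(ℝ, Coord n m) ∞ (fun k => Φ ((c.transChart Y).symm k))
            e.source := by
          have h : ContDiffOn ℝ ∞ Φ Φ.source :=
            ((contDiffOn_legendreCoord hL).mono hΦs).congr fun w _ => hΦ w
          exact h.contMDiffOn.comp ((c.contMDiffOn_transChart_symm Y).mono
            fun k hk => ((hes k).1 hk).1) fun k hk => ((hes k).1 hk).2
        have h2 := contDiff_fst.contMDiff.comp_contMDiffOn h1
        have h3 := contDiff_snd.contMDiff.comp_contMDiffOn h1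
        refine (c.contMDiffOn_baseCoord_symm.comp h2 fun k hk => ?_).prodMk h3
        change (Φ ((c.transChart Y).symm k)).1 ∈ c.baseCoord.target
        rw [hΦ1]
        exact hbs _ (hΦs ((hes k).1 hk).2)
      contMDiffOn_invFun := by
        have h1 : ContMDiffOn ((𝓡 n).prod 𝓘(ℝ, Fin m → ℝ)) 𝓘(ℝ, Coord n m) ∞
            (fun p : M × (Fin m → ℝ) => (c.baseCoord p.1, p.2)) e.target :=
          (c.contMDiffOn_baseCoord.comp contMDiffOn_fst
            fun p hp => ((het p).1 hp).1).prodMk_space contMDiffOn_snd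
        have h2 := hΦc.contMDiffOn.comp h1 fun p hp => ((het p).1 hp).2
        exact (c.contMDiffOn_transChart Y).comp h2
          fun p hp => hΦs (Φ.map_target ((het p).1 hp).2) }
  refine ⟨P, ?_, ?_⟩
  · refine (hes _).2 ⟨(c.transChart Y).map_source hz, ?_⟩
    rw [(c.transChart Y).left_inv hz]
    exact hzΦ
  · intro k hk
    obtain ⟨h1, h2⟩ := (hes k).1 hk
    have h3 := legendreMinus_frame hL (hΦs h2)
    rw [(c.transChart Y).right_inv h1] at h3
    refine h3.trans ?_
    change _ = (c.baseCoord.symm (Φ ((c.transChart Y).symm k)).1, (Φ ((c.transChart Y).symm k)).2)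
    rw [hΦ]
    rfl

theorem mderiv_transChart_symm (hz : z ∈ c.chartDom Y) (w : Coord n m) :
    mderiv (𝓡 (n + m)) 𝓘(ℝ, Coord n m) (c.transChart Y).symm (c.transChart Y z)
      (c.transDeriv Y z w) = w := by
  have hs : MDifferentiableAt (𝓡 (n + m)) 𝓘(ℝ, Coord n m) (c.transChart Y).symm
      (c.transChart Y z) :=
    ((c.contMDiffOn_transChart_symm Y).contMDiffAt ((c.transChart Y).open_target.mem_nhds
      ((c.transChart Y).map_source hz))).mdifferentiableAt (by simp)
  rw [mderiv_comp_transDeriv hz hs]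
  have e : (fun z => (c.transChart Y).symm (c.transChart Y z)) =ᶠ[𝓝 z] id := by
    filter_upwards [(c.isOpen_chartDom Y).mem_nhds hz] with z hz
      using (c.transChart Y).left_inv hz
  rw [e.fderiv_eq, fderiv_id]
  rfl

theorem transDeriv_mderiv_transChart_symm (hz : z ∈ c.chartDom Y)
    (v : EuclideanSpace ℝ (Fin (n + m))) :
    c.transDeriv Y z (mderiv (𝓡 (n + m)) 𝓘(ℝ, Coord n m) (c.transChart Y).symm
      (c.transChart Y z) v) = v := by
  have ht := (c.transChart Y).open_target.mem_nhds ((c.transChart Y).map_source hz)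
  have hs : MDifferentiableAt (𝓡 (n + m)) 𝓘(ℝ, Coord n m) (c.transChart Y).symm
      (c.transChart Y z) :=
    ((c.contMDiffOn_transChart_symm Y).contMDiffAt ht).mdifferentiableAt (by simp)
  rw [transDeriv, mderiv_apply_mderiv ((c.transChart Y).left_inv hz)
    (mdifferentiableAt_transChart hz) hs]
  have e : c.transChart Y ∘ (c.transChart Y).symm =ᶠ[𝓝 (c.transChart Y z)] id := by
    filter_upwards [ht] with k hk using (c.transChart Y).right_inv hk
  rw [e.mderiv_eq, mderiv_id]
  rfl

theorem mderiv_transChart_snd (hz : z ∈ c.chartDom Y) (w : Fin m → ℝ) :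
    mderiv 𝓘(ℝ, Fin m → ℝ) (𝓡 (n + m)) (fun t => c.transChart Y (z.1, t)) z.2 w =
      c.transDeriv Y z (0, w) := by
  have hmk : MDifferentiableAt 𝓘(ℝ, Fin m → ℝ) 𝓘(ℝ, Coord n m)
      (fun ξ : Fin m → ℝ => (z.1, ξ)) z.2 :=
    mdifferentiableAt_iff_differentiableAt.2 (by fun_prop)
  have h4 := mderiv_apply_mderiv (γ := fun ξ : Fin m → ℝ => (z.1, ξ)) (y := z.2) rfl
    (mdifferentiableAt_transChart hz) hmk w
  rw [mderiv_eq_fderiv, (hasFDerivAt_prodMk_right _ _).fderiv] at h4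
  exact h4.symm

theorem eventually_snd_mem_chartDom (hz : z ∈ c.chartDom Y) :
    ∀ᶠ t in 𝓝 z.2, (z.1, t) ∈ c.chartDom Y :=
  (show Continuous fun t : Fin m → ℝ => (z.1, t) by fun_prop).continuousAt.preimage_mem_nhds
    ((c.isOpen_chartDom Y).mem_nhds hz)

theorem mdifferentiableAt_transChart_snd (hz : z ∈ c.chartDom Y) :
    MDifferentiableAt 𝓘(ℝ, Fin m → ℝ) (𝓡 (n + m)) (fun t => c.transChart Y (z.1, t)) z.2 :=
  MDifferentiableAt.comp z.2 (mdifferentiableAt_transChart hz)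
    (mdifferentiableAt_iff_differentiableAt.2 (by fun_prop))

theorem src_transChart_snd (hz : z ∈ c.chartDom Y) {t : Fin m → ℝ}
    (ht : (z.1, t) ∈ c.chartDom Y) :
    𝒢.src (c.transChart Y (z.1, t)) = 𝒢.src (c.transChart Y z) := by
  rw [src_transChart hz, src_transChart ht]
  exact src_symm_eq (mem_target_of_mem_chartDom hz) (mem_target_of_mem_chartDom ht)

/-- A left null vector w of 𝔽L gives the nonzero tangent vector with coordinates (0, w). Moving u in
this direction keeps the source fixed and, to first order, all momenta, so the derivative of the
trivialized Legendre transformation kills it. -/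
theorem det_FL_ne_zero_of_isLocalDiffeoToDualAt (hL : ContMDiff (𝓡 (n + m)) 𝓘(ℝ, ℝ) ∞ L)
    (hz : z ∈ c.chartDom Y)
    (h : 𝒢.IsLocalDiffeoToDualAt (𝒢.legendreMinus L) (c.transChart Y z)) :
    (c.FL L Y z).det ≠ 0 := by
  obtain ⟨F, -, hF⟩ := h
  intro hdet
  obtain ⟨w, hw0, hw⟩ := Matrix.exists_vecMul_eq_zero_iff.2 hdet
  set f : G → M × (Fin m → ℝ) := fun k => F.dualTriv (𝒢.legendreMinus L k) with hf
  have hinj : Function.Injective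
      (mderiv (𝓡 (n + m)) ((𝓡 n).prod 𝓘(ℝ, Fin m → ℝ)) f (c.transChart Y z)) :=
    (hF.mfderivToContinuousLinearEquiv (by simp)).injective
  have h1 := mderiv_apply_mderiv (f := f) (γ := fun t => c.transChart Y (z.1, t)) (y := z.2) rfl
    (hF.mdifferentiableAt (by simp)) (mdifferentiableAt_transChart_snd hz) w
  set y := 𝒢.src (c.transChart Y z)
  set g : (Fin m → ℝ) → (Fin m → ℝ) := fun t μ =>
    -c.rightMomentum L Y (z.1, t) (c.fiberCoord y (F.e μ y).1) with hg
  -- The source y is constant along the family, so the frame vectors of the arbitrary frame F are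
  -- evaluated at one fixed point and need no differentiation.
  have e : (f ∘ fun t => c.transChart Y (z.1, t)) =ᶠ[𝓝 z.2] (fun t => (y, t)) ∘ g := by
    filter_upwards [eventually_snd_mem_chartDom hz] with t ht
    refine Prod.ext (src_transChart_snd hz ht) ?_
    funext μ
    refine (legendreMinus_transChart hL ht _).trans ?_
    exact congrArg (fun y => -fderiv ℝ (c.lagr L Y) (z.1, t) (c.curveDeriv (z.1, t)
      (c.fiberCoord y (F.e μ y).1))) (src_transChart_snd hz ht)
  have hgd : HasFDerivAt g (ContinuousLinearMap.pi fun μ =>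
      -(fderiv ℝ (fun z => c.rightMomentum L Y z (c.fiberCoord y (F.e μ y).1)) z).comp
        (ContinuousLinearMap.inr ℝ _ _)) z.2 := by
    refine hasFDerivAt_pi.2 fun μ => HasFDerivAt.neg ?_
    have hd : DifferentiableAt ℝ
        (fun z => c.rightMomentum L Y z (c.fiberCoord y (F.e μ y).1)) z :=
      (((contDiffOn_rightMomentum hL).contDiffAt
        ((c.isOpen_chartDom Y).mem_nhds hz)).differentiableAt (by simp)).clm_apply
        (differentiableAt_const _)
    exact HasFDerivAt.comp z.2 (f := fun t : Fin m → ℝ => (z.1, t)) hd.hasFDerivAt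
      (hasFDerivAt_prodMk_right _ _)
  have hgw : fderiv ℝ g z.2 w = 0 := by
    rw [hgd.fderiv]
    funext μ
    change -fderiv ℝ (fun z => c.rightMomentum L Y z (c.fiberCoord y (F.e μ y).1)) z (0, w) = 0
    rw [fderiv_rightMomentum hL hz, hw, zero_dotProduct, neg_zero]
  have hι : MDifferentiableAt 𝓘(ℝ, Fin m → ℝ) ((𝓡 n).prod 𝓘(ℝ, Fin m → ℝ))
      (fun t : Fin m → ℝ => (y, t)) (g z.2) :=
    mdifferentiableAt_const.prodMk mdifferentiableAt_id
  have h2 := mderiv_apply_mderiv (γ := g) (y := z.2) rfl hι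
    (mdifferentiableAt_iff_differentiableAt.2 hgd.differentiableAt) w
  rw [mderiv_eq_fderiv, hgw, map_zero] at h2
  rw [e.mderiv_eq, ← h2, mderiv_transChart_snd hz] at h1
  have h3 : c.transDeriv Y z (0, w) = 0 := hinj (h1.trans (map_zero _).symm)
  have h4 := mderiv_transChart_symm hz (0, w)
  rw [h3, map_zero] at h4
  exact hw0 (congrArg Prod.snd h4).symm

end AdaptedCoordinates

end LieGroupoid

/-! ### Construction of the local evolution operator -/

namespace LieGroupoid

variable {n m : ℕ} {G M : Type*}
  [TopologicalSpace G] [ChartedSpace (EuclideanSpace ℝ (Fin (n + m))) G]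
  [IsManifold (𝓡 (n + m)) ∞ G]
  [TopologicalSpace M] [ChartedSpace (EuclideanSpace ℝ (Fin n)) M]
  [IsManifold (𝓡 n) ∞ M]
  {𝒢 : LieGroupoid n m G M}

namespace LocalBisection

/-- The inverse of the left translation by a bisection. -/
def leftTransInv (S : 𝒢.LocalBisection) (g : G) : G :=
  𝒢.mul (𝒢.inv (S.secSrc (𝒢.src g))) g

theorem leftTrans_leftTransInv (S : 𝒢.LocalBisection) {g : G} (hg : 𝒢.src g ∈ S.dom) :
    S.leftTrans (S.leftTransInv g) = g := by
  have h : 𝒢.tgt (𝒢.inv (S.secSrc (𝒢.src g))) = 𝒢.src g := by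
    rw [𝒢.tgt_inv, S.src_secSrc _ hg]
  rw [leftTrans, leftTransInv, 𝒢.src_mul _ _ h, 𝒢.src_inv, S.secTgt_tgt_secSrc hg]
  exact 𝒢.mul_inv_cancel_left (S.src_secSrc _ hg)

theorem contMDiffOn_leftTransInv (S : 𝒢.LocalBisection) :
    ContMDiffOn (𝓡 (n + m)) (𝓡 (n + m)) ∞ S.leftTransInv (𝒢.src ⁻¹' S.dom) :=
  𝒢.contMDiffOn_mul_of_composable (𝒢.contMDiff_inv.comp_contMDiffOn
      (S.contMDiffOn_secSrc.comp 𝒢.contMDiff_src.contMDiffOn fun _ h => h)) contMDiffOn_id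
    fun _ h => (𝒢.tgt_inv _).trans (S.src_secSrc _ h)

end LocalBisection

namespace AdaptedCoordinates

variable {x₀ : M} {c : 𝒢.AdaptedCoordinates x₀} {Y : 𝒢.LocalBisection} {z : Coord n m} {L : G → ℝ}

/-- The function (g, ξ) ↦ L(g · (β(g), ξ)) is jointly smooth near (g, 0), hence so is its partial
derivative in ξ as a function of g. -/
theorem contMDiffAt_leftMomentum (hL : ContMDiff (𝓡 (n + m)) 𝓘(ℝ, ℝ) ∞ L) {g : G}
    (hg : 𝒢.tgt g ∈ c.baseDom) :
    ContMDiffAt (𝓡 (n + m)) 𝓘(ℝ, (Fin m → ℝ) →L[ℝ] ℝ) ∞ (c.leftMomentum L) g := by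
  have hpair : ContMDiffAt ((𝓡 (n + m)).prod 𝓘(ℝ, Fin m → ℝ)) 𝓘(ℝ, Coord n m) ∞
      (fun q : G × (Fin m → ℝ) => (c.baseCoord (𝒢.tgt q.1), q.2)) (g, 0) := by
    have h1 : ContMDiffAt (𝓡 n) 𝓘(ℝ, Fin n → ℝ) ∞ c.baseCoord (𝒢.tgt g) :=
      c.contMDiffOn_baseCoord.contMDiffAt
        (c.baseCoord.open_source.mem_nhds (c.mem_baseCoord_source hg))
    exact (ContMDiffAt.comp (g := c.baseCoord) (f := fun q : G × (Fin m → ℝ) => 𝒢.tgt q.1) (g, 0) h1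
      (𝒢.contMDiff_tgt.comp contMDiff_fst).contMDiffAt).prodMk_space contMDiffAt_snd
  have ht : c.coord.target ∈ 𝓝 (c.baseCoord (𝒢.tgt g), (0 : Fin m → ℝ)) :=
    c.coord.open_target.mem_nhds (c.mk_zero_mem_target hg)
  have hcurve : ContMDiffAt ((𝓡 (n + m)).prod 𝓘(ℝ, Fin m → ℝ)) (𝓡 (n + m)) ∞
      (fun q : G × (Fin m → ℝ) => c.fiberCurve (𝒢.tgt q.1) q.2) (g, 0) :=
    ContMDiffAt.comp (g := c.coord.symm)
      (f := fun q : G × (Fin m → ℝ) => (c.baseCoord (𝒢.tgt q.1), q.2)) (g, 0)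
      (c.contMDiffOn_coord_symm.contMDiffAt ht) hpair
  have hev : ∀ᶠ q : G × (Fin m → ℝ) in 𝓝 (g, 0),
      𝒢.tgt q.1 = 𝒢.src (c.fiberCurve (𝒢.tgt q.1) q.2) := by
    have hopen : IsOpen {q : G × (Fin m → ℝ) | 𝒢.tgt q.1 ∈ c.baseDom} :=
      c.isOpen_baseDom.preimage (𝒢.contMDiff_tgt.continuous.comp continuous_fst)
    filter_upwards [hopen.mem_nhds hg, hpair.continuousAt.preimage_mem_nhds ht] with q h1 h2
    exact (src_fiberCurve h1 h2).symm
  have hF : ContMDiffAt ((𝓡 (n + m)).prod 𝓘(ℝ, Fin m → ℝ)) 𝓘(ℝ, ℝ) ∞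
      (Function.uncurry fun (g : G) (ξ : Fin m → ℝ) => L (𝒢.mul g (c.fiberCurve (𝒢.tgt g) ξ)))
      (g, 0) :=
    hL.contMDiffAt.comp (g, (0 : Fin m → ℝ)) (𝒢.contMDiffAt_mul contMDiffAt_fst hcurve hev)
  have h := ContMDiffAt.mfderiv (fun (g : G) (ξ : Fin m → ℝ) =>
    L (𝒢.mul g (c.fiberCurve (𝒢.tgt g) ξ))) (fun _ => 0) hF contMDiffAt_const (m := ∞) (by simp)
  -- Smooth dependence of derivatives is expressed in tangent coordinates; over the vector spaces
  -- ℝ^m and ℝ these change nothing.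
  have e : inTangentCoordinates 𝓘(ℝ, Fin m → ℝ) 𝓘(ℝ, ℝ) (fun _ : G => (0 : Fin m → ℝ))
      (fun g => L (𝒢.mul g (c.fiberCurve (𝒢.tgt g) 0)))
      (fun g => c.leftMomentum L g) g = c.leftMomentum L :=
    inTangentCoordinates_model_space (I := 𝓘(ℝ, Fin m → ℝ)) (I' := 𝓘(ℝ, ℝ))
      (fun _ : G => (0 : Fin m → ℝ)) (fun g => L (𝒢.mul g (c.fiberCurve (𝒢.tgt g) 0)))
      (fun g => c.leftMomentum L g) g
  refine h.congr_of_eventuallyEq (.of_forall fun g' => ?_)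
  refine (congrFun e g').symm.trans ?_
  exact congrArg (fun T : G → (Fin m → ℝ) →L[ℝ] ℝ => inTangentCoordinates 𝓘(ℝ, Fin m → ℝ) 𝓘(ℝ, ℝ)
    (fun _ : G => (0 : Fin m → ℝ)) (fun g => L (𝒢.mul g (c.fiberCurve (𝒢.tgt g) 0))) T g g')
    (funext fun g' => (mderiv_eq_fderiv
      (f := fun ξ => L (𝒢.mul g' (c.fiberCurve (𝒢.tgt g') ξ)))).symm)

/-- The coordinates of the derivative of `L` at `g` along the left-invariant vector fields. -/
noncomputable def leftCoord (c : 𝒢.AdaptedCoordinates x₀) (L : G → ℝ) (g : G) : Coord n m :=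
  (c.baseCoord (𝒢.tgt g), fun μ => c.leftMomentum L g (Pi.single μ 1))

theorem contMDiffOn_leftCoord (hL : ContMDiff (𝓡 (n + m)) 𝓘(ℝ, ℝ) ∞ L) :
    ContMDiffOn (𝓡 (n + m)) 𝓘(ℝ, Coord n m) ∞ (c.leftCoord L) (𝒢.tgt ⁻¹' c.baseDom) := by
  refine (c.contMDiffOn_baseCoord.comp 𝒢.contMDiff_tgt.contMDiffOn
    fun g hg => c.mem_baseCoord_source hg).prodMk_space (contMDiffOn_pi_space.2 fun μ => ?_)
  intro g hg
  exact ((contMDiffAt_leftMomentum hL hg).clm_apply contMDiffAt_const).contMDiffWithinAt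

/-- This separates the variables: one side depends on g only, the other on z only, and the latter
side is invertible when 𝔽L is regular. -/
theorem isDELSolution_iff_leftCoord_eq [T2Space M] (hL : ContMDiff (𝓡 (n + m)) 𝓘(ℝ, ℝ) ∞ L)
    (hz : z ∈ c.chartDom Y) {g : G} (hg : 𝒢.tgt g ∈ c.baseDom) :
    𝒢.IsDELSolution L g (c.transChart Y z) ↔ c.leftCoord L g = c.legendreCoord L Y z := by
  rw [isDELSolution_iff hL hz hg, Prod.ext_iff]
  refine and_congr_right fun _ => ?_
  rw [funext_iff]
  refine ⟨fun h μ => h (Pi.single μ 1), fun h ξ => ?_⟩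
  have e : (c.leftMomentum L g).toLinearMap = (-c.rightMomentum L Y z).toLinearMap :=
    (Pi.basisFun ℝ (Fin m)).ext fun μ => by
      rw [Pi.basisFun_apply]
      exact h μ
  exact LinearMap.congr_fun e ξ

theorem base_mem_chartDom (hY : c.baseCoord.source ⊆ Y.dom) :
    (c.baseCoord x₀, (0 : Fin m → ℝ)) ∈ c.chartDom Y := by
  have h1 := c.mk_zero_mem_target c.unit_mem
  refine ⟨⟨h1, ?_⟩, ⟨h1, ?_⟩⟩
  · change 𝒢.unit (𝒢.src (c.coord.symm (c.baseCoord x₀, 0))) ∈ c.coord.source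
    rw [c.symm_mk_zero c.unit_mem, 𝒢.src_unit]
    exact c.unit_mem
  · change 𝒢.tgt (c.coord.symm (c.baseCoord x₀, 0)) ∈ Y.dom
    rw [c.symm_mk_zero c.unit_mem, 𝒢.tgt_unit]
    exact hY (c.mem_baseCoord_source c.unit_mem)

theorem transChart_base (hY : c.baseCoord.source ⊆ Y.dom) {h : G} (hh : 𝒢.src h = x₀)
    (hhY : h ∈ Y.carrier) : c.transChart Y (c.baseCoord x₀, 0) = h := by
  rw [← Y.image_secSrc] at hhY
  obtain ⟨x, hx, rfl⟩ := hhY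
  rw [Y.src_secSrc x hx] at hh
  subst hh
  change Y.rightTrans (c.coord.symm (c.baseCoord x, 0)) = _
  rw [c.symm_mk_zero c.unit_mem, LocalBisection.rightTrans, 𝒢.tgt_unit]
  have := 𝒢.unit_mul (Y.secSrc x)
  rwa [Y.src_secSrc x hx] at this

/-- With Φ a local inverse function for `legendreCoord`, the solution is z = Φ⁻¹(`leftCoord g`);
injectivity of Φ gives uniqueness and smoothness of Φ⁻¹ gives smoothness. The given solution (g₀,
h₀) ensures that `leftCoord g₀` lies in the range of Φ. -/
theorem exists_localEvolutionOperator [T2Space M] (hL : ContMDiff (𝓡 (n + m)) 𝓘(ℝ, ℝ) ∞ L)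
    {g₀ h₀ : G} (hsol : 𝒢.IsDELSolution L g₀ h₀) (hg₀ : 𝒢.tgt g₀ = x₀) (hh₀ : 𝒢.src h₀ = x₀)
    {W : Set G} (hW : 𝒢.IsSymmetricNhd c.coord.source x₀ W)
    {S : 𝒢.LocalBisection} (hgS : g₀ ∈ S.carrier)
    (hhY : h₀ ∈ Y.carrier) (hY : c.baseCoord.source ⊆ Y.dom)
    (hdet : (c.FL L Y (c.baseCoord x₀, 0)).det ≠ 0) :
    ∃ (A B : Set G) (Ψ : G → G),
      IsOpen A ∧ g₀ ∈ A ∧ A ⊆ S.leftTrans '' W ∧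
      IsOpen B ∧ h₀ ∈ B ∧ B ⊆ Y.rightTrans '' W ∧
      (∀ g ∈ A, ∀ h, h ∈ B ∧ 𝒢.IsDELSolution L g h ↔ h = Ψ g) ∧
      𝒢.IsLocalEvolutionOperator L A B Ψ := by
  have hz := base_mem_chartDom hY
  have hφ := transChart_base hY hh₀ hhY
  have hOW : IsOpen (c.coord.target ∩ c.coord.symm ⁻¹' W) :=
    c.coord.continuousOn_symm.isOpen_inter_preimage c.coord.open_target hW.isOpen
  obtain ⟨Φ, hzΦ, hΦW, hΦs, hΦ, hΦc⟩ := exists_openPartialHomeomorph_legendreCoord hL hz hdet hOW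
    ⟨mem_target_of_mem_chartDom hz, by
      change c.coord.symm (c.baseCoord x₀, 0) ∈ W
      rw [c.symm_mk_zero c.unit_mem]; exact hW.unit_mem⟩
  have hg₀D : 𝒢.tgt g₀ ∈ c.baseDom := by rw [hg₀]; exact c.unit_mem
  have hA1 : IsOpen ((𝒢.tgt ⁻¹' c.baseDom) ∩ c.leftCoord L ⁻¹' Φ.target) :=
    (contMDiffOn_leftCoord hL).continuousOn.isOpen_inter_preimage
      (c.isOpen_baseDom.preimage 𝒢.contMDiff_tgt.continuous) Φ.open_target
  have hA2 : IsOpen ((𝒢.src ⁻¹' S.dom) ∩ S.leftTransInv ⁻¹' W) :=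
    S.contMDiffOn_leftTransInv.continuousOn.isOpen_inter_preimage
      (S.isOpen_dom.preimage 𝒢.contMDiff_src.continuous) hW.isOpen
  have hsolIff : ∀ g, 𝒢.tgt g ∈ c.baseDom → ∀ z ∈ Φ.source,
      (𝒢.IsDELSolution L g (c.transChart Y z) ↔ c.leftCoord L g = Φ z) := fun g hg z hz => by
    rw [isDELSolution_iff_leftCoord_eq hL (hΦs hz) hg, hΦ]
  have hmem : ∀ g, c.leftCoord L g ∈ Φ.target →
      c.transChart Y (Φ.symm (c.leftCoord L g)) ∈ c.transChart Y '' Φ.source :=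
    fun g hg => ⟨_, Φ.map_target hg, rfl⟩
  have hΨ : ∀ g, 𝒢.tgt g ∈ c.baseDom → c.leftCoord L g ∈ Φ.target →
      𝒢.IsDELSolution L g (c.transChart Y (Φ.symm (c.leftCoord L g))) := fun g hg hg' => by
    rw [hsolIff g hg _ (Φ.map_target hg'), Φ.right_inv hg']
  -- The first factor of A makes the equation solvable; the second places g in L_Σ(W) by exhibiting
  -- its preimage under left translation. B is the image of the source of Φ, which was chosen inside
  -- the coordinates of W.
  refine ⟨((𝒢.tgt ⁻¹' c.baseDom) ∩ c.leftCoord L ⁻¹' Φ.target) ∩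
      ((𝒢.src ⁻¹' S.dom) ∩ S.leftTransInv ⁻¹' W), c.transChart Y '' Φ.source,
    fun g => c.transChart Y (Φ.symm (c.leftCoord L g)), hA1.inter hA2, ⟨⟨hg₀D, ?_⟩, ?_⟩, ?_, ?_, ?_,
    ?_, ?_, ?_, ?_, ?_⟩
  · rw [← hφ] at hsol
    change c.leftCoord L g₀ ∈ Φ.target
    rw [(hsolIff g₀ hg₀D _ hzΦ).1 hsol]
    exact Φ.map_source hzΦ
  · rw [← S.image_secSrc] at hgS
    obtain ⟨x, hx, rfl⟩ := hgS
    refine ⟨by rwa [Set.mem_preimage, S.src_secSrc x hx], ?_⟩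
    change 𝒢.mul (𝒢.inv (S.secSrc (𝒢.src (S.secSrc x)))) (S.secSrc x) ∈ W
    rw [S.src_secSrc x hx, 𝒢.inv_mul, hg₀]
    exact hW.unit_mem
  · exact fun g hg => ⟨_, hg.2.2, S.leftTrans_leftTransInv hg.2.1⟩
  · exact (c.transChart Y).isOpen_image_of_subset_source Φ.open_source hΦs
  · exact ⟨_, hzΦ, hφ⟩
  · rintro _ ⟨z, hz, rfl⟩
    exact ⟨c.coord.symm z, (hΦW hz).2, rfl⟩
  · rintro g ⟨⟨hg1, hg2⟩, -⟩ h
    constructor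
    · rintro ⟨⟨z, hz, rfl⟩, hs⟩
      change _ = c.transChart Y (Φ.symm (c.leftCoord L g))
      rw [(hsolIff g hg1 z hz).1 hs, Φ.left_inv hz]
    · rintro rfl
      exact ⟨hmem g hg2, hΨ g hg1 hg2⟩
  · have h1 := hΦc.contMDiffOn.comp ((contMDiffOn_leftCoord (c := c) hL).mono Set.inter_subset_left)
      (fun g (hg : g ∈ (𝒢.tgt ⁻¹' c.baseDom) ∩ c.leftCoord L ⁻¹' Φ.target) => hg.2)
    exact ((c.contMDiffOn_transChart Y).comp h1 fun g hg => hΦs (Φ.map_target hg.2)).mono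
      Set.inter_subset_left
  · exact fun g hg => hmem g hg.1.2
  · exact fun g hg => hΨ g hg.1.1 hg.1.2

end AdaptedCoordinates

end LieGroupoid

/-! ### The differential of Θ⁻ on invariant sections -/

namespace LieGroupoid

variable {n m : ℕ} {G M : Type*}
  [TopologicalSpace G] [ChartedSpace (EuclideanSpace ℝ (Fin (n + m))) G]
  [IsManifold (𝓡 (n + m)) ∞ G]
  [TopologicalSpace M] [ChartedSpace (EuclideanSpace ℝ (Fin n)) M]
  [IsManifold (𝓡 n) ∞ M]
  {𝒢 : LieGroupoid n m G M}

namespace AdaptedCoordinates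

variable {x₀ : M} {c : 𝒢.AdaptedCoordinates x₀} {Y : 𝒢.LocalBisection} {z : Coord n m} {L : G → ℝ}

/-- The coordinates of the value at `α(R_Y(z))` of a section of `AG`. -/
noncomputable def sectionCoord (c : 𝒢.AdaptedCoordinates x₀) (Y : 𝒢.LocalBisection)
    (X : 𝒢.AlgSection) (z : Coord n m) : Fin m → ℝ :=
  c.fiberCoord (𝒢.src (c.transChart Y z)) (X.toFun (𝒢.src (c.transChart Y z))).1

theorem contDiffOn_sectionCoord (X : 𝒢.AlgSection) :
    ContDiffOn ℝ ∞ (c.sectionCoord Y X) (c.chartDom Y) := by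
  have h1 := c.contMDiffOn_coord.contMDiffOn_tangentMapWithin (m := ∞) (by simp)
    c.coord.open_source.uniqueMDiffOn
  have h2 : ContMDiffOn (𝓡 n) 𝓘(ℝ, Coord n m).tangent ∞
      (fun y => tangentMapWithin (𝓡 (n + m)) 𝓘(ℝ, Coord n m) c.coord c.coord.source
        (𝒢.sectionMap X.toFun y)) c.baseDom :=
    h1.comp X.contMDiff.contMDiffOn fun y hy => hy
  have h3 : ContMDiffOn (𝓡 n) 𝓘(ℝ, Fin m → ℝ) ∞
      (fun y => c.fiberCoord y (X.toFun y).1) c.baseDom := by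
    refine (contDiff_snd.contMDiff.comp_contMDiffOn ((contMDiff_snd_tangentBundle_modelSpace
      (Coord n m) 𝓘(ℝ, Coord n m)).comp_contMDiffOn h2)).congr fun y hy => ?_
    exact congrArg (fun A : EuclideanSpace ℝ (Fin (n + m)) →L[ℝ] Coord n m => (A (X.toFun y).1).2)
      (mfderivWithin_of_isOpen c.coord.open_source hy).symm
  rw [← contMDiffOn_iff_contDiffOn]
  exact h3.comp (𝒢.contMDiff_src.comp_contMDiffOn (c.contMDiffOn_transChart Y))
    fun z hz => src_transChart_mem hz

/-- The vector field `X^→` in the coordinates given by `R_Y`. -/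
noncomputable def rightFieldCoord (c : 𝒢.AdaptedCoordinates x₀) (Y : 𝒢.LocalBisection)
    (X : 𝒢.AlgSection) (z : Coord n m) : Coord n m :=
  -c.curveDeriv z (c.sectionCoord Y X z)

theorem contDiffOn_rightFieldCoord (X : 𝒢.AlgSection) :
    ContDiffOn ℝ ∞ (c.rightFieldCoord Y X) (c.chartDom Y) :=
  ((c.contDiffOn_curveDeriv Y).clm_apply (contDiffOn_sectionCoord X)).neg

theorem rightField_transChart_eq (hz : z ∈ c.chartDom Y) (X : 𝒢.AlgSection) :
    𝒢.rightField X (c.transChart Y z) = c.transDeriv Y z (c.rightFieldCoord Y X z) :=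
  (rightField_transChart hz X).trans (map_neg (c.transDeriv Y z) _).symm

theorem isInvertible_transDeriv (hz : z ∈ c.chartDom Y) : (c.transDeriv Y z).IsInvertible :=
  .of_inverse (g := mderiv (𝓡 (n + m)) 𝓘(ℝ, Coord n m) (c.transChart Y).symm (c.transChart Y z))
    (ContinuousLinearMap.ext (transDeriv_mderiv_transChart_symm hz))
    (ContinuousLinearMap.ext (mderiv_transChart_symm hz))

theorem mdifferentiableAt_rightField (hz : z ∈ c.chartDom Y) (X : 𝒢.AlgSection) :
    MDifferentiableAt (𝓡 (n + m)) (𝓡 (n + m)).tangent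
      (fun g => (⟨g, 𝒢.rightField X g⟩ : TangentBundle (𝓡 (n + m)) G)) (c.transChart Y z) := by
  have ht := (c.transChart Y).open_target.mem_nhds ((c.transChart Y).map_source hz)
  have h1 := contMDiffOn_mderiv_apply (c.isOpen_chartDom Y) (c.contMDiffOn_transChart Y)
    (contDiffOn_rightFieldCoord (c := c) (Y := Y) X)
  have h2 := h1.comp (c.contMDiffOn_transChart_symm Y) fun g hg => (c.transChart Y).map_target hg
  refine ((h2.congr fun g hg => ?_).contMDiffAt ht).mdifferentiableAt (by simp)
  have key : ∀ g', c.transChart Y ((c.transChart Y).symm g) = g' →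
      (⟨g', 𝒢.rightField X g'⟩ : TangentBundle (𝓡 (n + m)) G) =
        ⟨c.transChart Y ((c.transChart Y).symm g),
          𝒢.rightField X (c.transChart Y ((c.transChart Y).symm g))⟩ := by
    rintro _ rfl; rfl
  refine (key g ((c.transChart Y).right_inv hg)).trans ?_
  exact congrArg (fun u : EuclideanSpace ℝ (Fin (n + m)) =>
    (⟨c.transChart Y ((c.transChart Y).symm g), u⟩ : TangentBundle (𝓡 (n + m)) G))
    (rightField_transChart_eq ((c.transChart Y).map_target hg) X)

/-- Brackets are natural under pullback by the local diffeomorphism R_Υ, and the pullback of a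
right-invariant field is `rightFieldCoord`; on a vector space the manifold bracket is the ordinary
one. -/
theorem mlieBracket_rightField (hz : z ∈ c.chartDom Y) (X X' : 𝒢.AlgSection) :
    VectorField.mlieBracket (𝓡 (n + m)) (𝒢.rightField X) (𝒢.rightField X') (c.transChart Y z) =
      c.transDeriv Y z (VectorField.lieBracket ℝ (c.rightFieldCoord Y X)
        (c.rightFieldCoord Y X') z) := by
  have h3 : minSmoothness ℝ 3 ≤ (∞ : WithTop ℕ∞) := by
    rw [minSmoothness_of_isRCLikeNormedField]; exact WithTop.coe_le_coe.2 (le_top (a := (3 : ℕ∞)))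
  have h2 : minSmoothness ℝ 2 ≤ (∞ : WithTop ℕ∞) := by
    rw [minSmoothness_of_isRCLikeNormedField]; exact WithTop.coe_le_coe.2 (le_top (a := (2 : ℕ∞)))
  have : IsManifold (𝓡 (n + m)) (minSmoothness ℝ 3) G := .of_le h3
  have h := VectorField.mpullback_mlieBracket (I := 𝓘(ℝ, Coord n m)) (f := c.transChart Y)
    (mdifferentiableAt_rightField hz X) (mdifferentiableAt_rightField hz X')
    ((c.contMDiffOn_transChart Y).contMDiffAt ((c.isOpen_chartDom Y).mem_nhds hz)) h2
  have hp : ∀ X : 𝒢.AlgSection, VectorField.mpullback 𝓘(ℝ, Coord n m) (𝓡 (n + m))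
      (c.transChart Y) (𝒢.rightField X) =ᶠ[𝓝 z] c.rightFieldCoord Y X := by
    intro X
    filter_upwards [(c.isOpen_chartDom Y).mem_nhds hz] with w hw
    exact (congrArg (c.transDeriv Y w).inverse (rightField_transChart_eq hw X)).trans
      ((isInvertible_transDeriv hw).inverse_apply_self _)
  have hE := congrFun (VectorField.mlieBracketWithin_eq_lieBracketWithin (𝕜 := ℝ)
    (V := c.rightFieldCoord Y X) (W := c.rightFieldCoord Y X') (s := Set.univ)) z
  rw [VectorField.lieBracketWithin_univ] at hE
  exact ((isInvertible_transDeriv hz).self_apply_inverse _).symm.trans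
    (congrArg (c.transDeriv Y z)
      ((h.trans ((hp X).mlieBracket_vectorField_eq (hp X'))).trans hE))

/-- Functions such as Θ⁻ of an invariant section are defined pointwise on G; differentiability there
is deduced from their smooth expression q in the chart. -/
theorem vecAct_transDeriv {f : G → ℝ} (hz : z ∈ c.chartDom Y) {q : Coord n m → ℝ}
    (hq : ContDiffOn ℝ ∞ q (c.chartDom Y)) (hf : ∀ w ∈ c.chartDom Y, f (c.transChart Y w) = q w)
    (v : Coord n m) : vecAct f (c.transChart Y z) (c.transDeriv Y z v) = fderiv ℝ q z v := by
  have ht := (c.transChart Y).open_target.mem_nhds ((c.transChart Y).map_source hz)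
  have h1 := hq.contMDiffOn.comp (c.contMDiffOn_transChart_symm Y)
    fun g hg => (c.transChart Y).map_target hg
  have h2 : MDifferentiableAt (𝓡 (n + m)) 𝓘(ℝ, ℝ) f (c.transChart Y z) := by
    refine ((h1.congr fun g hg => ?_).contMDiffAt ht).mdifferentiableAt (by simp)
    have h3 := hf _ ((c.transChart Y).map_target hg)
    rwa [(c.transChart Y).right_inv hg] at h3
  refine (mderiv_comp_transDeriv hz h2 v).trans ?_
  have e : (fun z => f (c.transChart Y z)) =ᶠ[𝓝 z] q := by
    filter_upwards [(c.isOpen_chartDom Y).mem_nhds hz] with w hw using hf w hw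
  rw [e.fderiv_eq]

/-- The fibre coordinates of X at α(R_Υ(x, u)) do not change with u, so they can be frozen before
differentiating and only 𝔽L appears. -/
theorem fderiv_rightMomentum_sectionCoord (hL : ContMDiff (𝓡 (n + m)) 𝓘(ℝ, ℝ) ∞ L)
    (hz : z ∈ c.chartDom Y) (X : 𝒢.AlgSection) (η : Fin m → ℝ) :
    fderiv ℝ (fun z => c.rightMomentum L Y z (c.sectionCoord Y X z)) z (0, η) =
      Matrix.vecMul η (c.FL L Y z) ⬝ᵥ c.sectionCoord Y X z := by
  have hn := (c.isOpen_chartDom Y).mem_nhds hz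
  have hm : DifferentiableAt ℝ (c.rightMomentum L Y) z :=
    ((contDiffOn_rightMomentum hL).contDiffAt hn).differentiableAt (by simp)
  have hs : DifferentiableAt ℝ (c.sectionCoord Y X) z :=
    ((contDiffOn_sectionCoord X).contDiffAt hn).differentiableAt (by simp)
  have hi := hasFDerivAt_prodMk_right (𝕜 := ℝ) z.1 z.2
  have h1 := HasFDerivAt.comp z.2 (f := fun t : Fin m → ℝ => (z.1, t))
    (hm.clm_apply hs).hasFDerivAt hi
  have h2 := HasFDerivAt.comp z.2 (f := fun t : Fin m → ℝ => (z.1, t))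
    (hm.clm_apply (differentiableAt_const (c.sectionCoord Y X z))).hasFDerivAt hi
  have e : ((fun z => c.rightMomentum L Y z (c.sectionCoord Y X z)) ∘ fun t => (z.1, t)) =ᶠ[𝓝 z.2]
      (fun w => c.rightMomentum L Y w (c.sectionCoord Y X z)) ∘ fun t => (z.1, t) := by
    filter_upwards [eventually_snd_mem_chartDom hz] with t ht
    exact congrArg (fun y => c.rightMomentum L Y (z.1, t) (c.fiberCoord y (X.toFun y).1))
      (src_transChart_snd hz ht)
  exact (DFunLike.congr_fun (h1.unique (h2.congr_of_eventuallyEq e)) η).trans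
    (fderiv_rightMomentum hL hz η _)

/-- On right-invariant directions the two anchor terms cancel with the bracket term, as in the
identity d(dL) = 0; the left-invariant directions (0, η) contribute u-derivatives of the momentum.
The bracket of the left-invariant fields is irrelevant, since Θ⁻ does not see its second argument.
-/
theorem dThetaMinus_transChart (hL : ContMDiff (𝓡 (n + m)) 𝓘(ℝ, ℝ) ∞ L) (hz : z ∈ c.chartDom Y)
    (X X₁ X' X₁' : 𝒢.AlgSection) {η η' : Fin m → ℝ}
    (h : 𝒢.leftField X₁ (c.transChart Y z) = c.transDeriv Y z (0, η))
    (h' : 𝒢.leftField X₁' (c.transChart Y z) = c.transDeriv Y z (0, η')) :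
    𝒢.dThetaMinus L X X₁ X' X₁' (c.transChart Y z) =
      Matrix.vecMul η (c.FL L Y z) ⬝ᵥ c.sectionCoord Y X' z -
        Matrix.vecMul η' (c.FL L Y z) ⬝ᵥ c.sectionCoord Y X z := by
  have hn := (c.isOpen_chartDom Y).mem_nhds hz
  have hq : ∀ X : 𝒢.AlgSection, ContDiffOn ℝ ∞
      (fun z => c.rightMomentum L Y z (c.sectionCoord Y X z)) (c.chartDom Y) := fun X =>
    (contDiffOn_rightMomentum hL).clm_apply (contDiffOn_sectionCoord X)
  have hθ : ∀ X X₁ : 𝒢.AlgSection, ∀ w ∈ c.chartDom Y,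
      thetaMinus L (c.transChart Y w) (𝒢.rightField X (c.transChart Y w))
        (𝒢.leftField X₁ (c.transChart Y w)) = c.rightMomentum L Y w (c.sectionCoord Y X w) :=
    fun X X₁ w hw => (congrArg Neg.neg (vecAct_rightField_transChart hL hw X)).trans (neg_neg _)
  have hV : ∀ X : 𝒢.AlgSection, DifferentiableAt ℝ (c.rightFieldCoord Y X) z := fun X =>
    ((contDiffOn_rightFieldCoord X).contDiffAt hn).differentiableAt (by simp)
  have hneg : ∀ X : 𝒢.AlgSection, fderiv ℝ (fun w => fderiv ℝ (c.lagr L Y) w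
      (c.rightFieldCoord Y X w)) z =
      -fderiv ℝ (fun z => c.rightMomentum L Y z (c.sectionCoord Y X z)) z := by
    intro X
    rw [← fderiv_fun_neg]
    congr 1
    funext w
    exact map_neg _ _
  -- Here -[V, V']ℓ = -V(V'ℓ) + V'(Vℓ) for the coordinate fields V, V', and Vℓ is minus the momentum
  -- paired with the section, so the two signs combine.
  have hbr : thetaMinus L (c.transChart Y z)
      (VectorField.mlieBracket (𝓡 (n + m)) (𝒢.rightField X) (𝒢.rightField X') (c.transChart Y z))
      (VectorField.mlieBracket (𝓡 (n + m)) (𝒢.leftField X₁) (𝒢.leftField X₁')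
        (c.transChart Y z)) =
      fderiv ℝ (fun z => c.rightMomentum L Y z (c.sectionCoord Y X' z)) z (c.rightFieldCoord Y X z)
      - fderiv ℝ (fun z => c.rightMomentum L Y z (c.sectionCoord Y X z)) z
        (c.rightFieldCoord Y X' z) := by
    refine (congrArg (fun v => -vecAct L (c.transChart Y z) v)
      (mlieBracket_rightField hz X X')).trans ?_
    rw [vecAct_transDeriv hz (contDiffOn_lagr hL) (fun _ _ => rfl), VectorField.fderiv_apply_lieBracket
      ((contDiffOn_lagr hL).contDiffAt hn) (by
        rw [minSmoothness_of_isRCLikeNormedField]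
        exact WithTop.coe_le_coe.2 (le_top (a := (2 : ℕ∞)))) (hV X') (hV X), hneg, hneg]
    simp only [neg_apply]
    ring
  have hterm : ∀ X X₁ X' X₁' : 𝒢.AlgSection, ∀ η : Fin m → ℝ,
      𝒢.leftField X₁ (c.transChart Y z) = c.transDeriv Y z (0, η) →
      vecAct (fun k => thetaMinus L k (𝒢.rightField X' k) (𝒢.leftField X₁' k)) (c.transChart Y z)
        (𝒢.rightField X (c.transChart Y z) + 𝒢.leftField X₁ (c.transChart Y z)) =
      fderiv ℝ (fun z => c.rightMomentum L Y z (c.sectionCoord Y X' z)) z (c.rightFieldCoord Y X z)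
        + Matrix.vecMul η (c.FL L Y z) ⬝ᵥ c.sectionCoord Y X' z := by
    intro X X₁ X' X₁' η h
    have e : 𝒢.rightField X (c.transChart Y z) + 𝒢.leftField X₁ (c.transChart Y z) =
        c.transDeriv Y z (c.rightFieldCoord Y X z + (0, η)) := by
      refine Eq.trans ?_ (map_add (c.transDeriv Y z) _ _).symm
      exact congrArg₂ (fun a b : EuclideanSpace ℝ (Fin (n + m)) => a + b)
        (rightField_transChart_eq hz X) h
    rw [← fderiv_rightMomentum_sectionCoord hL hz, ← map_add]
    exact (congrArg (vecAct _ _) e).trans (vecAct_transDeriv hz (hq X') (hθ X' X₁') _)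
  rw [dThetaMinus, hterm X X₁ X' X₁' η h, hterm X' X₁' X X₁ η' h', hbr]
  ring

end AdaptedCoordinates

end LieGroupoid

/-! ### Linear coordinates on Vβ ⊕ Vα at u = 0 -/

namespace LieGroupoid

variable {n m : ℕ} {G M : Type*}
  [TopologicalSpace G] [ChartedSpace (EuclideanSpace ℝ (Fin (n + m))) G]
  [IsManifold (𝓡 (n + m)) ∞ G]
  [TopologicalSpace M] [ChartedSpace (EuclideanSpace ℝ (Fin n)) M]
  [IsManifold (𝓡 n) ∞ M]
  {𝒢 : LieGroupoid n m G M}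

namespace AdaptedCoordinates

variable {x₀ : M} {c : 𝒢.AdaptedCoordinates x₀} {Y : 𝒢.LocalBisection} {z : Coord n m} {L : G → ℝ}

/-- When v = 0 the right factor (b(x, u), 0) is an identity, so p(x, u, 0) = u and R(x, 0) is the
identity matrix. -/
theorem curveDeriv_snd_of_snd_eq_zero (hz : z ∈ c.chartDom Y) (hz2 : z.2 = 0) (ξ : Fin m → ℝ) :
    (c.curveDeriv z ξ).2 = -ξ := by
  have hP : HasFDerivAt c.pMap (fderiv ℝ c.pMap ((z.1, 0), z.2)) ((z.1, 0), z.2) :=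
    ((c.contDiffOn_pMap.contDiffAt (c.isOpen_pDom.mem_nhds (mem_pDom hz))).differentiableAt
      (by simp)).hasFDerivAt
  have h1 : HasFDerivAt (fun u : Fin m → ℝ => (((z.1, u), z.2) : Coord n m × (Fin m → ℝ)))
      ((ContinuousLinearMap.inl ℝ _ _).comp (ContinuousLinearMap.inr ℝ _ _)) 0 :=
    HasFDerivAt.comp (g := fun w : Coord n m => (w, z.2)) (0 : Fin m → ℝ)
      (hasFDerivAt_prodMk_left _ _) (hasFDerivAt_prodMk_right _ _)
  have h2 := HasFDerivAt.comp (g := c.pMap) (0 : Fin m → ℝ) hP h1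
  have hO : IsOpen (c.coord.target ∩ (fun w => 𝒢.tgt (c.coord.symm w)) ⁻¹' c.baseDom) :=
    c.contMDiffOn_tgt_symm.continuousOn.isOpen_inter_preimage c.coord.open_target c.isOpen_baseDom
  have h0 : (z.1, (0 : Fin m → ℝ)) ∈
      c.coord.target ∩ (fun w => 𝒢.tgt (c.coord.symm w)) ⁻¹' c.baseDom := by
    refine ⟨(fst_zero_mem_bDom hz).1, ?_⟩
    change 𝒢.unit (𝒢.tgt (c.coord.symm (z.1, 0))) ∈ c.coord.source
    rw [symm_fst_zero hz, 𝒢.tgt_unit]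
    exact unit_mem_of_mem_chartDom hz
  have e : (c.pMap ∘ fun u : Fin m → ℝ => (((z.1, u), z.2) : Coord n m × (Fin m → ℝ)))
      =ᶠ[𝓝 0] id := by
    have hc : Continuous fun u : Fin m → ℝ => ((z.1, u) : Coord n m) := by fun_prop
    filter_upwards [hc.continuousAt.preimage_mem_nhds (hO.mem_nhds h0)] with u hu
    change (c.coord (𝒢.mul (c.coord.symm (z.1, u)) (c.coord.symm (c.bMap (z.1, u), z.2)))).2 = u
    rw [hz2, bMap, c.symm_mk_zero hu.2, 𝒢.mul_unit, c.coord.right_inv hu.1]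
  rw [curveDeriv_snd]
  exact congrArg Neg.neg
    (DFunLike.congr_fun (h2.unique ((hasFDerivAt_id 0).congr_of_eventuallyEq e)) ξ)

theorem rightFieldCoord_snd (hz : z ∈ c.chartDom Y) (hz2 : z.2 = 0) (X : 𝒢.AlgSection) :
    (c.rightFieldCoord Y X z).2 = c.sectionCoord Y X z := by
  rw [rightFieldCoord, Prod.snd_neg, curveDeriv_snd_of_snd_eq_zero hz hz2, neg_neg]

/-- The function β(x, u) can be recovered from β(R_Υ(x, u)) through the bisection, so Tβ-vertical
vectors are killed by the derivative of b. At u = 0 that derivative is the identity on x-directions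
because b(x, 0) = x. -/
theorem eq_zero_of_transDeriv_mem_vertTgt (hz : z ∈ c.chartDom Y) (hz2 : z.2 = 0) {w : Coord n m}
    (hw : (c.transDeriv Y z w : TangentSpace (𝓡 (n + m)) (c.transChart Y z)) ∈
      𝒢.vertTgt (c.transChart Y z)) (hw2 : w.2 = 0) : w = 0 := by
  have hd := tgt_mem_of_mem_chartDom hz
  have hzt := mem_target_of_mem_chartDom hz
  have htgt : ∀ w ∈ c.chartDom Y, 𝒢.src (Y.secTgt (𝒢.tgt (c.transChart Y w))) =
      𝒢.tgt (c.coord.symm w) := fun w hw => by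
    have h := tgt_mem_of_mem_chartDom hw
    change 𝒢.src (Y.secTgt (𝒢.tgt (Y.rightTrans (c.coord.symm w)))) = _
    rw [Y.tgt_rightTrans h, Y.secTgt_tgt_secSrc h, Y.src_secSrc _ h]
  have hcod : 𝒢.tgt (c.transChart Y z) ∈ Y.cod := by
    change 𝒢.tgt (Y.rightTrans (c.coord.symm z)) ∈ Y.cod
    rw [Y.tgt_rightTrans hd]
    exact Y.tgt_secSrc_mem hd
  have hze : (z.1, (0 : Fin m → ℝ)) = z := by rw [← hz2]
  have hb : 𝒢.tgt (c.coord.symm z) ∈ c.baseCoord.source := by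
    have := (fst_zero_mem_bDom hz).2
    rwa [hze] at this
  have hF : MDifferentiableAt (𝓡 n) 𝓘(ℝ, Fin n → ℝ)
      (fun y => c.baseCoord (𝒢.src (Y.secTgt y))) (𝒢.tgt (c.transChart Y z)) := by
    have h1 : ContMDiffAt (𝓡 n) (𝓡 n) ∞ (fun y => 𝒢.src (Y.secTgt y))
        (𝒢.tgt (c.transChart Y z)) :=
      𝒢.contMDiff_src.contMDiffAt.comp _
        (Y.contMDiffOn_secTgt.contMDiffAt (Y.isOpen_cod.mem_nhds hcod))
    refine (ContMDiffAt.comp (𝒢.tgt (c.transChart Y z)) (g := c.baseCoord)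
      (c.contMDiffOn_baseCoord.contMDiffAt (c.baseCoord.open_source.mem_nhds ?_))
      h1).mdifferentiableAt (by simp)
    rw [htgt z hz]
    exact hb
  have h1 := mderiv_apply_mderiv rfl hF
    (𝒢.contMDiff_tgt.mdifferentiableAt (x := c.transChart Y z) (by simp)) (c.transDeriv Y z w)
  have hw' : mderiv (𝓡 (n + m)) (𝓡 n) 𝒢.tgt (c.transChart Y z) (c.transDeriv Y z w) = 0 := hw
  have hFt : MDifferentiableAt (𝓡 (n + m)) 𝓘(ℝ, Fin n → ℝ)
      ((fun y => c.baseCoord (𝒢.src (Y.secTgt y))) ∘ 𝒢.tgt) (c.transChart Y z) :=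
    MDifferentiableAt.comp _ hF (𝒢.contMDiff_tgt.mdifferentiableAt (by simp))
  rw [hw', map_zero, mderiv_comp_transDeriv hz hFt] at h1
  have e : (fun w => ((fun y => c.baseCoord (𝒢.src (Y.secTgt y))) ∘ 𝒢.tgt) (c.transChart Y w))
      =ᶠ[𝓝 z] c.bMap := by
    filter_upwards [(c.isOpen_chartDom Y).mem_nhds hz] with w hw
      using congrArg c.baseCoord (htgt w hw)
  rw [e.fderiv_eq] at h1
  have hbd : HasFDerivAt c.bMap (fderiv ℝ c.bMap z) (z.1, 0) := by
    rw [hze]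
    exact ((c.contMDiffOn_bMap.contDiffOn.contDiffAt
      (c.isOpen_bDom.mem_nhds ⟨hzt, hb⟩)).differentiableAt (by simp)).hasFDerivAt
  have h2 := HasFDerivAt.comp (g := c.bMap) (f := fun x => (x, (0 : Fin m → ℝ))) z.1 hbd
    (hasFDerivAt_prodMk_left z.1 (0 : Fin m → ℝ))
  have e2 : (c.bMap ∘ fun x => (x, (0 : Fin m → ℝ))) =ᶠ[𝓝 z.1] id := by
    have hc : Continuous fun x : Fin n → ℝ => ((x, 0) : Coord n m) := by fun_prop
    filter_upwards [hc.continuousAt.preimage_mem_nhds ((c.isOpen_chartDom Y).mem_nhds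
      (by rwa [hze]))] with x hx using bMap_fst_zero hx
  have h3 := DFunLike.congr_fun (h2.unique ((hasFDerivAt_id z.1).congr_of_eventuallyEq e2)) w.1
  refine Prod.ext ?_ hw2
  refine h3.symm.trans ((congrArg (fderiv ℝ c.bMap z) ?_).trans h1.symm)
  exact Prod.ext rfl hw2.symm

/-- The vector is the velocity of k ↦ k⁻¹h, and β(k⁻¹h) = β(h). -/
theorem transDeriv_curveDeriv_mem_vertTgt (hz : z ∈ c.chartDom Y) (ξ : Fin m → ℝ) :
    (c.transDeriv Y z (c.curveDeriv z ξ) : TangentSpace (𝓡 (n + m)) (c.transChart Y z)) ∈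
      𝒢.vertTgt (c.transChart Y z) := by
  have h0 : c.coord (c.curve z 0) = z := by
    rw [curve_zero hz, c.coord.right_inv (mem_target_of_mem_chartDom hz)]
  have he := inv_fiberCurve_mul_transChart hz
  have hd : MDifferentiableAt 𝓘(ℝ, Fin m → ℝ) (𝓡 (n + m)) (fun ξ =>
      𝒢.mul (𝒢.inv (c.fiberCurve (𝒢.src (c.transChart Y z)) ξ)) (c.transChart Y z)) 0 := by
    refine MDifferentiableAt.congr_of_eventuallyEq ?_ he
    exact MDifferentiableAt.comp (0 : Fin m → ℝ) (by rw [h0]; exact mdifferentiableAt_transChart hz)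
      (hasFDerivAt_coord_curve hz).hasMFDerivAt.mdifferentiableAt
  have h1 := mderiv_apply_mderiv (x := c.transChart Y z) (y := 0) (γ := fun ξ =>
      𝒢.mul (𝒢.inv (c.fiberCurve (𝒢.src (c.transChart Y z)) ξ)) (c.transChart Y z))
    (he.self_of_nhds.trans (congrArg (c.transChart Y) h0))
    (𝒢.contMDiff_tgt.mdifferentiableAt (by simp)) hd ξ
  have e : (𝒢.tgt ∘ fun ξ => 𝒢.mul (𝒢.inv (c.fiberCurve (𝒢.src (c.transChart Y z)) ξ))
      (c.transChart Y z)) =ᶠ[𝓝 0] fun _ => 𝒢.tgt (c.transChart Y z) := by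
    filter_upwards [eventually_src_fiberCurve (src_transChart_mem hz)] with ξ hξ
      using 𝒢.tgt_mul _ _ ((𝒢.tgt_inv _).trans hξ)
  rw [e.mderiv_eq, mderiv_const, mderiv_inv_fiberCurve_mul hz] at h1
  exact h1

theorem transDeriv_mem_vertSrc_iff (hz : z ∈ c.chartDom Y) (w : Coord n m) :
    (c.transDeriv Y z w : TangentSpace (𝓡 (n + m)) (c.transChart Y z)) ∈
      𝒢.vertSrc (c.transChart Y z) ↔ w.1 = 0 := by
  have hs : MDifferentiableAt (𝓡 (n + m)) (𝓡 n) 𝒢.src (c.transChart Y z) :=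
    𝒢.contMDiff_src.mdifferentiableAt (by simp)
  constructor
  · intro hw
    have hw' : mderiv (𝓡 (n + m)) (𝓡 n) 𝒢.src (c.transChart Y z) (c.transDeriv Y z w) = 0 := hw
    have hb : MDifferentiableAt (𝓡 n) 𝓘(ℝ, Fin n → ℝ) c.baseCoord (𝒢.src (c.transChart Y z)) :=
      (c.contMDiffOn_baseCoord.contMDiffAt (c.baseCoord.open_source.mem_nhds
        (c.mem_baseCoord_source (src_transChart_mem hz)))).mdifferentiableAt (by simp)
    have h1 := mderiv_apply_mderiv rfl hb hs (c.transDeriv Y z w)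
    rw [hw', map_zero, mderiv_comp_transDeriv hz (MDifferentiableAt.comp _ hb hs)] at h1
    have e : (fun w => (c.baseCoord ∘ 𝒢.src) (c.transChart Y w)) =ᶠ[𝓝 z] Prod.fst := by
      filter_upwards [(c.isOpen_chartDom Y).mem_nhds hz] with w hw
        using baseCoord_src_transChart hw
    rw [e.fderiv_eq, fderiv_fst] at h1
    exact h1.symm
  · intro hw
    obtain ⟨a, w⟩ := w
    obtain rfl : a = 0 := hw
    have h1 := mderiv_apply_mderiv (γ := fun t => c.transChart Y (z.1, t)) (y := z.2) rfl hs
      (mdifferentiableAt_transChart_snd hz) w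
    have e : (𝒢.src ∘ fun t => c.transChart Y (z.1, t)) =ᶠ[𝓝 z.2]
        fun _ => 𝒢.src (c.transChart Y z) := by
      filter_upwards [eventually_snd_mem_chartDom hz] with t ht using src_transChart_snd hz ht
    rw [e.mderiv_eq, mderiv_const, mderiv_transChart_snd hz] at h1
    exact h1

/-- With h = R_Υ(z), translate the family t ↦ R_Υ(x, t) back by h⁻¹; its velocity lies in the fibre
of AG over β(h), extends to a section, and left translation by h restores the original velocity. -/
theorem exists_leftField_eq [T2Space M] (hz : z ∈ c.chartDom Y) (η : Fin m → ℝ) :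
    ∃ X : 𝒢.AlgSection, 𝒢.leftField X (c.transChart Y z) = c.transDeriv Y z (0, η) := by
  have hφ : ContMDiffAt 𝓘(ℝ, Fin m → ℝ) (𝓡 (n + m)) ∞ (fun t => c.transChart Y (z.1, t)) z.2 :=
    ContMDiffAt.comp z.2 ((c.contMDiffOn_transChart Y).contMDiffAt
      ((c.isOpen_chartDom Y).mem_nhds hz)) (contDiff_prodMk_right z.1).contMDiff.contMDiffAt
  have hsrc : ∀ᶠ t in 𝓝 z.2, 𝒢.tgt (𝒢.inv (c.transChart Y z)) =
      𝒢.src (c.transChart Y (z.1, t)) := by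
    filter_upwards [eventually_snd_mem_chartDom hz] with t ht
    rw [𝒢.tgt_inv, src_transChart_snd hz ht]
  have hκ := (𝒢.contMDiffAt_mul (contMDiffAt_const (c := 𝒢.inv (c.transChart Y z))) hφ
    hsrc).mdifferentiableAt (by simp)
  have hκs : ∀ᶠ t in 𝓝 z.2, 𝒢.mul (𝒢.inv (c.transChart Y z)) (c.transChart Y (z.1, t)) ∈
      𝒢.src ⁻¹' {𝒢.tgt (c.transChart Y z)} := by
    filter_upwards [hsrc] with t ht using (𝒢.src_mul _ _ ht).trans (𝒢.src_inv _)
  have h0 : 𝒢.mul (𝒢.inv (c.transChart Y z)) (c.transChart Y (z.1, z.2)) =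
      𝒢.unit (𝒢.tgt (c.transChart Y z)) := 𝒢.inv_mul _
  have hmem := mderiv_apply_mderiv
    (γ := fun t => 𝒢.mul (𝒢.inv (c.transChart Y z)) (c.transChart Y (z.1, t))) (y := z.2) h0
    (𝒢.contMDiff_src.mdifferentiableAt (by simp)) hκ η
  have e : (𝒢.src ∘ fun t => 𝒢.mul (𝒢.inv (c.transChart Y z)) (c.transChart Y (z.1, t)))
      =ᶠ[𝓝 z.2] fun _ => 𝒢.tgt (c.transChart Y z) := hκs
  rw [e.mderiv_eq, mderiv_const] at hmem
  obtain ⟨X, hX⟩ := 𝒢.exists_algSection (𝒢.tgt (c.transChart Y z)) ⟨_, hmem⟩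
  refine ⟨X, ?_⟩
  have h1 := mderivWithin_apply_mderiv
    (γ := fun t => 𝒢.mul (𝒢.inv (c.transChart Y z)) (c.transChart Y (z.1, t))) (y := z.2) h0
    (𝒢.mdifferentiableWithinAt_mul_left (c.transChart Y z)) hκ hκs η
  have e2 : ((fun h => 𝒢.mul (c.transChart Y z) h) ∘
      fun t => 𝒢.mul (𝒢.inv (c.transChart Y z)) (c.transChart Y (z.1, t))) =ᶠ[𝓝 z.2]
      fun t => c.transChart Y (z.1, t) := by
    filter_upwards [hsrc] with t ht
      using 𝒢.mul_inv_cancel_left ((𝒢.tgt_inv _).symm.trans ht)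
  rw [e2.mderiv_eq, mderiv_transChart_snd hz] at h1
  refine Eq.trans ?_ h1
  exact congrArg (fun a : 𝒢.algFiber (𝒢.tgt (c.transChart Y z)) =>
    mderivWithin (𝓡 (n + m)) (𝓡 (n + m)) (fun h => 𝒢.mul (c.transChart Y z) h)
      (𝒢.src ⁻¹' {𝒢.tgt (c.transChart Y z)}) (𝒢.unit (𝒢.tgt (c.transChart Y z))) a.1) hX

theorem exists_sectionCoord_eq [T2Space M] (hz : z ∈ c.chartDom Y) (ξ : Fin m → ℝ) :
    ∃ X : 𝒢.AlgSection, c.sectionCoord Y X z = ξ := by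
  have hyD := src_transChart_mem hz
  obtain ⟨X, hX⟩ := 𝒢.exists_algSection _ (fiberEquiv hyD ξ)
  refine ⟨X, ?_⟩
  rw [sectionCoord, hX]
  exact fiberCoord_fiberVec hyD ξ

/-- The `u`-components of the first component of an element of `V β ⊕ V α`. -/
noncomputable def tgtPart (c : 𝒢.AdaptedCoordinates x₀) (Y : 𝒢.LocalBisection) (h : G) :
    𝒢.PFiber h →ₗ[ℝ] (Fin m → ℝ) where
  toFun a := (mderiv (𝓡 (n + m)) 𝓘(ℝ, Coord n m) (c.transChart Y).symm h a.1.1).2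
  map_add' a b := congrArg Prod.snd (map_add
    (mderiv (𝓡 (n + m)) 𝓘(ℝ, Coord n m) (c.transChart Y).symm h) a.1.1 b.1.1)
  map_smul' r a := congrArg Prod.snd (map_smul
    (mderiv (𝓡 (n + m)) 𝓘(ℝ, Coord n m) (c.transChart Y).symm h) r a.1.1)

/-- The `u`-components of the second component of an element of `V β ⊕ V α`. -/
noncomputable def srcPart (c : 𝒢.AdaptedCoordinates x₀) (Y : 𝒢.LocalBisection) (h : G) :
    𝒢.PFiber h →ₗ[ℝ] (Fin m → ℝ) where
  toFun a := (mderiv (𝓡 (n + m)) 𝓘(ℝ, Coord n m) (c.transChart Y).symm h a.2.1).2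
  map_add' a b := congrArg Prod.snd (map_add
    (mderiv (𝓡 (n + m)) 𝓘(ℝ, Coord n m) (c.transChart Y).symm h) a.2.1 b.2.1)
  map_smul' r a := congrArg Prod.snd (map_smul
    (mderiv (𝓡 (n + m)) 𝓘(ℝ, Coord n m) (c.transChart Y).symm h) r a.2.1)

theorem transDeriv_srcPart (hz : z ∈ c.chartDom Y) (a : 𝒢.PFiber (c.transChart Y z)) :
    (a.2.1 : TangentSpace (𝓡 (n + m)) (c.transChart Y z)) =
      c.transDeriv Y z (0, c.srcPart Y (c.transChart Y z) a) := by
  have h1 := transDeriv_mderiv_transChart_symm hz a.2.1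
  have h2 : (mderiv (𝓡 (n + m)) 𝓘(ℝ, Coord n m) (c.transChart Y).symm (c.transChart Y z)
      a.2.1).1 = 0 := by
    rw [← transDeriv_mem_vertSrc_iff hz]
    exact (congrArg (fun v : TangentSpace (𝓡 (n + m)) (c.transChart Y z) =>
      v ∈ 𝒢.vertSrc (c.transChart Y z)) h1).mpr a.2.2
  refine h1.symm.trans (congrArg (c.transDeriv Y z) ?_)
  exact Prod.ext h2 rfl

theorem tgtPart_eq_sectionCoord (hz : z ∈ c.chartDom Y) (hz2 : z.2 = 0)
    {a : 𝒢.PFiber (c.transChart Y z)} {X : 𝒢.AlgSection}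
    (h : (a.1 : TangentSpace (𝓡 (n + m)) (c.transChart Y z)) =
      𝒢.rightField X (c.transChart Y z)) :
    c.tgtPart Y (c.transChart Y z) a = c.sectionCoord Y X z := by
  rw [← rightFieldCoord_snd hz hz2]
  refine congrArg Prod.snd ((congrArg (mderiv (𝓡 (n + m)) 𝓘(ℝ, Coord n m) (c.transChart Y).symm
    (c.transChart Y z)) (h.trans (rightField_transChart_eq hz X))).trans
    (mderiv_transChart_symm hz _))

/-- The difference of the two vectors is β-vertical with zero u-component, hence zero. Thus at u = 0
an element of Vβ is determined by its u-component and is the value of a right-invariant field. -/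
theorem rightField_eq_of_tgtPart_eq (hz : z ∈ c.chartDom Y) (hz2 : z.2 = 0)
    {a : 𝒢.PFiber (c.transChart Y z)} {X : 𝒢.AlgSection}
    (h : c.tgtPart Y (c.transChart Y z) a = c.sectionCoord Y X z) :
    (a.1 : TangentSpace (𝓡 (n + m)) (c.transChart Y z)) =
      𝒢.rightField X (c.transChart Y z) := by
  let u : EuclideanSpace ℝ (Fin (n + m)) := a.1.1
  have h1 : _ = u := transDeriv_mderiv_transChart_symm hz a.1.1
  set w := mderiv (𝓡 (n + m)) 𝓘(ℝ, Coord n m) (c.transChart Y).symm (c.transChart Y z) a.1.1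
    with hw
  have h2 : w + c.curveDeriv z (c.sectionCoord Y X z) = 0 := by
    refine eq_zero_of_transDeriv_mem_vertTgt hz hz2 ?_ ?_
    · have h3 : c.transDeriv Y z (w + c.curveDeriv z (c.sectionCoord Y X z)) =
          u + c.transDeriv Y z (c.curveDeriv z (c.sectionCoord Y X z)) :=
        (map_add _ _ _).trans (congrArg (fun v : EuclideanSpace ℝ (Fin (n + m)) =>
          v + c.transDeriv Y z (c.curveDeriv z (c.sectionCoord Y X z))) h1)
      exact (congrArg (fun v : TangentSpace (𝓡 (n + m)) (c.transChart Y z) =>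
        v ∈ 𝒢.vertTgt (c.transChart Y z)) h3).mpr
        (add_mem a.1.2 (transDeriv_curveDeriv_mem_vertTgt hz _))
    · rw [Prod.snd_add, curveDeriv_snd_of_snd_eq_zero hz hz2, ← h]
      exact add_neg_cancel _
  rw [rightField_transChart_eq hz]
  exact h1.symm.trans (congrArg (c.transDeriv Y z) (eq_neg_of_add_eq_zero_left h2))

end AdaptedCoordinates

end LieGroupoid

/-! ### Nondegeneracy of the Poincaré–Cartan section -/

namespace LieGroupoid

variable {n m : ℕ} {G M : Type*}
  [TopologicalSpace G] [ChartedSpace (EuclideanSpace ℝ (Fin (n + m))) G]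
  [IsManifold (𝓡 (n + m)) ∞ G]
  [TopologicalSpace M] [ChartedSpace (EuclideanSpace ℝ (Fin n)) M]
  [IsManifold (𝓡 n) ∞ M]
  {𝒢 : LieGroupoid n m G M}

/-- The alternating bilinear form determined by a matrix and two systems of coordinates. -/
theorem exists_bilinForm_eq {V ι : Type*} [AddCommGroup V] [Module ℝ V] [Fintype ι]
    [DecidableEq ι] (A : Matrix ι ι ℝ) (p q : V →ₗ[ℝ] (ι → ℝ)) :
    ∃ Ω : LinearMap.BilinForm ℝ V, ∀ a b, Ω a b =
      -(Matrix.vecMul (q a) A ⬝ᵥ p b - Matrix.vecMul (q b) A ⬝ᵥ p a) := by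
  let T : LinearMap.BilinForm ℝ V := (Matrix.toBilin' A).compl₁₂ q p
  have h : ∀ a b, T a b = Matrix.vecMul (q a) A ⬝ᵥ p b :=
    fun a b => (Matrix.toBilin'_apply' _ _ _).trans (Matrix.dotProduct_mulVec _ _ _)
  refine ⟨LinearMap.flip T - T, fun a b => ?_⟩
  rw [LinearMap.sub_apply, LinearMap.sub_apply, LinearMap.flip_apply, h, h]
  ring

namespace AdaptedCoordinates

variable {x₀ : M} {c : 𝒢.AdaptedCoordinates x₀} {Y : 𝒢.LocalBisection} {z : Coord n m} {L : G → ℝ}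

theorem exists_pFiber_eq (hz : z ∈ c.chartDom Y) (hz2 : z.2 = 0) (ξ η : Fin m → ℝ) :
    ∃ a : 𝒢.PFiber (c.transChart Y z),
      c.tgtPart Y (c.transChart Y z) a = ξ ∧ c.srcPart Y (c.transChart Y z) a = η := by
  refine ⟨(⟨c.transDeriv Y z (c.curveDeriv z (-ξ)), transDeriv_curveDeriv_mem_vertTgt hz _⟩,
    ⟨c.transDeriv Y z (0, η), (transDeriv_mem_vertSrc_iff hz _).2 rfl⟩), ?_, ?_⟩
  · refine (congrArg Prod.snd (mderiv_transChart_symm hz _)).trans ?_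
    rw [curveDeriv_snd_of_snd_eq_zero hz hz2, neg_neg]
  · exact congrArg Prod.snd (mderiv_transChart_symm hz _)

theorem pFiber_eq_zero [T2Space M] (hz : z ∈ c.chartDom Y) (hz2 : z.2 = 0)
    {a : 𝒢.PFiber (c.transChart Y z)} (h1 : c.tgtPart Y (c.transChart Y z) a = 0)
    (h2 : c.srcPart Y (c.transChart Y z) a = 0) : a = 0 := by
  refine Prod.ext (Subtype.ext ?_) (Subtype.ext ?_)
  · obtain ⟨X, hX⟩ := exists_sectionCoord_eq (c := c) hz 0
    refine (rightField_eq_of_tgtPart_eq hz hz2 (h1.trans hX.symm)).trans ?_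
    rw [rightField_transChart_eq hz, rightFieldCoord, hX, map_zero, neg_zero]
    exact map_zero (c.transDeriv Y z)
  · refine (transDeriv_srcPart hz a).trans ?_
    rw [h2]
    exact map_zero (c.transDeriv Y z)

/-- Ω is written down directly from 𝔽L in the coordinates (ξ, η) of Vβ ⊕ Vα, and agrees with -dΘ⁻ on
all invariant sections by the formula for `dThetaMinus`. -/
theorem poincareCartanNondegenerateAt [T2Space M] (hL : ContMDiff (𝓡 (n + m)) 𝓘(ℝ, ℝ) ∞ L)
    (hz : z ∈ c.chartDom Y) (hz2 : z.2 = 0) (hdet : (c.FL L Y z).det ≠ 0) :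
    𝒢.PoincareCartanNondegenerateAt L (c.transChart Y z) := by
  obtain ⟨Ω, hT⟩ := exists_bilinForm_eq (c.FL L Y z) (c.tgtPart Y (c.transChart Y z))
    (c.srcPart Y (c.transChart Y z))
  have hleft : ∀ a, (∀ b, Ω a b = 0) → a = 0 := by
    intro a ha
    refine pFiber_eq_zero hz hz2 ?_ ?_
    -- Testing against vectors with ξ = 0 shows that 𝔽L annihilates the ξ-part of a from the right;
    -- testing below against vectors with η = 0 shows that it annihilates the η-part from the left.
    · by_contra h0
      refine hdet (Matrix.exists_mulVec_eq_zero_iff.1 ⟨_, h0, ?_⟩)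
      refine dotProduct_eq_zero _ fun η => ?_
      obtain ⟨b, hb1, hb2⟩ := exists_pFiber_eq hz hz2 0 η
      have h := ha b
      rw [hT, hb1, hb2, dotProduct_zero, zero_sub, neg_neg, ← Matrix.dotProduct_mulVec] at h
      rwa [dotProduct_comm]
    · by_contra h0
      refine hdet (Matrix.exists_vecMul_eq_zero_iff.1 ⟨_, h0, ?_⟩)
      refine dotProduct_eq_zero _ fun ξ => ?_
      obtain ⟨b, hb1, hb2⟩ := exists_pFiber_eq hz hz2 ξ 0
      have h := ha b
      rwa [hT, hb1, hb2, Matrix.zero_vecMul, zero_dotProduct, sub_zero, neg_eq_zero] at h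
  refine ⟨Ω, ?_, hleft, fun b hb => hleft b fun a => ?_⟩
  · intro X X₁ X' X₁' a b ha1 ha2 hb1 hb2
    rw [hT, dThetaMinus_transChart hL hz X X₁ X' X₁' (ha2.symm.trans (transDeriv_srcPart hz a))
      (hb2.symm.trans (transDeriv_srcPart hz b)), tgtPart_eq_sectionCoord hz hz2 ha1,
      tgtPart_eq_sectionCoord hz hz2 hb1]
  -- Right nondegeneracy follows from left nondegeneracy because Ω is antisymmetric.
  · have h := hb a
    rw [hT] at h ⊢
    linarith

/-- A left null vector η of 𝔽L gives the element with coordinates (0, η) in the radical of any Ω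
representing -dΘ⁻. To evaluate such an Ω, every fibre element is realized by invariant fields of
global sections. -/
theorem det_FL_ne_zero_of_poincareCartanNondegenerateAt [T2Space M]
    (hL : ContMDiff (𝓡 (n + m)) 𝓘(ℝ, ℝ) ∞ L) (hz : z ∈ c.chartDom Y) (hz2 : z.2 = 0)
    (h : 𝒢.PoincareCartanNondegenerateAt L (c.transChart Y z)) : (c.FL L Y z).det ≠ 0 := by
  obtain ⟨Ω, hΩ, hnd, -⟩ := h
  intro hdet
  obtain ⟨η, hη0, hη⟩ := Matrix.exists_vecMul_eq_zero_iff.2 hdet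
  obtain ⟨a, ha1, ha2⟩ := exists_pFiber_eq (c := c) hz hz2 0 η
  obtain ⟨X, hX⟩ := exists_sectionCoord_eq (c := c) hz 0
  have haX := rightField_eq_of_tgtPart_eq hz hz2 (ha1.trans hX.symm)
  obtain ⟨X₁, hX₁⟩ := exists_leftField_eq (c := c) hz η
  have haX₁ := (transDeriv_srcPart hz a).trans ((congrArg (fun η => c.transDeriv Y z (0, η))
    ha2).trans hX₁.symm)
  have ha : a = 0 := hnd a fun b => by
    obtain ⟨X', hX'⟩ := exists_sectionCoord_eq (c := c) hz (c.tgtPart Y _ b)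
    obtain ⟨X₁', hX₁'⟩ := exists_leftField_eq (c := c) hz (c.srcPart Y _ b)
    rw [hΩ X X₁ X' X₁' a b haX haX₁ (rightField_eq_of_tgtPart_eq hz hz2 hX'.symm)
      ((transDeriv_srcPart hz b).trans hX₁'.symm),
      dThetaMinus_transChart hL hz X X₁ X' X₁' hX₁ hX₁', hη, hX, zero_dotProduct, dotProduct_zero,
      sub_zero, neg_zero]
  rw [ha, map_zero] at ha2
  exact hη0 ha2.symm

end AdaptedCoordinates

end LieGroupoid

/-! ### The theorem, read at the coordinates (x₀, 0) of h₀ -/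

theorem mainTheorem2 {n m : ℕ} {G M : Type*}
    [TopologicalSpace G] [T2Space G] [ChartedSpace (EuclideanSpace ℝ (Fin (n + m))) G]
    [IsManifold (𝓡 (n + m)) ∞ G]
    [TopologicalSpace M] [T2Space M] [ChartedSpace (EuclideanSpace ℝ (Fin n)) M]
    [IsManifold (𝓡 n) ∞ M]
    (𝒢 : LieGroupoid n m G M)
    (L : G → ℝ) (hL : ContMDiff (𝓡 (n + m)) 𝓘(ℝ, ℝ) ∞ L)
    (g₀ h₀ : G) (hsol : 𝒢.IsDELSolution L g₀ h₀)
    (x₀ : M) (hg₀ : 𝒢.tgt g₀ = x₀) (hh₀ : 𝒢.src h₀ = x₀)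
    (c : 𝒢.AdaptedCoordinates x₀)
    (W : Set G) (hW : 𝒢.IsSymmetricNhd c.coord.source x₀ W)
    (S₀ : 𝒢.LocalBisection) (hgS : g₀ ∈ S₀.carrier) (hS₀ : c.baseCoord.source ⊆ S₀.cod)
    (Y₀ : 𝒢.LocalBisection) (hhY : h₀ ∈ Y₀.carrier) (hY₀ : c.baseCoord.source ⊆ Y₀.dom) :
    List.TFAE
      [IsUnit (c.FL L Y₀ (c.baseCoord x₀, 0)).det,
        𝒢.PoincareCartanNondegenerateAt L h₀,
        𝒢.IsLocalDiffeoToDualAt (𝒢.legendreMinus L) h₀] ∧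
    ((IsUnit (c.FL L Y₀ (c.baseCoord x₀, 0)).det ∨
        𝒢.PoincareCartanNondegenerateAt L h₀ ∨
        𝒢.IsLocalDiffeoToDualAt (𝒢.legendreMinus L) h₀) →
      ∃ (A B : Set G) (Ψ : G → G),
        IsOpen A ∧ g₀ ∈ A ∧ A ⊆ S₀.leftTrans '' W ∧
        IsOpen B ∧ h₀ ∈ B ∧ B ⊆ Y₀.rightTrans '' W ∧
        (∀ g ∈ A, ∀ h, h ∈ B ∧ 𝒢.IsDELSolution L g h ↔ h = Ψ g) ∧
        𝒢.IsLocalEvolutionOperator L A B Ψ) := by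

  have hz := LieGroupoid.AdaptedCoordinates.base_mem_chartDom hY₀
  have hφ := LieGroupoid.AdaptedCoordinates.transChart_base hY₀ hh₀ hhY
  have h13 : (c.FL L Y₀ (c.baseCoord x₀, 0)).det ≠ 0 ↔
      𝒢.IsLocalDiffeoToDualAt (𝒢.legendreMinus L) h₀ := by
    rw [← hφ]
    exact ⟨LieGroupoid.AdaptedCoordinates.isLocalDiffeoToDualAt hL hz,
      LieGroupoid.AdaptedCoordinates.det_FL_ne_zero_of_isLocalDiffeoToDualAt hL hz⟩
  have h12 : (c.FL L Y₀ (c.baseCoord x₀, 0)).det ≠ 0 ↔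
      𝒢.PoincareCartanNondegenerateAt L h₀ := by
    rw [← hφ]
    exact ⟨LieGroupoid.AdaptedCoordinates.poincareCartanNondegenerateAt hL hz rfl,
      LieGroupoid.AdaptedCoordinates.det_FL_ne_zero_of_poincareCartanNondegenerateAt hL hz rfl⟩
  rw [isUnit_iff_ne_zero]
  refine ⟨?_, fun h => ?_⟩
  · tfae_have 1 ↔ 2 := h12
    tfae_have 1 ↔ 3 := h13
    tfae_finish
  · rw [← h12, ← h13, or_self, or_self] at h
    exact LieGroupoid.AdaptedCoordinates.exists_localEvolutionOperator hL hsol hg₀ hh₀ hW hgS hhY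
      hY₀ h
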